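/- Let $\Gamma\subset\mathbb R^3$ be a continuous graph: a connected union of finitely many points (vertices) and finitely many, but at least one, simple arcs (edges), each arc joining two of the vertices and meeting the vertices and the other arcs only at endpoints. The valence $d(q)$ of $q\in\Gamma$ is the number of edge ends at $q$ ($d(q)=2$ at interior points of edges), and $q$ is a topological vertex if $d(q)\ne2$. Write $dA$ for the area measure of $S^2$ and $x^+=\max(x,0)$. *Net total curvature.* A $\Gamma$-approximating polygonal graph $P$ is obtained by cutting $\Gamma$ into simple arcs at a finite set of points of $\Gamma$ (the vertices of $P$) which contains all topological vertices, and by taking as the edges of $P$ the chords of these arcs (chords of different arcs are different edges; crossings are allowed and are not vertices). Put $$\mathcal N(P)=\sum_q \frac14\int_{S^2}\Big[\sum_{i=1}^{d(q)}\chi_i(e)\Big]^+dA(e),$$ where $q$ runs over the vertices of $P$, $T_1,\dots,T_{d(q)}$ are the unit tangent vectors at $q$ to the edges of $P$, and $\chi_i(e)=-1$ if $\langle e,T_i\rangle>0$, $\chi_i(e)=+1$ otherwise. Define $\mathcal N(\Gamma)=\sup_P\mathcal N(P)\in[0,\infty]$, the supremum over all $\Gamma$-approximating polygonal graphs. *Net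 local maxima.* The double of a graph has the same vertices and two copies of each edge. A parameterization of the double by a $1$-manifold passes $d(q)$ times over $q$ (any point may be regarded as a vertex), each passage joining two of the $2d(q)$ edge ends over $q$. Let $\mathrm{nlm}(e,q)=\frac12(\mathrm{lmax}-\mathrm{lmin})$, where $\mathrm{lmax}$ and $\mathrm{lmin}$ are the numbers of those passages at which $\langle e,\cdot\rangle$ has a local maximum, respectively a local minimum. For a polygonal graph $P$ let $\mu_P(e)=\sum_q\mathrm{nlm}(e,q)^+$, the sum over its vertices; here the parameterization which runs along each edge and back on its second copy is used (if no edge at $q$ is orthogonal to $e$, all parameterizations give the same value). *Multiplicity.* For $e\in S^2$ a sequence $P_k$ of $\Gamma$-approximating polygonal graphs is refined with respect to $e$ if every vertex of $P_k$ is a vertex of $P_{k+1}$, $\mathcal N(P_k)\to\mathcal N(\Gamma)$, and each $P_k$, $k\ge1$, is obtained from some $\Gamma$-approximating polygonal graph, all of whose edges correspond to arcs of $\Gamma$ of diameter at most $1/k$, by inserting on each of these arcs at most two further vertices so that the resulting polygonal line has the same maximum and the same minimum of $\langle e,\cdot\rangle$ as the arc. The multiplicity $\mu(e)=\mu_\Gamma(e)\in[0,\infty]$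 is the limit of $\mu_{P_k}(e)$ for a sequence $P_k$ refined with respect to $e$. A point $q\in\Gamma$ is critical relative to $e$ if it is a topological vertex or if $\langle e,\cdot\rangle$ is not monotone on any open interval of $\Gamma$ containing $q$. **Theorem.** $\mathcal N(\Gamma)\in(0,\infty]$. For every $e\in S^2$ such a limit $\mu(e)$ exists, and for almost every $e$ it does not depend on the choice of the refined sequence. Whatever choices are made, $\mu$ is measurable (up to a null set) and $$\mathcal N(\Gamma)=\frac12\int_{S^2}\mu(e)\,dA(e).$$ For almost every $e\in S^2$, either $\mu(e)=+\infty$, or $\mu(e)\in\{\frac12,1,\frac32,\dots\}$, the set of critical points relative to $e$ is finite, and $$\mu(e)=\sum_{q\text{ critical relative to }e}\mathrm{nlm}(e,q)^+$$ for every parameterization of the double of $\Gamma$. If moreover $\mathcal N(\Gamma)<\infty$, then along each edge, in each of its two orientations, the one-sided unit tangent vector in the direction of motion exists at every point other than the final one and is continuous from the side towards which one moves; in particular, unit tangent vectors to all edge ends exist at every vertex. Also, if $\mathcal N(\Gamma)<\infty$, for almost every $e$ there are only finitely many critical points relative to $e$. -/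

import Mathlib

open Set Filter Topology MeasureTheory
open scoped ENNReal

noncomputable section

namespace NetCurvature

/-- Euclidean three-space. -/
abbrev E3 : Type := EuclideanSpace ℝ (Fin 3)

/-- The unit sphere `S²`. -/
abbrev S2 : Type := Metric.sphere (0 : E3) 1

/-- The area measure on `S²` (total mass `4π`). -/
def area : Measure S2 := (volume : Measure E3).toSphere

/-- The linear "height" function `⟨e, ·⟩`. -/
def height (e : S2) (x : E3) : ℝ := inner ℝ (e : E3) x

/-- The unit vector pointing from `x` to `y`. -/
def unitDir (x y : E3) : E3 := ‖y - x‖⁻¹ • (y - x)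

/-! ### Parameterizations of the double and net local maxima -/

/-- Let `B` be the set of ends of edges at a point `q`. The double of the graph has the ends
`B × Bool` over `q` (two copies of every edge). A parameterization of the double by a
one-dimensional manifold passes over `q` several times, and each passage joins two of these ends:
it is a perfect matching of `B × Bool`. -/
structure DoublePairing (B : Type) where
  mate : B × Bool → B × Bool
  mate_mate : ∀ x, mate (mate x) = x
  mate_ne : ∀ x, mate x ≠ x

/-- The parameterization which runs along each edge and back on its second copy. -/
def DoublePairing.standard (B : Type) : DoublePairing B where
  mate x := (x.1, !x.2)
  mate_mate x := by simp
  mate_ne x := by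
    intro h
    have := congrArg Prod.snd h
    simp at this

/-- The number of passages of the parameterization over `q` both of whose ends have property `p`.
Each passage consists of two ends, whence the division by `2`. -/
def DoublePairing.count {B : Type} (τ : DoublePairing B) (p : B → Prop) : ℝ :=
  ({x : B × Bool | p x.1 ∧ p (τ.mate x).1}.ncard : ℝ) / 2

/-- `½ (lmax - lmin)`: a passage is a local maximum if the height is at most that of `q` along
both of its ends (`below`), a local minimum if it is at least that of `q` along both (`above`). -/
def DoublePairing.nlm {B : Type} (τ : DoublePairing B) (below above : B → Prop) : ℝ :=
  (τ.count below - τ.count above) / 2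

/-- If each end goes either strictly down or strictly up then `nlm` is half the difference of the
down-valence and the up-valence; in particular it does not depend on the parameterization. -/
theorem DoublePairing.nlm_eq {B : Type} [Finite B] (τ : DoublePairing B) (below above : B → Prop)
    (h : ∀ b, below b ↔ ¬ above b) :
    τ.nlm below above = (({b | below b}.ncard : ℝ) - ({b | above b}.ncard : ℝ)) / 2 := by
  classical
  have := Fintype.ofFinite B
  have inj : Function.Injective τ.mate := fun x y hxy => by
    rw [← τ.mate_mate x, hxy, τ.mate_mate]
  have key : ∀ p q : B → Prop, (∀ b, p b ↔ ¬ q b) →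
      2 * {b | p b}.ncard = {x : B × Bool | p x.1 ∧ p (τ.mate x).1}.ncard
        + {x : B × Bool | p x.1 ∧ q (τ.mate x).1}.ncard := by
    intro p q hpq
    have h1 : {x : B × Bool | p x.1}.ncard = 2 * {b | p b}.ncard := by
      have : {x : B × Bool | p x.1} = {b | p b} ×ˢ (Set.univ : Set Bool) := by ext; simp
      rw [this, Set.ncard_prod, Set.ncard_univ]
      simp [mul_comm]
    rw [← h1, ← Set.ncard_union_eq]
    · congr 1
      ext x
      simp only [mem_ofPred_eq, mem_union]
      have := hpq (τ.mate x).1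
      tauto
    · rw [Set.disjoint_left]
      rintro x ⟨_, h2⟩ ⟨_, h3⟩
      exact (hpq _).1 h2 h3
  have hswap : {x : B × Bool | below x.1 ∧ above (τ.mate x).1}.ncard
      = {x : B × Bool | above x.1 ∧ below (τ.mate x).1}.ncard := by
    rw [← Set.ncard_image_of_injective _ inj]
    congr 1
    ext x
    simp only [mem_image, mem_ofPred_eq]
    constructor
    · rintro ⟨y, ⟨h1, h2⟩, rfl⟩
      exact ⟨h2, by rwa [τ.mate_mate]⟩
    · rintro ⟨h1, h2⟩
      exact ⟨τ.mate x, ⟨h2, by rwa [τ.mate_mate]⟩, τ.mate_mate x⟩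
  have k1 := key below above h
  have k2 := key above below (fun b => by have := h b; tauto)
  unfold DoublePairing.nlm DoublePairing.count
  rw [hswap] at k1
  have k1' := congrArg (Nat.cast : ℕ → ℝ) k1
  have k2' := congrArg (Nat.cast : ℕ → ℝ) k2
  push_cast at k1' k2'
  linarith

/-! ### Polygonal graphs -/

/-- A polygonal graph in `ℝ³`: finitely many vertices and finitely many straight edges, each
joining two distinct vertices. Edge number `i` is the segment from `fst i` to `snd i`. Several
edges may have the same endpoints and edges may cross: the edges are kept apart by their index. -/
structure PolygonalGraph where
  verts : Finset E3
  numEdges : ℕ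
  fst : Fin numEdges → E3
  snd : Fin numEdges → E3
  fst_mem : ∀ i, fst i ∈ verts
  snd_mem : ∀ i, snd i ∈ verts
  fst_ne_snd : ∀ i, fst i ≠ snd i

namespace PolygonalGraph

variable (P : PolygonalGraph)

/-- Initial point of an oriented edge. -/
def src (d : Fin P.numEdges × Bool) : E3 := if d.2 then P.fst d.1 else P.snd d.1

/-- Final point of an oriented edge. -/
def tgt (d : Fin P.numEdges × Bool) : E3 := if d.2 then P.snd d.1 else P.fst d.1

/-- The ends of edges at the vertex `q`: the oriented edges starting at `q`. -/
abbrev Star (q : E3) : Type := {d : Fin P.numEdges × Bool // P.src d = q}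

/-- The function `χ` of a unit vector `T`: `-1` on the open hemisphere with center `T`, and `1`
elsewhere. -/
def chi (T : E3) (e : S2) : ℝ := if 0 < height e T then -1 else 1

open Classical in
/-- `nc(q) = ¼ ∫_{S²} [∑ᵢ χᵢ(e)]⁺ dA(e)`, the sum being over the unit tangent vectors at `q`. -/
def nc (q : E3) : ℝ≥0∞ :=
  (1 / 4) * ∫⁻ e, ENNReal.ofReal ((∑ d : P.Star q, chi (unitDir q (P.tgt d.1)) e)⁺) ∂area

/-- The net total curvature of a polygonal graph. -/
def netCurv : ℝ≥0∞ := ∑ q ∈ P.verts, P.nc q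

/-- The net number of local maxima of the height at `q`. -/
def nlm (e : S2) (q : E3) : ℝ :=
  (DoublePairing.standard (P.Star q)).nlm
    (fun d => height e (P.tgt d.1) ≤ height e q) (fun d => height e q ≤ height e (P.tgt d.1))

/-- The multiplicity `μ_P(e)`, the sum of `nlm⁺(e, q)` over the vertices. -/
def mult (e : S2) : ℝ := ∑ q ∈ P.verts, (P.nlm e q)⁺

end PolygonalGraph

/-! ### Continuous graphs -/

/-- A continuous graph in `ℝ³`, connected and with at least one edge: finitely many points
(vertices) and finitely many simple arcs (edges), each joining two of the vertices; arcs meet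
the vertices and each other only at endpoints. Vertices of valence two are allowed. -/
structure ContinuousGraph where
  verts : Finset E3
  numEdges : ℕ
  numEdges_pos : 0 < numEdges
  arc : Fin numEdges → ℝ → E3
  arc_continuousOn : ∀ i, ContinuousOn (arc i) (Icc 0 1)
  arc_injOn : ∀ i, InjOn (arc i) (Icc 0 1)
  arc_zero_mem : ∀ i, arc i 0 ∈ verts
  arc_one_mem : ∀ i, arc i 1 ∈ verts
  arc_notMem_verts : ∀ i, ∀ t ∈ Ioo (0 : ℝ) 1, arc i t ∉ verts
  arc_disjoint : ∀ i j, ∀ s ∈ Ioo (0 : ℝ) 1, ∀ t ∈ Ioo (0 : ℝ) 1, arc i s = arc j t → i = j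
  connected : IsConnected ((verts : Set E3) ∪ ⋃ i, arc i '' Icc 0 1)

namespace ContinuousGraph

variable (G : ContinuousGraph)

/-- The closed edge number `i`, as a set of points. -/
def edge (i : Fin G.numEdges) : Set E3 := G.arc i '' Icc 0 1

/-- The point set of the graph. -/
def carrier : Set E3 := (G.verts : Set E3) ∪ ⋃ i, G.edge i

/-- The oriented edges: `(i, true)` is the arc number `i`, and `(i, false)` is the same arc run
backwards. -/
def path (d : Fin G.numEdges × Bool) (t : ℝ) : E3 :=
  if d.2 then G.arc d.1 t else G.arc d.1 (1 - t)

/-- The branches of the graph at a point `q`, that is, the oriented edges that can be followed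
away from `q`. If `q` is a vertex, these are the oriented edges starting at `q`;
if `q` is an interior point of an edge, these are the two orientations of that edge. -/
abbrev Branch (q : E3) : Type :=
  {d : Fin G.numEdges × Bool // ∃ t ∈ Ico (0 : ℝ) 1, G.path d t = q}

/-- The valence of a point. It is `2` at the interior points of edges. -/
def valence (q : E3) : ℕ := Nat.card (G.Branch q)

/-- The topological vertices: those of valence different from `2`. -/
def IsTopVertex (q : E3) : Prop := q ∈ G.carrier ∧ G.valence q ≠ 2

/-- The property `r` holds, for every small `ε > 0`, of `ε` and of the position `t` of `q` on the
oriented edge `d`. -/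
def Along (q : E3) (d : Fin G.numEdges × Bool) (r : ℝ → ℝ → Prop) : Prop :=
  ∃ t ∈ Ico (0 : ℝ) 1, G.path d t = q ∧ ∀ᶠ ε in 𝓝[>] (0 : ℝ), r t ε

/-- `q` is critical relative to `e`: it is a topological vertex, or there is no open interval of
the graph containing `q` on which the height is monotone. At a point of valence two, an open
interval containing `q` consists of pieces of its two branches, and the height is monotone on it
if and only if, moving away from `q`, it is nondecreasing along one of the branches and
nonincreasing along the other one. -/
def IsCritical (e : S2) (q : E3) : Prop :=
  q ∈ G.carrier ∧ (G.IsTopVertex q ∨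
    ¬ ∃ b b' : G.Branch q, b ≠ b' ∧
      G.Along q b.1 (fun t ε => MonotoneOn (fun s => height e (G.path b.1 s)) (Icc t (t + ε))) ∧
      G.Along q b'.1 (fun t ε => AntitoneOn (fun s => height e (G.path b'.1 s)) (Icc t (t + ε))))

/-- The net number of local maxima `nlm(e, q)` with respect to a parameterization of the double
of the graph. -/
def nlm (e : S2) (q : E3) (τ : DoublePairing (G.Branch q)) : ℝ :=
  τ.nlm
    (fun b => G.Along q b.1 (fun t ε => height e (G.path b.1 (t + ε)) ≤ height e q))
    (fun b => G.Along q b.1 (fun t ε => height e q ≤ height e (G.path b.1 (t + ε))))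

/-- The polygonal graph inscribed in `G` with the same vertices: each arc is replaced with its
chord. -/
def inscribed : PolygonalGraph where
  verts := G.verts
  numEdges := G.numEdges
  fst i := G.arc i 0
  snd i := G.arc i 1
  fst_mem := G.arc_zero_mem
  snd_mem := G.arc_one_mem
  fst_ne_snd i h := zero_ne_one (G.arc_injOn i (by simp) (by simp) h)

/-- `S` is another way to cut the point set of `G` into vertices and simple arcs, with the same
topological vertices and valences, only the vertices of valence two being arbitrary. The arc of
`S` number `i` is the part of `G` which corresponds to the edge number `i` of `S.inscribed`. -/
def IsSubdivision (S : ContinuousGraph) : Prop :=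
  S.carrier = G.carrier ∧ ∀ q ∈ G.carrier, S.valence q = G.valence q

/-- The polygonal graph `P` is `G`-approximating. -/
def IsApproximating (P : PolygonalGraph) : Prop :=
  ∃ S, G.IsSubdivision S ∧ P = S.inscribed

/-- The net total curvature: the supremum of the net total curvatures of the `G`-approximating
polygonal graphs. -/
def netCurv : ℝ≥0∞ := ⨆ (P : PolygonalGraph) (_ : G.IsApproximating P), P.netCurv

/-- A sequence of `G`-approximating polygonal graphs `(S k).inscribed`, refined with respect to
`e`. Each of them refines the preceding one, and their net total curvatures tend to that of `G`.
Moreover, each is obtained from a `G`-approximating polygonal graph all of whose edges correspond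
to arcs of `G` of diameter at most `1 / (k + 1)`, by inserting for each edge at most two further
points of the corresponding arc, in such a way that the polygonal line so obtained attains the
maximum and the minimum of the height on that arc. -/
structure IsRefinedSeq (e : S2) (S : ℕ → ContinuousGraph) : Prop where
  isSubdivision : ∀ k, G.IsSubdivision (S k)
  nested : ∀ k, (S k).verts ⊆ (S (k + 1)).verts
  tendsto_netCurv : Tendsto (fun k => (S k).inscribed.netCurv) atTop (𝓝 G.netCurv)
  extremal : ∀ k, ∃ R, G.IsSubdivision R ∧ R.verts ⊆ (S k).verts ∧ ∀ i : Fin R.numEdges,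
    Metric.diam (R.edge i) ≤ 1 / ((k : ℝ) + 1) ∧
    (((S k).verts : Set E3) ∩ R.arc i '' Ioo 0 1).ncard ≤ 2 ∧
    (∀ x ∈ R.edge i, ∃ v ∈ (S k).verts, v ∈ R.edge i ∧ height e x ≤ height e v) ∧
    (∀ x ∈ R.edge i, ∃ v ∈ (S k).verts, v ∈ R.edge i ∧ height e v ≤ height e x)

/-- `m` is the multiplicity `μ(e)` of `G` at `e`: the limit of the multiplicities of a sequence of
`G`-approximating polygonal graphs, refined with respect to `e`. -/
def IsMultiplicity (e : S2) (m : ℝ≥0∞) : Prop :=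
  ∃ S, G.IsRefinedSeq e S ∧
    Tendsto (fun k => ENNReal.ofReal ((S k).inscribed.mult e)) atTop (𝓝 m)

/-- The graph has one-sided unit tangent vectors at all points, which are one-sided continuous:
along each oriented edge, the unit tangent vector in the direction of motion exists at all points
but the final one, and is continuous from the right. (Both orientations of an edge together give
both one-sided tangent vectors at each interior point, and all the tangent vectors at each
vertex.) -/
def HasOneSidedTangents : Prop :=
  ∀ d : Fin G.numEdges × Bool, ∃ T : ℝ → E3, ∀ t ∈ Ico (0 : ℝ) 1,
    ‖T t‖ = 1 ∧
    Tendsto (fun s => unitDir (G.path d t) (G.path d s)) (𝓝[>] t) (𝓝 (T t)) ∧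
    ContinuousWithinAt T (Ici t) t

end ContinuousGraph

end NetCurvature

end

noncomputable section

open scoped Pointwise

namespace NetCurvature

/-! Fix a direction `e` and write `h` for the height. At a vertex `q` of a polygonal graph, `nlm` is
half the sum of `sign (h q - h y)` over the edges from `q` to `y`. Summation by parts
(`sum_mul_nlm`) turns `∑ χ(q) nlm(q)` into `cut e χ`, half the sum over edges of (jump of `χ`) times
(sign of the jump of `h`). Since `mult` is the sum of the positive parts of `nlm`, it is the maximum
of `cut e χ` over weights `0 ≤ χ ≤ 1`, attained at an indicator. Integrating over `e`, where almost
surely no edge is horizontal, gives `netCurv = ½ ∫ mult` for polygonal graphs.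

This variational form yields two comparisons. First, `mult` grows when vertices are added
(`mult_mono`): if `χ` jumps across an edge, the jump can be moved to a single piece along which the
height changes in at least as favourable a direction, because height differences telescope. Second,
for generic `e` any subdivision `Q` is dominated by every subdivision `S` with short enough arcs,
even if `S` misses vertices of `Q` (`eventually_mult_le`): the jumps are placed in the middle of the
edges of `Q`, so `χ` is constant on each short arc of `S` that carries a missing vertex, and those
vertices can be deleted without changing the cut. Both comparisons use that a graph is determined by
its point set and its vertices (`sum_edges_eq`), so two subdivisions have a common refinement.

Hence along any refined sequence `mult` increases, and for generic `e` its limit is `supMult`, the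
supremum over all subdivisions, whatever the sequence. A single sequence serves almost all
directions, so monotone convergence gives measurability and the integral formula.

If `supMult e` is finite, it is attained, because the values of `mult` are half-integers. A critical
point inside an edge can be turned into a strict local extremum of an inscribed polygon, which costs
a fixed amount of `∑ |nlm| = 2 mult`; so there are finitely many critical points (`card_le_mult`).
Once they are added to a maximizing subdivision, the height is strictly monotone on every arc, `nlm`
of the polygon equals that of the graph, and noncritical vertices contribute nothing
(`supMult_eq_sum`).

If `netCurv` is finite, almost every height is strictly monotone just after each point of each edge.
Two distinct limits of secant directions would be separated by such a height, a contradiction; this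
gives one-sided tangents and their one-sided continuity (`exists_tangents`). -/

theorem area_orthogonal_eq_zero {v : E3} (hv : v ≠ 0) : area {e : S2 | inner ℝ (e : E3) v = 0} = 0 := by
  have hm : MeasurableSet {e : S2 | inner ℝ (e : E3) v = 0} :=
    (isClosed_eq (by fun_prop) continuous_const).measurableSet
  rw [area, Measure.toSphere_apply' _ hm]
  -- `toSphere` measures a set through the volume of the cone over it, and the cone over a great
  -- circle lies in the plane orthogonal to `v`.
  have hV : (volume : Measure E3) ((ℝ ∙ v)ᗮ : Submodule ℝ E3) = 0 := by
    apply Measure.addHaar_submodule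
    intro h
    have : v ∈ (ℝ ∙ v)ᗮ := by rw [h]; trivial
    rw [Submodule.mem_orthogonal_singleton_iff_inner_right] at this
    exact hv (inner_self_eq_zero.1 this)
  have : volume (Ioo (0 : ℝ) 1 • ((↑) '' {e : S2 | inner ℝ (e : E3) v = 0} : Set E3)) = 0 := by
    refine measure_mono_null ?_ hV
    rintro _ ⟨r, _, _, ⟨e, he, rfl⟩, rfl⟩
    rw [mem_ofPred_eq] at he
    simp only [SetLike.mem_coe]
    rw [Submodule.mem_orthogonal_singleton_iff_inner_left]
    simp [inner_smul_left, he]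
  simp [this]

/-! ### Heights, the area measure and signs -/

theorem height_sub (e : S2) (x y : E3) : height e (x - y) = height e x - height e y := by
  simp [height, inner_sub_right]

theorem ae_height_ne {x y : E3} (h : x ≠ y) : ∀ᵐ e ∂area, height e x ≠ height e y := by
  have := area_orthogonal_eq_zero (sub_ne_zero.2 h)
  rw [← compl_mem_ae_iff] at this
  filter_upwards [this] with e he h2
  apply he
  change height e (x - y) = 0
  rw [height_sub, h2, sub_self]

theorem continuous_height (e : S2) : Continuous (height e) := by
  unfold height; fun_prop

theorem continuous_height_left (x : E3) : Continuous fun e : S2 => height e x := by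
  unfold height; fun_prop

instance : area.IsOpenPosMeasure := by unfold area; infer_instance

instance : IsFiniteMeasure area := by unfold area; infer_instance

theorem area_ne_zero : area ≠ 0 := by unfold area; exact Measure.toSphere_ne_zero _

theorem sign_le_one (x : ℝ) : Real.sign x ≤ 1 := by
  rcases Real.sign_apply_eq x with h | h | h <;> rw [h] <;> norm_num

theorem neg_one_le_sign (x : ℝ) : -1 ≤ Real.sign x := by
  rcases Real.sign_apply_eq x with h | h | h <;> rw [h] <;> norm_num

theorem measurable_sign : Measurable Real.sign := by
  unfold Real.sign
  exact Measurable.ite measurableSet_Iio measurable_const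
    (Measurable.ite measurableSet_Ioi measurable_const measurable_const)

/-- In `nlm` a level end counts both as `below` and as `above`, and the two cancel, just as
`Real.sign 0 = 0`. So `nlm` is a sum of signs in every direction, generic or not. -/
theorem sign_sub_eq_ite (a b : ℝ) :
    Real.sign (a - b) = (if b ≤ a then 1 else 0) - (if a ≤ b then 1 else 0) := by
  rcases lt_trichotomy a b with h | h | h
  · rw [Real.sign_of_neg (by linarith)]; simp [h.le, h.not_ge]
  · simp [h]
  · rw [Real.sign_of_pos (by linarith)]; simp [h.le, h.not_ge]

theorem sign_sub_comm (a b : ℝ) : Real.sign (a - b) = - Real.sign (b - a) := by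
  rw [← Real.sign_neg]; ring_nf

theorem DoublePairing.count_standard {B : Type} [Finite B] (p : B → Prop) :
    (DoublePairing.standard B).count p = {b | p b}.ncard := by
  have : {x : B × Bool | p x.1 ∧ p ((DoublePairing.standard B).mate x).1}
      = {b | p b} ×ˢ (Set.univ : Set Bool) := by
    ext x; simp [DoublePairing.standard]
  rw [DoublePairing.count, this, Set.ncard_prod, Set.ncard_univ]
  simp

/-! ### Polygonal graphs: multiplicity as a maximal cut, net curvature as its integral -/

namespace PolygonalGraph

variable (P : PolygonalGraph)

open Classical in
theorem nlm_eq_sum (e : S2) (q : E3) :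
    P.nlm e q = (1 / 2) * ∑ d : P.Star q, Real.sign (height e q - height e (P.tgt d.1)) := by
  unfold nlm DoublePairing.nlm
  rw [DoublePairing.count_standard, DoublePairing.count_standard]
  simp only [sign_sub_eq_ite, Finset.sum_sub_distrib, Finset.sum_boole,
    Set.ncard_eq_toFinset_card', Set.toFinset_ofPred]
  ring

open Classical in
theorem sum_star (f : E3 → Fin P.numEdges × Bool → ℝ) :
    ∑ q ∈ P.verts, ∑ d : P.Star q, f q d.1 = ∑ d, f (P.src d) d := by
  have hmaps : ∀ d ∈ Finset.univ, P.src d ∈ P.verts := by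
    intro d _
    unfold src
    split_ifs
    · exact P.fst_mem _
    · exact P.snd_mem _
  rw [← Finset.sum_fiberwise_of_maps_to hmaps]
  refine Finset.sum_congr rfl fun q _ => ?_
  rw [Finset.sum_subtype (p := fun d => P.src d = q) _ (by simp)]
  exact Finset.sum_congr rfl fun d _ => by rw [d.2]

/-- Half the signed number of edges, counted with the jumps of `χ`. -/
def cut (e : S2) (χ : E3 → ℝ) : ℝ :=
  (1 / 2) * ∑ i, (χ (P.fst i) - χ (P.snd i)) *
    Real.sign (height e (P.fst i) - height e (P.snd i))

/-- Summation by parts: each edge occurs at both of its ends, with opposite signs. -/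
theorem sum_mul_nlm (e : S2) (χ : E3 → ℝ) : ∑ q ∈ P.verts, χ q * P.nlm e q = P.cut e χ := by
  classical
  have := P.sum_star fun q d => χ q * Real.sign (height e q - height e (P.tgt d))
  simp only [nlm_eq_sum, cut]
  calc _ = (1 / 2) * ∑ q ∈ P.verts, ∑ d : P.Star q,
        χ q * Real.sign (height e q - height e (P.tgt d.1)) := by
        rw [Finset.mul_sum]
        refine Finset.sum_congr rfl fun q _ => ?_
        rw [← Finset.mul_sum]
        ring
    _ = _ := by
        rw [this, Fintype.sum_prod_type]
        congr 1
        refine Finset.sum_congr rfl fun i _ => ?_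
        simp only [Fintype.sum_bool, src, tgt, if_true, Bool.false_eq_true, if_false]
        rw [sign_sub_comm (height e (P.snd i)) (height e (P.fst i))]
        ring

/-- With `exists_mult_eq_cut` this makes `mult` a maximum of cuts, so a lower bound for `mult` needs
only one good weight. -/
theorem cut_le_mult (e : S2) {χ : E3 → ℝ} (h0 : ∀ x, 0 ≤ χ x) (h1 : ∀ x, χ x ≤ 1) :
    P.cut e χ ≤ P.mult e := by
  rw [← sum_mul_nlm, mult]
  refine Finset.sum_le_sum fun q _ => ?_
  calc χ q * P.nlm e q ≤ χ q * (P.nlm e q)⁺ := by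
        gcongr
        · exact h0 q
        · exact le_posPart _
    _ ≤ 1 * (P.nlm e q)⁺ := by
        gcongr
        exact h1 q
    _ = _ := one_mul _

theorem exists_mult_eq_cut (e : S2) : ∃ A : Set E3, P.mult e = P.cut e (A.indicator 1) := by
  refine ⟨{q | 0 < P.nlm e q}, ?_⟩
  classical
  rw [← sum_mul_nlm, mult]
  refine Finset.sum_congr rfl fun q _ => ?_
  by_cases h : 0 < P.nlm e q
  · simp [indicator, h, h.le]
  · simp [indicator, h, not_lt.1 h]

/-- The cut of the constant weight `1` vanishes, so the positive and negative parts of `nlm`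
balance. -/
theorem mult_eq_sum_abs (e : S2) : P.mult e = (1 / 2) * ∑ q ∈ P.verts, |P.nlm e q| := by
  have h := P.sum_mul_nlm e 1
  simp only [Pi.one_apply, one_mul, cut, sub_self, zero_mul, Finset.sum_const_zero, mul_zero] at h
  have h2 : ∑ q ∈ P.verts, |P.nlm e q| = ∑ q ∈ P.verts, (2 * (P.nlm e q)⁺ - P.nlm e q) := by
    refine Finset.sum_congr rfl fun q _ => ?_
    rcases le_total 0 (P.nlm e q) with h | h
    · rw [posPart_of_nonneg h, abs_of_nonneg h]; ring
    · rw [posPart_of_nonpos h, abs_of_nonpos h]; ring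
  rw [h2, Finset.sum_sub_distrib, h, ← Finset.mul_sum, mult]
  ring

theorem exists_nlm_posPart_eq (e : S2) (q : E3) : ∃ n : ℕ, (P.nlm e q)⁺ = (n : ℝ) / 2 := by
  unfold nlm DoublePairing.nlm
  rw [DoublePairing.count_standard, DoublePairing.count_standard]
  generalize Set.ncard _ = a
  generalize Set.ncard _ = b
  -- Truncated subtraction of natural numbers is the positive part.
  refine ⟨a - b, ?_⟩
  rcases le_total b a with h | h
  · rw [posPart_of_nonneg, Nat.cast_sub h]
    have : (b : ℝ) ≤ a := by exact_mod_cast h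
    linarith
  · rw [posPart_of_nonpos, Nat.sub_eq_zero_of_le h]
    · simp
    have : (a : ℝ) ≤ b := by exact_mod_cast h
    linarith

theorem exists_mult_eq (e : S2) : ∃ n : ℕ, P.mult e = (n : ℝ) / 2 := by
  choose n hn using P.exists_nlm_posPart_eq e
  exact ⟨∑ q ∈ P.verts, n q, by simp [mult, hn, Finset.sum_div]⟩

theorem measurable_nlm (q : E3) : Measurable fun e => P.nlm e q := by
  classical
  simp only [nlm_eq_sum]
  refine Measurable.const_mul (Finset.measurable_sum _ fun d _ => ?_) _
  exact measurable_sign.comp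
    ((continuous_height_left _).sub (continuous_height_left _)).measurable

theorem measurable_mult : Measurable P.mult :=
  Finset.measurable_sum _ fun q _ => (P.measurable_nlm q).sup_const 0

/-- On a horizontal edge `chi` would be `1` but the sign `0`; such directions form a null set. -/
theorem chi_unitDir {x y : E3} {e : S2} (h : height e x ≠ height e y) :
    chi (unitDir x y) e = Real.sign (height e x - height e y) := by
  have hxy : 0 < ‖y - x‖⁻¹ := by
    rw [inv_pos, norm_pos_iff, sub_ne_zero]
    rintro rfl
    exact h rfl
  have : height e (unitDir x y) = ‖y - x‖⁻¹ * (height e y - height e x) := by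
    rw [← height_sub]; simp [unitDir, height, inner_smul_right]
  unfold chi
  rw [this]
  rcases lt_or_gt_of_ne h with h | h
  · rw [if_pos (mul_pos hxy (by linarith)), Real.sign_of_neg (by linarith)]
  · rw [if_neg, Real.sign_of_pos (by linarith)]
    exact not_lt.2 (mul_nonpos_of_nonneg_of_nonpos hxy.le (by linarith))

theorem src_ne_tgt (d : Fin P.numEdges × Bool) : P.src d ≠ P.tgt d := by
  unfold src tgt
  split_ifs
  · exact P.fst_ne_snd _
  · exact (P.fst_ne_snd _).symm

/-- For almost every `e` no edge at `q` is horizontal, and then the sum of the `chi` is `2 nlm`;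
this turns the factor `1/4` into `1/2`. -/
theorem nc_eq (q : E3) : P.nc q = (1 / 2) * ∫⁻ e, ENNReal.ofReal ((P.nlm e q)⁺) ∂area := by
  classical
  have h2 : (2 : ℝ≥0∞) ≠ ⊤ := by simp
  have h : ∫⁻ e, ENNReal.ofReal ((∑ d : P.Star q, chi (unitDir q (P.tgt d.1)) e)⁺) ∂area
      = ∫⁻ e, 2 * ENNReal.ofReal ((P.nlm e q)⁺) ∂area := by
    apply lintegral_congr_ae
    have : ∀ d : P.Star q, ∀ᵐ e ∂area, height e q ≠ height e (P.tgt d.1) := fun d =>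
      ae_height_ne (d.2.symm.trans_ne (P.src_ne_tgt d.1))
    filter_upwards [ae_all_iff.2 this] with e he
    rw [nlm_eq_sum, Finset.sum_congr rfl fun d _ => chi_unitDir (he d)]
    generalize (∑ d : P.Star q, Real.sign (height e q - height e (P.tgt d.1))) = s
    rw [show (2 : ℝ≥0∞) = ENNReal.ofReal 2 by simp, ← ENNReal.ofReal_mul (by norm_num)]
    congr 1
    rcases le_total 0 s with h | h
    · rw [posPart_of_nonneg h, posPart_of_nonneg (by linarith)]; ring
    · rw [posPart_of_nonpos h, posPart_of_nonpos (by linarith)]; ring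
  rw [nc, h, lintegral_const_mul' _ _ h2, ← mul_assoc]
  congr 1
  rw [show (4 : ℝ≥0∞) = 2 * 2 by norm_num, one_div, one_div,
    ENNReal.mul_inv (by simp) (by simp), mul_assoc, ENNReal.inv_mul_cancel (by simp) (by simp),
    mul_one]

theorem netCurv_eq : P.netCurv = (1 / 2) * ∫⁻ e, ENNReal.ofReal (P.mult e) ∂area := by
  simp only [netCurv, nc_eq, mult]
  rw [← Finset.mul_sum, ← lintegral_finsetSum]
  · congr 2
    ext e
    rw [ENNReal.ofReal_sum_of_nonneg fun _ _ => posPart_nonneg _]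
  · intro q _
    exact ENNReal.measurable_ofReal.comp ((P.measurable_nlm q).sup_const 0)

theorem measurable_ofReal_mult : Measurable fun e => ENNReal.ofReal (P.mult e) :=
  ENNReal.measurable_ofReal.comp P.measurable_mult

end PolygonalGraph

/-! ### Refinements: cutting edges into pieces -/

theorem affine_mem_Icc {a b s : ℝ} (ha : 0 ≤ a) (hab : a < b) (hb : b ≤ 1) (hs : s ∈ Icc (0 : ℝ) 1) :
    a + (b - a) * s ∈ Icc (0 : ℝ) 1 := by
  constructor <;> nlinarith [hs.1, hs.2]

theorem affine_mem_Ioo {a b s : ℝ} (hab : a < b) (hs : s ∈ Ioo (0 : ℝ) 1) :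
    a + (b - a) * s ∈ Ioo a b := by
  constructor <;> nlinarith [hs.1, hs.2]

namespace ContinuousGraph

variable (R : ContinuousGraph)

theorem arc_mem_carrier (i : Fin R.numEdges) {s : ℝ} (hs : s ∈ Icc (0 : ℝ) 1) :
    R.arc i s ∈ R.carrier :=
  Or.inr (mem_iUnion.2 ⟨i, s, hs, rfl⟩)

theorem verts_subset_carrier : (R.verts : Set E3) ⊆ R.carrier := fun _ h => Or.inl h

theorem mem_carrier_iff {x : E3} :
    x ∈ R.carrier ↔ x ∈ R.verts ∨ ∃ i, ∃ s ∈ Ioo (0 : ℝ) 1, R.arc i s = x := by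
  constructor
  · rintro (h | h)
    · exact Or.inl h
    · obtain ⟨i, s, hs, rfl⟩ := mem_iUnion.1 h
      rcases eq_or_lt_of_le hs.1 with rfl | h0
      · exact Or.inl (R.arc_zero_mem i)
      rcases eq_or_lt_of_le hs.2 with rfl | h1
      · exact Or.inl (R.arc_one_mem i)
      exact Or.inr ⟨i, s, ⟨h0, h1⟩, rfl⟩
  · rintro (h | ⟨i, s, hs, rfl⟩)
    · exact Or.inl h
    · exact R.arc_mem_carrier i (Ioo_subset_Icc_self hs)

theorem arc_eq_arc_iff {i j : Fin R.numEdges} {s t : ℝ} (hs : s ∈ Ioo (0 : ℝ) 1)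
    (ht : t ∈ Ioo (0 : ℝ) 1) : R.arc i s = R.arc j t ↔ i = j ∧ s = t := by
  constructor
  · intro h
    obtain rfl := R.arc_disjoint i j s hs t ht h
    exact ⟨rfl, R.arc_injOn i (Ioo_subset_Icc_self hs) (Ioo_subset_Icc_self ht) h⟩
  · rintro ⟨rfl, rfl⟩; rfl

/-- Every edge of `U` is a piece of an edge of `R`, and every edge of `R` is the concatenation
of such pieces; the latter is expressed by telescoping sums. -/
structure Refinement (U R : ContinuousGraph) where
  ι : Fin U.numEdges → Fin R.numEdges
  α : Fin U.numEdges → ℝ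
  β : Fin U.numEdges → ℝ
  α_nonneg : ∀ k, 0 ≤ α k
  α_lt_β : ∀ k, α k < β k
  β_le_one : ∀ k, β k ≤ 1
  arc_eq : ∀ k, ∀ s ∈ Icc (0 : ℝ) 1, U.arc k s = R.arc (ι k) (α k + (β k - α k) * s)
  telescope : ∀ g : Fin R.numEdges → ℝ → ℝ,
    ∑ k, (g (ι k) (β k) - g (ι k) (α k)) = ∑ i, (g i 1 - g i 0)
  verts_subset : R.verts ⊆ U.verts
  carrier_eq : U.carrier = R.carrier

/-- A graph refines itself. -/
def Refinement.refl : Refinement R R where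
  ι := id
  α _ := 0
  β _ := 1
  α_nonneg _ := le_rfl
  α_lt_β _ := one_pos
  β_le_one _ := le_rfl
  arc_eq k s _ := by simp
  telescope g := rfl
  verts_subset := Finset.Subset.refl _
  carrier_eq := rfl

variable {R} in
/-- Refinements can be composed. -/
def Refinement.trans {W U : ContinuousGraph} (f : Refinement W U) (g : Refinement U R) :
    Refinement W R where
  ι k := g.ι (f.ι k)
  α k := g.α (f.ι k) + (g.β (f.ι k) - g.α (f.ι k)) * f.α k
  β k := g.α (f.ι k) + (g.β (f.ι k) - g.α (f.ι k)) * f.β k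
  α_nonneg k := (affine_mem_Icc (g.α_nonneg _) (g.α_lt_β _) (g.β_le_one _)
    ⟨f.α_nonneg k, (f.α_lt_β k).le.trans (f.β_le_one k)⟩).1
  α_lt_β k := by
    have := g.α_lt_β (f.ι k)
    have := f.α_lt_β k
    nlinarith
  β_le_one k := (affine_mem_Icc (g.α_nonneg _) (g.α_lt_β _) (g.β_le_one _)
    ⟨(f.α_nonneg k).trans (f.α_lt_β k).le, f.β_le_one k⟩).2
  arc_eq k s hs := by
    rw [f.arc_eq k s hs, g.arc_eq _ _ (affine_mem_Icc (f.α_nonneg _) (f.α_lt_β _) (f.β_le_one _) hs)]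
    congr 1
    ring
  telescope φ := by
    rw [f.telescope fun l s => φ (g.ι l) (g.α l + (g.β l - g.α l) * s)]
    simp only [mul_one, mul_zero, add_zero, add_sub_cancel]
    exact g.telescope φ
  verts_subset := g.verts_subset.trans f.verts_subset
  carrier_eq := f.carrier_eq.trans g.carrier_eq

section Insertion

variable (i : Fin R.numEdges) (t : ℝ)

/-- The edge which contains a piece, when edge number `i` is cut into two. -/
def insertι : Fin (R.numEdges + 1) → Fin R.numEdges := Fin.snoc (α := fun _ => Fin R.numEdges) id i

/-- The parameter at which a piece begins, when edge number `i` is cut at `t`. -/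
def insertα : Fin (R.numEdges + 1) → ℝ := Fin.snoc (α := fun _ => ℝ) (fun _ => 0) t

/-- The parameter at which a piece ends, when edge number `i` is cut at `t`. -/
def insertβ : Fin (R.numEdges + 1) → ℝ :=
  Fin.snoc (α := fun _ => ℝ) (fun k => if k = i then t else 1) 1

@[simp] theorem insertι_last : R.insertι i (Fin.last _) = i := by simp [insertι]
@[simp] theorem insertι_castSucc (k) : R.insertι i (Fin.castSucc k) = k := by simp [insertι]
@[simp] theorem insertα_last : R.insertα t (Fin.last _) = t := by simp [insertα]
@[simp] theorem insertα_castSucc (k) : R.insertα t (Fin.castSucc k) = 0 := by simp [insertα]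
@[simp] theorem insertβ_last : R.insertβ i t (Fin.last _) = 1 := by simp [insertβ]
@[simp] theorem insertβ_castSucc (k) :
    R.insertβ i t (Fin.castSucc k) = if k = i then t else 1 := by simp [insertβ]

variable {t} (ht : t ∈ Ioo (0 : ℝ) 1)
include ht

theorem insertα_nonneg (k) : 0 ≤ R.insertα t k := by
  refine Fin.lastCases ?_ (fun k => ?_) k
  · simpa using ht.1.le
  · simp

theorem insertβ_le_one (k) : R.insertβ i t k ≤ 1 := by
  refine Fin.lastCases ?_ (fun k => ?_) k
  · simp
  · rw [insertβ_castSucc]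
    split_ifs
    exacts [ht.2.le, le_rfl]

theorem insertα_lt_insertβ (k) : R.insertα t k < R.insertβ i t k := by
  refine Fin.lastCases ?_ (fun k => ?_) k
  · simpa using ht.2
  · rw [insertβ_castSucc, insertα_castSucc]
    split_ifs
    exacts [ht.1, one_pos]

/-- Stated for the raw arcs because the connectedness field of `insertVertex` already depends on it.
-/
theorem insert_carrier_eq :
    ((insert (R.arc i t) R.verts : Finset E3) : Set E3) ∪ ⋃ k, (fun s => R.arc (R.insertι i k)
      (R.insertα t k + (R.insertβ i t k - R.insertα t k) * s)) '' Icc 0 1 = R.carrier := by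
  apply Subset.antisymm
  · rintro x (h | h)
    · rw [Finset.coe_insert] at h
      rcases h with rfl | h
      · exact R.arc_mem_carrier i (Ioo_subset_Icc_self ht)
      · exact R.verts_subset_carrier h
    · obtain ⟨k, s, hs, rfl⟩ := mem_iUnion.1 h
      exact R.arc_mem_carrier _ (affine_mem_Icc (R.insertα_nonneg ht k)
        (R.insertα_lt_insertβ i ht k) (R.insertβ_le_one i ht k) hs)
  · rintro x (h | h)
    · exact Or.inl (by simp [Finset.mem_coe.1 h])
    · obtain ⟨j, s, hs, rfl⟩ := mem_iUnion.1 h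
      refine Or.inr (mem_iUnion.2 ?_)
      by_cases hj : j = i
      · subst hj
        rcases le_or_gt s t with hst | hst
        · refine ⟨Fin.castSucc j, s / t, ⟨div_nonneg hs.1 ht.1.le, (div_le_one ht.1).2 hst⟩, ?_⟩
          have := ht.1.ne'
          simp only [insertι_castSucc, insertα_castSucc, insertβ_castSucc, if_true]
          congr 1
          field_simp
          ring
        · have h1 : 0 < 1 - t := by linarith [ht.2]
          refine ⟨Fin.last _, (s - t) / (1 - t), ⟨div_nonneg (by linarith) h1.le,
            (div_le_one h1).2 (by linarith [hs.2])⟩, ?_⟩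
          simp only [insertι_last, insertα_last, insertβ_last]
          congr 1
          field_simp
          ring
      · exact ⟨Fin.castSucc j, s, hs, by simp [hj]⟩

/-- Cut the edge number `i` at the parameter `t`. -/
def insertVertex : ContinuousGraph where
  verts := insert (R.arc i t) R.verts
  numEdges := R.numEdges + 1
  numEdges_pos := Nat.succ_pos _
  arc k s := R.arc (R.insertι i k) (R.insertα t k + (R.insertβ i t k - R.insertα t k) * s)
  arc_continuousOn k := by
    refine (R.arc_continuousOn _).comp (by fun_prop) fun s hs => ?_
    exact affine_mem_Icc (R.insertα_nonneg ht k) (R.insertα_lt_insertβ i ht k)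
      (R.insertβ_le_one i ht k) hs
  arc_injOn k s hs s' hs' h := by
    have h1 := fun {s} => affine_mem_Icc (s := s) (R.insertα_nonneg ht k) (R.insertα_lt_insertβ i ht k)
      (R.insertβ_le_one i ht k)
    have h2 := R.arc_injOn _ (h1 hs) (h1 hs') h
    have h3 := R.insertα_lt_insertβ i ht k
    exact mul_left_cancel₀ (sub_ne_zero.2 h3.ne') (add_left_cancel h2)
  arc_zero_mem k := by
    refine Fin.lastCases ?_ (fun k => ?_) k
    · simp
    · simp [R.arc_zero_mem k]
  arc_one_mem k := by
    refine Fin.lastCases ?_ (fun k => ?_) k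
    · simp [R.arc_one_mem i]
    · by_cases h : k = i
      · simp [h]
      · simp [h, R.arc_one_mem k]
  arc_notMem_verts k s hs h := by
    have h1 := affine_mem_Ioo (R.insertα_lt_insertβ i ht k) hs
    set u := R.insertα t k + (R.insertβ i t k - R.insertα t k) * s
    have h2 : u ∈ Ioo (0 : ℝ) 1 := ⟨(R.insertα_nonneg ht k).trans_lt h1.1,
      h1.2.trans_le (R.insertβ_le_one i ht k)⟩
    rcases Finset.mem_insert.1 h with h | h
    · obtain ⟨h3, h4⟩ := (R.arc_eq_arc_iff h2 ht).1 h
      rw [h4] at h1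
      revert h1 h3
      refine Fin.lastCases ?_ (fun k => ?_) k
      · simp
      · intro h1 h3
        simp only [insertι_castSucc] at h3
        simp [h3] at h1
    · exact R.arc_notMem_verts _ _ h2 h
  arc_disjoint k l s hs s' hs' h := by
    have h1 := affine_mem_Ioo (R.insertα_lt_insertβ i ht k) hs
    have h1' := affine_mem_Ioo (R.insertα_lt_insertβ i ht l) hs'
    set u := R.insertα t k + (R.insertβ i t k - R.insertα t k) * s
    set u' := R.insertα t l + (R.insertβ i t l - R.insertα t l) * s'
    have h2 : u ∈ Ioo (0 : ℝ) 1 := ⟨(R.insertα_nonneg ht k).trans_lt h1.1,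
      h1.2.trans_le (R.insertβ_le_one i ht k)⟩
    have h2' : u' ∈ Ioo (0 : ℝ) 1 := ⟨(R.insertα_nonneg ht l).trans_lt h1'.1,
      h1'.2.trans_le (R.insertβ_le_one i ht l)⟩
    obtain ⟨h3, h4⟩ := (R.arc_eq_arc_iff h2 h2').1 h
    rw [← h4] at h1'
    clear_value u u'
    clear h
    revert h1 h1' h3
    refine Fin.lastCases ?_ (fun k => ?_) k <;> refine Fin.lastCases ?_ (fun l => ?_) l
    · simp
    · intro h1 h1' h3
      simp only [insertι_castSucc, insertι_last] at h3
      subst h3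
      simp only [insertα_castSucc, insertβ_castSucc, insertα_last, if_true, mem_Ioo] at h1 h1'
      linarith
    · intro h1 h1' h3
      simp only [insertι_castSucc, insertι_last] at h3
      subst h3
      simp only [insertα_castSucc, insertβ_castSucc, insertα_last, if_true, mem_Ioo] at h1 h1'
      linarith
    · intro _ _ h3
      simpa using h3
  connected := by
    rw [R.insert_carrier_eq i ht]
    exact R.connected

/-- Cutting an edge yields a refinement. -/
def insertVertexRefinement : Refinement (R.insertVertex i ht) R where
  ι := R.insertι i
  α := R.insertα t
  β := R.insertβ i t
  α_nonneg := R.insertα_nonneg ht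
  α_lt_β := R.insertα_lt_insertβ i ht
  β_le_one := R.insertβ_le_one i ht
  arc_eq _ _ _ := rfl
  telescope g := by
    have h := Fin.sum_univ_castSucc fun k : Fin (R.numEdges + 1) =>
      g (R.insertι i k) (R.insertβ i t k) - g (R.insertι i k) (R.insertα t k)
    refine h.trans ?_
    simp only [insertι_castSucc, insertα_castSucc, insertβ_castSucc, insertι_last, insertα_last,
      insertβ_last]
    have h2 : ∀ k, g k (if k = i then t else 1) - g k 0
        = (g k 1 - g k 0) + if k = i then g i t - g i 1 else 0 := by
      intro k
      split_ifs with hk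
      · subst hk; ring
      · ring
    rw [Finset.sum_congr rfl fun k _ => h2 k, Finset.sum_add_distrib]
    simp only [Finset.sum_ite_eq', Finset.mem_univ, if_true]
    ring
  verts_subset := Finset.subset_insert _ _
  carrier_eq := R.insert_carrier_eq i ht

end Insertion

/-- The points are added one at a time; each is either already a vertex or an interior point of an
edge to be cut. -/
theorem exists_refinement {V : Finset E3} (hV : (V : Set E3) ⊆ R.carrier) :
    ∃ U : ContinuousGraph, U.verts = R.verts ∪ V ∧ Nonempty (Refinement U R) := by
  classical
  induction V using Finset.induction_on with
  | empty => exact ⟨R, by simp, ⟨Refinement.refl R⟩⟩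
  | insert v V _ ih =>
    rw [Finset.coe_insert, insert_subset_iff] at hV
    obtain ⟨U, hU, ⟨f⟩⟩ := ih hV.2
    rw [← f.carrier_eq, mem_carrier_iff] at hV
    rcases hV.1 with h | ⟨i, t, ht, rfl⟩
    · refine ⟨U, ?_, ⟨f⟩⟩
      rw [hU] at h
      rw [hU, Finset.union_insert, Finset.insert_eq_of_mem h]
    · refine ⟨U.insertVertex i ht, ?_, ⟨(U.insertVertexRefinement i ht).trans f⟩⟩
      rw [Finset.union_insert, ← hU]
      rfl

namespace Refinement

variable {R} {U : ContinuousGraph} (f : Refinement U R)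
include f

theorem arc_zero (k) : U.arc k 0 = R.arc (f.ι k) (f.α k) := by
  simpa using f.arc_eq k 0 (by simp)

theorem arc_one (k) : U.arc k 1 = R.arc (f.ι k) (f.β k) := by
  simpa using f.arc_eq k 1 (by simp)

theorem α_mem (k) : f.α k ∈ Ico (0 : ℝ) 1 := ⟨f.α_nonneg k, (f.α_lt_β k).trans_le (f.β_le_one k)⟩

theorem β_mem (k) : f.β k ∈ Ioc (0 : ℝ) 1 := ⟨(f.α_nonneg k).trans_lt (f.α_lt_β k), f.β_le_one k⟩

theorem mem_Ioo {k} {s : ℝ} (hs : s ∈ Ioo (f.α k) (f.β k)) : s ∈ Ioo (0 : ℝ) 1 :=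
  ⟨(f.α_nonneg k).trans_lt hs.1, hs.2.trans_le (f.β_le_one k)⟩

theorem exists_arc_eq {k} {s : ℝ} (hs : s ∈ Ioo (f.α k) (f.β k)) :
    ∃ u ∈ Ioo (0 : ℝ) 1, U.arc k u = R.arc (f.ι k) s := by
  have h : 0 < f.β k - f.α k := by linarith [f.α_lt_β k]
  have hu : (s - f.α k) / (f.β k - f.α k) ∈ Ioo (0 : ℝ) 1 :=
    ⟨div_pos (by linarith [hs.1]) h, (div_lt_one h).2 (by linarith [hs.2])⟩
  refine ⟨_, hu, ?_⟩
  rw [f.arc_eq _ _ (Ioo_subset_Icc_self hu)]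
  congr 1
  field_simp
  ring

theorem notMem_verts {k} {s : ℝ} (hs : s ∈ Ioo (f.α k) (f.β k)) : R.arc (f.ι k) s ∉ U.verts := by
  obtain ⟨u, hu, h⟩ := f.exists_arc_eq hs
  rw [← h]
  exact U.arc_notMem_verts k u hu

theorem le_or_le {k} {s : ℝ} (h : R.arc (f.ι k) s ∈ U.verts) : s ≤ f.α k ∨ f.β k ≤ s := by
  by_contra! hs
  exact f.notMem_verts hs h

theorem eq_of_mem {k l} (hkl : f.ι k = f.ι l) {s : ℝ} (hs : s ∈ Ioo (f.α k) (f.β k))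
    (hs' : s ∈ Ioo (f.α l) (f.β l)) : k = l := by
  obtain ⟨u, hu, h⟩ := f.exists_arc_eq hs
  obtain ⟨u', hu', h'⟩ := f.exists_arc_eq hs'
  exact U.arc_disjoint k l u hu u' hu' (by rw [h, h', hkl])

/-- This identity stands in for an ordering of the pieces along edge `i`. As `g` is arbitrary, step
functions can be used to locate pieces. -/
theorem telescope_edge (i : Fin R.numEdges) (g : ℝ → ℝ) :
    ∑ k, (if f.ι k = i then g (f.β k) - g (f.α k) else 0) = g 1 - g 0 := by
  have := f.telescope fun j s => if j = i then g s else 0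
  simp only [Finset.sum_sub_distrib, Finset.sum_ite_eq', Finset.mem_univ, if_true] at this
  rw [← this, ← Finset.sum_sub_distrib]
  refine Finset.sum_congr rfl fun k _ => ?_
  split_ifs <;> simp

theorem exists_lt_of_lt {i : Fin R.numEdges} {g : ℝ → ℝ} (h : g 1 < g 0) :
    ∃ k, f.ι k = i ∧ g (f.β k) < g (f.α k) := by
  by_contra! H
  have := f.telescope_edge i g
  have h2 : 0 ≤ ∑ k, (if f.ι k = i then g (f.β k) - g (f.α k) else 0) := by
    refine Finset.sum_nonneg fun k _ => ?_
    split_ifs with hk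
    · linarith [H k hk]
    · exact le_rfl
  linarith

theorem exists_le_of_le {i : Fin R.numEdges} {g : ℝ → ℝ} (h : g 1 ≤ g 0) :
    ∃ k, f.ι k = i ∧ g (f.β k) ≤ g (f.α k) := by
  by_contra! H
  have := f.telescope_edge i g
  -- The test function `-s` only serves to produce some piece on edge `i`, so that the sum of
  -- positive terms is not empty.
  obtain ⟨k, hk, _⟩ := f.exists_lt_of_lt (i := i) (g := fun s => -s) (by norm_num)
  have h2 : 0 < ∑ k, (if f.ι k = i then g (f.β k) - g (f.α k) else 0) := by
    refine Finset.sum_pos' (fun l _ => ?_) ⟨k, Finset.mem_univ _, ?_⟩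
    · split_ifs with hl
      · linarith [H l hl]
      · exact le_rfl
    · rw [if_pos hk]
      linarith [H k hk]
  linarith

theorem exists_α_le_lt (i : Fin R.numEdges) {s : ℝ} (h0 : 0 ≤ s) (h1 : s < 1) :
    ∃ k, f.ι k = i ∧ f.α k ≤ s ∧ s < f.β k := by
  classical
  -- The step function drops just after `s`, hence exactly across the piece with `α ≤ s < β`.
  obtain ⟨k, hk, h⟩ := f.exists_lt_of_lt (i := i) (g := fun u => if u ≤ s then 1 else 0)
    (by simp [h0, h1.not_ge])
  refine ⟨k, hk, ?_⟩
  by_contra! H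
  have := f.α_lt_β k
  by_cases h2 : f.α k ≤ s
  · simp [h2, H h2] at h
  · simp only [h2, if_false] at h
    split_ifs at h <;> linarith

theorem exists_α_eq {i : Fin R.numEdges} {s : ℝ} (h0 : 0 ≤ s) (h1 : s < 1)
    (hs : R.arc i s ∈ U.verts) : ∃ k, f.ι k = i ∧ f.α k = s := by
  obtain ⟨k, rfl, h2, h3⟩ := f.exists_α_le_lt i h0 h1
  refine ⟨k, rfl, h2.antisymm ?_⟩
  rcases f.le_or_le hs with h | h
  · exact h
  · linarith

theorem exists_β_eq {i : Fin R.numEdges} {s : ℝ} (h0 : 0 < s) (h1 : s ≤ 1)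
    (hs : R.arc i s ∈ U.verts) : ∃ k, f.ι k = i ∧ f.β k = s := by
  classical
  -- With a strict inequality the step drops at `s` itself, which selects the piece to the left of
  -- `s`.
  obtain ⟨k, rfl, h⟩ := f.exists_lt_of_lt (i := i) (g := fun u => if u < s then 1 else 0)
    (by simp [h0, h1.not_gt])
  refine ⟨k, rfl, ?_⟩
  have := f.α_lt_β k
  rcases f.le_or_le hs with h2 | h2
  · rw [if_neg (by linarith), if_neg (by linarith)] at h
    exact absurd h (lt_irrefl _)
  · refine h2.antisymm ?_
    by_contra! h3
    rw [if_pos (by linarith), if_pos (by linarith)] at h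
    exact absurd h (lt_irrefl _)

theorem eq_of_α_eq {k l} (hkl : f.ι k = f.ι l) (h : f.α k = f.α l) : k = l := by
  obtain ⟨s, hs, hs'⟩ := exists_between (lt_min (f.α_lt_β k) (h ▸ f.α_lt_β l))
  exact f.eq_of_mem hkl ⟨hs, hs'.trans_le (min_le_left _ _)⟩
    ⟨h ▸ hs, hs'.trans_le (min_le_right _ _)⟩

theorem eq_of_β_eq {k l} (hkl : f.ι k = f.ι l) (h : f.β k = f.β l) : k = l := by
  obtain ⟨s, hs, hs'⟩ := exists_between (max_lt (f.α_lt_β k) (h ▸ f.α_lt_β l))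
  exact f.eq_of_mem hkl ⟨(le_max_left _ _).trans_lt hs, hs'⟩
    ⟨(le_max_right _ _).trans_lt hs, h ▸ hs'⟩

end Refinement

end ContinuousGraph

/-! ### A graph is determined by its point set and its vertices -/

namespace ContinuousGraph

variable (R : ContinuousGraph)

theorem arc_mem_verts_iff {k : Fin R.numEdges} {s : ℝ} (hs : s ∈ Icc (0 : ℝ) 1) :
    R.arc k s ∈ R.verts ↔ s = 0 ∨ s = 1 := by
  constructor
  · intro h
    by_contra! H
    exact R.arc_notMem_verts k s ⟨hs.1.lt_of_ne' H.1, hs.2.lt_of_ne H.2⟩ h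
  · rintro (rfl | rfl)
    · exact R.arc_zero_mem k
    · exact R.arc_one_mem k

theorem isCompact_arc_image (k : Fin R.numEdges) {a b : ℝ} (ha : 0 ≤ a) (hb : b ≤ 1) :
    IsCompact (R.arc k '' Icc a b) :=
  isCompact_Icc.image_of_continuousOn ((R.arc_continuousOn k).mono (Icc_subset_Icc ha hb))

/-- The part of the graph which remains when an open piece of an edge is removed. -/
def remainder (k : Fin R.numEdges) (a b : ℝ) : Set E3 :=
  (R.verts ∪ ⋃ j : {j // j ≠ k}, R.edge j) ∪ (R.arc k '' Icc 0 a ∪ R.arc k '' Icc b 1)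

variable {R}

theorem isClosed_remainder {k : Fin R.numEdges} {a b : ℝ} (ha : a ≤ 1) (hb : 0 ≤ b) :
    IsClosed (R.remainder k a b) := by
  refine ((R.verts.finite_toSet.isClosed).union (isClosed_iUnion_of_finite fun j => ?_)).union
    (((R.isCompact_arc_image k le_rfl ha).isClosed).union
      ((R.isCompact_arc_image k hb le_rfl).isClosed))
  exact (R.isCompact_arc_image j.1 le_rfl le_rfl).isClosed

theorem carrier_subset_remainder {k : Fin R.numEdges} {a b : ℝ} :
    R.carrier ⊆ R.remainder k a b ∪ R.arc k '' Ioo a b := by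
  rintro x (h | h)
  · exact Or.inl (Or.inl (Or.inl h))
  · obtain ⟨j, hj⟩ := mem_iUnion.1 h
    by_cases hjk : j = k
    · subst hjk
      obtain ⟨s, hs, rfl⟩ := hj
      by_cases h1 : s ≤ a
      · exact Or.inl (Or.inr (Or.inl ⟨s, ⟨hs.1, h1⟩, rfl⟩))
      by_cases h2 : b ≤ s
      · exact Or.inl (Or.inr (Or.inr ⟨s, ⟨h2, hs.2⟩, rfl⟩))
      exact Or.inr ⟨s, ⟨not_le.1 h1, not_le.1 h2⟩, rfl⟩
    · exact Or.inl (Or.inl (Or.inr (mem_iUnion.2 ⟨⟨j, hjk⟩, hj⟩)))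

theorem arc_notMem_remainder {k : Fin R.numEdges} {a b s : ℝ} (ha : 0 ≤ a) (hb : b ≤ 1)
    (hs : s ∈ Ioo a b) : R.arc k s ∉ R.remainder k a b := by
  have hs' : s ∈ Ioo (0 : ℝ) 1 := ⟨ha.trans_lt hs.1, hs.2.trans_le hb⟩
  rintro ((h | h) | (⟨u, hu, h⟩ | ⟨u, hu, h⟩))
  · exact R.arc_notMem_verts k s hs' h
  · obtain ⟨⟨j, hj⟩, u, hu, h⟩ := mem_iUnion.1 h
    by_cases hv : R.arc j u ∈ R.verts
    · exact R.arc_notMem_verts k s hs' (h ▸ hv)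
    · rw [R.arc_mem_verts_iff hu, not_or] at hv
      exact hj (R.arc_disjoint j k u ⟨hu.1.lt_of_ne' hv.1, hu.2.lt_of_ne hv.2⟩ s hs' h)
  · have := R.arc_injOn k ⟨hu.1, by linarith [hu.2, hs.1, hs'.2]⟩ (Ioo_subset_Icc_self hs') h
    linarith [hs.1, hu.2]
  · have := R.arc_injOn k ⟨by linarith [hu.1, hs.2, hs'.1], hu.2⟩ (Ioo_subset_Icc_self hs') h
    linarith [hs.2, hu.1]

/-- The remainder is closed and misses the point, so near an interior point of an edge, closeness in
space forces closeness along the edge. -/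
theorem exists_dist_lt {k : Fin R.numEdges} {a b s : ℝ} (ha : 0 ≤ a) (hb : b ≤ 1)
    (hs : s ∈ Ioo a b) : ∃ δ > 0, ∀ w ∈ R.carrier, dist w (R.arc k s) < δ →
      ∃ u ∈ Ioo a b, R.arc k u = w := by
  have h := (isClosed_remainder (R := R) (k := k) (by linarith [hs.1, hs.2] : a ≤ 1)
    (by linarith [hs.1, hs.2] : 0 ≤ b)).isOpen_compl
  obtain ⟨δ, hδ, hball⟩ := Metric.isOpen_iff.1 h _ (arc_notMem_remainder ha hb hs)
  refine ⟨δ, hδ, fun w hw hd => ?_⟩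
  rcases carrier_subset_remainder (k := k) (a := a) (b := b) hw with h | h
  · exact absurd h (hball hd)
  · exact h

/-- A closed edge and the remainder of the graph are closed, cover it and meet only in vertices. A
connected set without vertices therefore stays on one side. -/
theorem exists_subset_openEdge {C : Set E3} (hC : IsPreconnected C) (hne : C.Nonempty)
    (hsub : C ⊆ R.carrier) (hv : ∀ x ∈ C, x ∉ R.verts) : ∃ k, C ⊆ R.arc k '' Ioo 0 1 := by
  obtain ⟨x, hx⟩ := hne
  rcases R.mem_carrier_iff.1 (hsub hx) with h | ⟨k, s, hs, rfl⟩
  · exact absurd h (hv x hx)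
  have hop : ∀ y ∈ C, y ∈ R.edge k → y ∈ R.arc k '' Ioo 0 1 := by
    rintro _ hy ⟨u, hu, rfl⟩
    have := hv _ hy
    rw [R.arc_mem_verts_iff hu, not_or] at this
    exact ⟨u, ⟨hu.1.lt_of_ne' this.1, hu.2.lt_of_ne this.2⟩, rfl⟩
  refine ⟨k, fun y hy => hop y hy ?_⟩
  have key := isPreconnected_iff_subset_of_disjoint_closed.1 hC (R.edge k) (R.remainder k 0 1)
    (R.isCompact_arc_image k le_rfl le_rfl).isClosed
    (isClosed_remainder zero_le_one zero_le_one) ?_ ?_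
  · rcases key with h | h
    · exact h hy
    · exact absurd (h hx) (arc_notMem_remainder le_rfl le_rfl hs)
  · intro z hz
    rcases carrier_subset_remainder (k := k) (a := 0) (b := 1) (hsub hz) with h | h
    · exact Or.inr h
    · exact Or.inl (image_mono Ioo_subset_Icc_self h)
  · rw [eq_empty_iff_forall_notMem]
    rintro z ⟨hz, h1, h2⟩
    obtain ⟨u, hu, rfl⟩ := hop z hz h1
    exact arc_notMem_remainder le_rfl le_rfl hu h2

theorem exists_openEdge_subset {S T : ContinuousGraph} (hc : S.carrier = T.carrier)
    (hv : S.verts = T.verts) (k : Fin S.numEdges) :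
    ∃ l, S.arc k '' Ioo 0 1 ⊆ T.arc l '' Ioo 0 1 := by
  refine exists_subset_openEdge ?_ ?_ ?_ ?_
  · exact isPreconnected_Ioo.image _ ((S.arc_continuousOn k).mono Ioo_subset_Icc_self)
  · exact (nonempty_Ioo.2 one_pos).image _
  · rintro _ ⟨s, hs, rfl⟩
    rw [← hc]
    exact S.arc_mem_carrier k (Ioo_subset_Icc_self hs)
  · rintro _ ⟨s, hs, rfl⟩
    rw [← hv]
    exact S.arc_notMem_verts k s hs

theorem openEdge_inj {k l : Fin R.numEdges}
    (h : R.arc k '' Ioo 0 1 ⊆ R.arc l '' Ioo 0 1) : k = l := by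
  have h2 : (1 / 2 : ℝ) ∈ Ioo (0 : ℝ) 1 := by norm_num
  obtain ⟨s, hs, hs'⟩ := h ⟨1 / 2, h2, rfl⟩
  exact (R.arc_disjoint l k s hs _ h2 hs').symm

theorem closure_openEdge (k : Fin R.numEdges) : closure (R.arc k '' Ioo 0 1) = R.edge k := by
  have h : closure (Ioo (0 : ℝ) 1) = Icc 0 1 := closure_Ioo zero_ne_one
  have := image_closure_of_isCompact (s := Ioo (0 : ℝ) 1) (f := R.arc k) (by
    rw [h]; exact isCompact_Icc) (by rw [h]; exact R.arc_continuousOn k)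
  rw [← this, h]
  rfl

theorem edge_inter_verts (k : Fin R.numEdges) :
    R.edge k ∩ R.verts = {R.arc k 0, R.arc k 1} := by
  ext x
  constructor
  · rintro ⟨⟨s, hs, rfl⟩, h⟩
    rcases (R.arc_mem_verts_iff hs).1 h with rfl | rfl <;> simp
  · rintro (rfl | rfl)
    · exact ⟨⟨0, by simp, rfl⟩, R.arc_zero_mem k⟩
    · exact ⟨⟨1, by simp, rfl⟩, R.arc_one_mem k⟩

/-- A graph is determined by its point set and its vertices, up to the numbering and the
parameterization of the edges. -/
theorem sum_edges_eq {S T : ContinuousGraph} (hc : S.carrier = T.carrier) (hv : S.verts = T.verts)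
    {F : E3 → E3 → ℝ} (hF : ∀ x y, F x y = F y x) :
    ∑ k, F (S.arc k 0) (S.arc k 1) = ∑ k, F (T.arc k 0) (T.arc k 1) := by
  choose φ hφ using exists_openEdge_subset hc hv
  choose ψ hψ using exists_openEdge_subset hc.symm hv.symm
  have h1 : ∀ k, ψ (φ k) = k := fun k => (openEdge_inj ((hφ k).trans (hψ _))).symm
  have h2 : ∀ k, φ (ψ k) = k := fun k => (openEdge_inj ((hψ k).trans (hφ _))).symm
  refine Fintype.sum_equiv ⟨φ, ψ, h1, h2⟩ _ _ fun k => ?_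
  have h3 : S.arc k '' Ioo 0 1 = T.arc (φ k) '' Ioo 0 1 :=
    (hφ k).antisymm (by simpa only [h1] using hψ (φ k))
  -- The pair of endpoints is recovered from the open edge as its closure intersected with the
  -- vertices. Their order is lost, which is why `F` must be symmetric.
  have h4 : ({S.arc k 0, S.arc k 1} : Set E3) = {T.arc (φ k) 0, T.arc (φ k) 1} := by
    rw [← edge_inter_verts, ← edge_inter_verts, ← closure_openEdge, ← closure_openEdge, h3, hv]
  rcases Set.pair_eq_pair_iff.1 h4 with ⟨h5, h6⟩ | ⟨h5, h6⟩
  · simp [h5, h6]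
  · simp [h5, h6, hF]

/-! ### Valences -/

theorem path_zero (d : Fin R.numEdges × Bool) :
    R.path d 0 = if d.2 then R.arc d.1 0 else R.arc d.1 1 := by
  simp [path]

theorem path_one (d : Fin R.numEdges × Bool) :
    R.path d 1 = if d.2 then R.arc d.1 1 else R.arc d.1 0 := by
  simp [path]

theorem exists_path_eq_iff_of_mem {q : E3} (hq : q ∈ R.verts) (d : Fin R.numEdges × Bool) :
    (∃ t ∈ Ico (0 : ℝ) 1, R.path d t = q) ↔ R.path d 0 = q := by
  constructor
  · rintro ⟨t, ht, rfl⟩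
    unfold path at hq ⊢
    split_ifs at hq ⊢
    · rcases (R.arc_mem_verts_iff ⟨ht.1, ht.2.le⟩).1 hq with rfl | rfl
      · rfl
      · exact absurd ht.2 (lt_irrefl _)
    · rcases (R.arc_mem_verts_iff (s := 1 - t) ⟨by linarith [ht.2], by linarith [ht.1]⟩).1 hq
        with h | h
      · linarith [ht.2]
      · rw [h, sub_zero]
  · intro h
    exact ⟨0, by simp, h⟩

theorem exists_path_eq_arc_iff {i : Fin R.numEdges} {s : ℝ} (hs : s ∈ Ioo (0 : ℝ) 1)
    (d : Fin R.numEdges × Bool) : (∃ t ∈ Ico (0 : ℝ) 1, R.path d t = R.arc i s) ↔ d.1 = i := by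
  have aux : ∀ {j u}, u ∈ Icc (0 : ℝ) 1 → R.arc j u = R.arc i s → j = i := by
    intro j u hu h
    have hv : R.arc j u ∉ R.verts := h ▸ R.arc_notMem_verts i s hs
    rw [R.arc_mem_verts_iff hu, not_or] at hv
    exact R.arc_disjoint j i u ⟨hu.1.lt_of_ne' hv.1, hu.2.lt_of_ne hv.2⟩ s hs h
  obtain ⟨j, b⟩ := d
  constructor
  · rintro ⟨t, ht, h⟩
    cases b
    · exact aux (u := 1 - t) ⟨by linarith [ht.2], by linarith [ht.1]⟩ (by simpa [path] using h)
    · exact aux (u := t) ⟨ht.1, ht.2.le⟩ (by simpa [path] using h)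
  · rintro rfl
    cases b
    · exact ⟨1 - s, ⟨by linarith [hs.2], by linarith [hs.1]⟩, by simp [path]⟩
    · exact ⟨s, ⟨hs.1.le, hs.2⟩, by simp [path]⟩

theorem valence_eq_ncard (q : E3) :
    R.valence q = {d | ∃ t ∈ Ico (0 : ℝ) 1, R.path d t = q}.ncard := rfl

theorem valence_arc {i : Fin R.numEdges} {s : ℝ} (hs : s ∈ Ioo (0 : ℝ) 1) :
    R.valence (R.arc i s) = 2 := by
  simp only [valence_eq_ncard, exists_path_eq_arc_iff hs]
  have : {d : Fin R.numEdges × Bool | d.1 = i} = {(i, true), (i, false)} := by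
    ext ⟨j, b⟩; cases b <;> simp
  rw [this, Set.ncard_pair (by simp)]

theorem valence_of_mem {q : E3} (hq : q ∈ R.verts) :
    R.valence q = {d | R.path d 0 = q}.ncard := by
  simp only [valence_eq_ncard, exists_path_eq_iff_of_mem hq]

/-- Following a branch of `R` away from a vertex of `U`, one first runs along a piece that starts
there. With `eq_of_path_zero_eq` the piece is unique, so branches of `R` match edge ends of `U`. -/
theorem Refinement.exists_path_eq_iff {U : ContinuousGraph} (f : Refinement U R) {q : E3}
    (hq : q ∈ U.verts) (d : Fin R.numEdges × Bool) :
    (∃ t ∈ Ico (0 : ℝ) 1, R.path d t = q) ↔ ∃ k, f.ι k = d.1 ∧ U.path (k, d.2) 0 = q := by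
  obtain ⟨i, b⟩ := d
  cases b
  · simp only [path, Bool.false_eq_true, if_false]
    constructor
    · rintro ⟨t, ht, rfl⟩
      obtain ⟨k, rfl, h⟩ := f.exists_β_eq (i := i) (s := 1 - t) (by linarith [ht.2])
        (by linarith [ht.1]) hq
      exact ⟨k, rfl, by rw [sub_zero, f.arc_one, h]⟩
    · rintro ⟨k, rfl, rfl⟩
      have := f.β_mem k
      refine ⟨1 - f.β k, ⟨by linarith [this.2], by linarith [this.1]⟩, ?_⟩
      rw [sub_sub_cancel, sub_zero, f.arc_one]
  · simp only [path, if_true]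
    constructor
    · rintro ⟨t, ht, rfl⟩
      obtain ⟨k, rfl, h⟩ := f.exists_α_eq ht.1 ht.2 hq
      exact ⟨k, rfl, by rw [f.arc_zero, h]⟩
    · rintro ⟨k, rfl, rfl⟩
      exact ⟨f.α k, f.α_mem k, (f.arc_zero k).symm⟩

theorem Refinement.eq_of_path_zero_eq {U : ContinuousGraph} (f : Refinement U R) {k l b}
    (hkl : f.ι k = f.ι l) (h : U.path (k, b) 0 = U.path (l, b) 0) : k = l := by
  cases b
  · simp only [path_zero, Bool.false_eq_true, if_false, f.arc_one] at h
    have hk := f.β_mem k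
    have hl := f.β_mem l
    rw [hkl] at h
    exact f.eq_of_β_eq hkl (R.arc_injOn _ ⟨hk.1.le, hk.2⟩ ⟨hl.1.le, hl.2⟩ h)
  · simp only [path_zero, if_true, f.arc_zero] at h
    have hk := f.α_mem k
    have hl := f.α_mem l
    rw [hkl] at h
    exact f.eq_of_α_eq hkl (R.arc_injOn _ ⟨hk.1, hk.2.le⟩ ⟨hl.1, hl.2.le⟩ h)

/-- Passing to a refinement does not change the number of branches with a given property. -/
theorem Refinement.ncard_branch {U : ContinuousGraph} (f : Refinement U R) {q : E3}
    (hq : q ∈ U.verts) (p : R.Branch q → Prop) (p' : Fin U.numEdges × Bool → Prop)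
    (hp : ∀ b : R.Branch q, ∀ k, f.ι k = b.1.1 → U.path (k, b.1.2) 0 = q → (p b ↔ p' (k, b.1.2))) :
    {b | p b}.ncard = {d | U.path d 0 = q ∧ p' d}.ncard := by
  have h : Subtype.val '' {b | p b}
      = (fun d : Fin U.numEdges × Bool => (f.ι d.1, d.2)) '' {d | U.path d 0 = q ∧ p' d} := by
    ext d
    constructor
    · rintro ⟨b, hb, rfl⟩
      obtain ⟨k, hk, hk'⟩ := (f.exists_path_eq_iff hq b.1).1 b.2
      exact ⟨(k, b.1.2), ⟨hk', (hp b k hk hk').1 hb⟩, by simp [hk]⟩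
    · rintro ⟨⟨k, c⟩, ⟨h1, h2⟩, rfl⟩
      refine ⟨⟨(f.ι k, c), (f.exists_path_eq_iff hq _).2 ⟨k, rfl, h1⟩⟩, ?_, rfl⟩
      exact (hp _ k rfl h1).2 h2
  rw [← Set.ncard_image_of_injective _ Subtype.val_injective, h, Set.InjOn.ncard_image]
  rintro ⟨k, b⟩ ⟨hk, _⟩ ⟨l, c⟩ ⟨hl, _⟩ hkl
  simp only [Prod.mk.injEq] at hkl
  obtain ⟨h1, rfl⟩ := hkl
  rw [f.eq_of_path_zero_eq h1 (hk.trans hl.symm)]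

theorem Refinement.valence_eq {U : ContinuousGraph} (f : Refinement U R) {q : E3}
    (hq : q ∈ R.carrier) : U.valence q = R.valence q := by
  by_cases hU : q ∈ U.verts
  · have := f.ncard_branch hU (fun _ => True) (fun _ => True) (by simp)
    rw [Set.ofPred_true, Set.ncard_univ] at this
    simp only [and_true] at this
    rw [valence_of_mem hU, ← this]
    rfl
  · have hR : q ∉ R.verts := fun h => hU (f.verts_subset h)
    rcases R.mem_carrier_iff.1 hq with h | ⟨i, s, hs, rfl⟩
    · exact absurd h hR
    rw [valence_arc hs]
    rw [← f.carrier_eq] at hq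
    rcases U.mem_carrier_iff.1 hq with h | ⟨j, u, hu, h⟩
    · exact absurd h hU
    rw [← h, valence_arc hu]

/-- Puts the valence into the form of a symmetric sum over edges, to which `sum_edges_eq` applies.
-/
theorem valence_eq_sum {q : E3} (hq : q ∈ R.verts) : (R.valence q : ℝ)
    = ∑ k, ((({q} : Set E3).indicator 1 (R.arc k 0) : ℝ) + ({q} : Set E3).indicator 1 (R.arc k 1)) := by
  classical
  rw [valence_of_mem hq, Set.ncard_eq_toFinset_card', Set.toFinset_ofPred, ← Finset.sum_boole,
    Fintype.sum_prod_type]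
  simp only [Fintype.sum_bool, path_zero, if_true, Bool.false_eq_true, if_false]
  simp [indicator]

/-- The refinements `U` and `W` have the same vertices and points but may number and parameterize
their edges differently; symmetric sums over edges do not see this. -/
theorem exists_common_refinement {S T : ContinuousGraph} (h : S.carrier = T.carrier) :
    ∃ U W : ContinuousGraph, Nonempty (Refinement U S) ∧ Nonempty (Refinement W T) ∧
      U.carrier = W.carrier ∧ U.verts = W.verts ∧ U.verts = S.verts ∪ T.verts := by
  obtain ⟨U, hU, ⟨f⟩⟩ := S.exists_refinement (V := T.verts)
    (h ▸ T.verts_subset_carrier)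
  obtain ⟨W, hW, ⟨g⟩⟩ := T.exists_refinement (V := S.verts)
    (h ▸ S.verts_subset_carrier)
  exact ⟨U, W, ⟨f⟩, ⟨g⟩, by rw [f.carrier_eq, g.carrier_eq, h], by rw [hU, hW, Finset.union_comm],
    hU⟩

theorem valence_eq_of_carrier_eq {S T : ContinuousGraph} (h : S.carrier = T.carrier) {q : E3}
    (hq : q ∈ T.carrier) : S.valence q = T.valence q := by
  obtain ⟨U, W, ⟨f⟩, ⟨g⟩, hc, hv, -⟩ := exists_common_refinement h
  rw [← f.valence_eq (h ▸ hq), ← g.valence_eq hq]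
  rw [← g.carrier_eq] at hq
  by_cases hW : q ∈ W.verts
  · have := sum_edges_eq hc hv (F := fun x y => ({q} : Set E3).indicator 1 x
      + ({q} : Set E3).indicator 1 y) fun x y => add_comm _ _
    rw [← valence_eq_sum hW, ← valence_eq_sum (hv ▸ hW)] at this
    exact_mod_cast this
  · rcases W.mem_carrier_iff.1 hq with h1 | ⟨i, s, hs, h1⟩
    · exact absurd h1 hW
    rcases U.mem_carrier_iff.1 (hc ▸ hq) with h2 | ⟨j, u, hu, h2⟩
    · exact absurd (hv ▸ h2) hW
    rw [← h1, valence_arc hs, h1, ← h2, valence_arc hu]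

/-- Valence is determined by the point set, so only point sets need to be compared from here on. -/
theorem isSubdivision_iff {G S : ContinuousGraph} :
    G.IsSubdivision S ↔ S.carrier = G.carrier :=
  ⟨fun h => h.1, fun h => ⟨h, fun _ hq => valence_eq_of_carrier_eq h hq⟩⟩

/-! ### Small edges -/

theorem exists_diam_le (R : ContinuousGraph) {δ : ℝ} (hδ : 0 < δ) : ∃ V : Finset E3,
    (V : Set E3) ⊆ R.carrier ∧ ∀ U : ContinuousGraph, Refinement U R → V ⊆ U.verts →
      ∀ k, Metric.diam (U.edge k) ≤ δ := by
  classical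
  have h1 : ∀ i, ∃ n : ℕ, 0 < n ∧ ∀ s ∈ Icc (0 : ℝ) 1, ∀ t ∈ Icc (0 : ℝ) 1,
      dist s t ≤ 1 / n → dist (R.arc i s) (R.arc i t) ≤ δ := by
    intro i
    have h := isCompact_Icc.uniformContinuousOn_of_continuous (R.arc_continuousOn i)
    obtain ⟨η, hη, h⟩ := Metric.uniformContinuousOn_iff_le.1 h δ hδ
    obtain ⟨n, hn⟩ := exists_nat_one_div_lt hη
    refine ⟨n + 1, n.succ_pos, fun s hs t ht hst => h s hs t ht (hst.trans ?_)⟩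
    push_cast
    exact hn.le
  choose n hn0 hn using h1
  refine ⟨Finset.univ.biUnion fun i => (Finset.range (n i)).image fun j : ℕ =>
    R.arc i ((j : ℝ) / n i), ?_, ?_⟩
  · intro x hx
    simp only [Finset.coe_biUnion, mem_iUnion, Finset.coe_image, mem_image, Finset.coe_range] at hx
    obtain ⟨i, -, j, hj, rfl⟩ := hx
    refine R.arc_mem_carrier i ⟨by positivity, ?_⟩
    have : (0 : ℝ) < n i := by exact_mod_cast hn0 i
    rw [div_le_one this]
    exact_mod_cast (mem_Iio.1 hj).le
  · intro U f hV k
    have hpos : (0 : ℝ) < n (f.ι k) := by exact_mod_cast hn0 _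
    have hlen : f.β k - f.α k ≤ 1 / n (f.ι k) := by
      by_contra! H
      have h0 := f.α_mem k
      have hm := Nat.lt_floor_add_one ((n (f.ι k)) * f.α k : ℝ)
      have hm' := Nat.floor_le (a := (n (f.ι k)) * f.α k) (by have := h0.1; positivity)
      set m := ⌊(n (f.ι k)) * f.α k⌋₊
      -- The first grid point after `α` would lie inside a piece longer than the mesh, although it
      -- is a vertex.
      have h2 : ((m + 1 : ℕ) : ℝ) / n (f.ι k) ∈ Ioo (f.α k) (f.β k) := by
        constructor
        · rw [lt_div_iff₀ hpos]
          push_cast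
          linarith
        · have : ((m + 1 : ℕ) : ℝ) / n (f.ι k) ≤ f.α k + 1 / n (f.ι k) := by
            rw [div_le_iff₀ hpos, add_mul, one_div_mul_cancel hpos.ne']
            push_cast
            linarith
          linarith
      refine f.notMem_verts h2 (hV ?_)
      simp only [Finset.mem_biUnion, Finset.mem_univ, true_and, Finset.mem_image, Finset.mem_range]
      refine ⟨f.ι k, m + 1, ?_, rfl⟩
      have := (f.mem_Ioo h2).2
      rw [div_lt_one hpos] at this
      exact_mod_cast this
    refine Metric.diam_le_of_forall_dist_le hδ.le ?_
    rintro _ ⟨s, hs, rfl⟩ _ ⟨t, ht, rfl⟩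
    rw [f.arc_eq k s hs, f.arc_eq k t ht]
    have hab := f.α_lt_β k
    refine hn _ _ (affine_mem_Icc (f.α_nonneg k) hab (f.β_le_one k) hs) _
      (affine_mem_Icc (f.α_nonneg k) hab (f.β_le_one k) ht) (le_trans ?_ hlen)
    rw [Real.dist_eq, abs_le]
    constructor <;> nlinarith [hs.1, hs.2, ht.1, ht.2]

end ContinuousGraph

/-! ### Adding vertices increases the multiplicity -/

theorem sign_le_sign {x y : ℝ} (h : 0 < x → 0 < y) (h' : 0 ≤ x → 0 ≤ y) :
    Real.sign x ≤ Real.sign y := by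
  rcases lt_trichotomy x 0 with hx | hx | hx
  · rw [Real.sign_of_neg hx]; exact neg_one_le_sign y
  · rw [hx, Real.sign_zero]
    rcases (h' hx.ge).eq_or_lt with hy | hy
    · rw [← hy, Real.sign_zero]
    · rw [Real.sign_of_pos hy]; exact zero_le_one
  · rw [Real.sign_of_pos hx, Real.sign_of_pos (h hx)]

/-- A jump `a` of an indicator can be absorbed into the height, so that only drops of `a * height`
need to be discussed. -/
theorem mul_sign_sub {a : ℝ} (ha : a = 0 ∨ a = 1 ∨ a = -1) (x y : ℝ) :
    a * Real.sign (x - y) = Real.sign (a * x - a * y) := by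
  rcases ha with rfl | rfl | rfl
  · simp
  · simp
  · rw [neg_one_mul, ← Real.sign_neg]; ring_nf

theorem indicator_sub_indicator (A : Set E3) (x y : E3) :
    (A.indicator 1 x - A.indicator 1 y : ℝ) = 0 ∨ (A.indicator 1 x - A.indicator 1 y : ℝ) = 1 ∨
      (A.indicator 1 x - A.indicator 1 y : ℝ) = -1 := by
  by_cases hx : x ∈ A <;> by_cases hy : y ∈ A <;> simp [hx, hy]

namespace ContinuousGraph

theorem cut_eq_of_verts_eq {S T : ContinuousGraph} (hc : S.carrier = T.carrier)
    (hv : S.verts = T.verts) (e : S2) (χ : E3 → ℝ) : S.inscribed.cut e χ = T.inscribed.cut e χ := by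
  have := sum_edges_eq hc hv (F := fun x y => (χ x - χ y) * Real.sign (height e x - height e y))
    fun x y => by rw [sign_sub_comm]; ring
  exact congrArg (1 / 2 * ·) this

/-- Extend a set of vertices to a set of points such that the edge number `k` is left at the
parameter `c k` if exactly one of its ends belongs to the set. -/
def extendSet (Q : ContinuousGraph) (A : Set E3) (c : Fin Q.numEdges → ℝ) : Set E3 :=
  {x | (x ∈ Q.verts ∧ x ∈ A) ∨ ∃ k, ∃ s ∈ Ioo (0 : ℝ) 1, Q.arc k s = x ∧
    ((s ≤ c k ∧ Q.arc k 0 ∈ A) ∨ (c k < s ∧ Q.arc k 1 ∈ A))}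

variable {Q U : ContinuousGraph} {A : Set E3} {c : Fin Q.numEdges → ℝ}

theorem mem_extendSet_iff_of_mem {x : E3} (hx : x ∈ Q.verts) :
    x ∈ Q.extendSet A c ↔ x ∈ A := by
  constructor
  · rintro (h | ⟨k, s, hs, rfl, -⟩)
    · exact h.2
    · exact absurd hx (Q.arc_notMem_verts k s hs)
  · intro h
    exact Or.inl ⟨hx, h⟩

theorem arc_mem_extendSet_iff (hc : ∀ k, c k ∈ Ico (0 : ℝ) 1) {k : Fin Q.numEdges} {s : ℝ}
    (hs : s ∈ Icc (0 : ℝ) 1) : Q.arc k s ∈ Q.extendSet A c ↔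
      (s ≤ c k ∧ Q.arc k 0 ∈ A) ∨ (c k < s ∧ Q.arc k 1 ∈ A) := by
  rcases eq_or_lt_of_le hs.1 with rfl | h0
  · rw [mem_extendSet_iff_of_mem (Q.arc_zero_mem k)]
    simp [(hc k).1, (hc k).1.not_gt]
  rcases eq_or_lt_of_le hs.2 with rfl | h1
  · rw [mem_extendSet_iff_of_mem (Q.arc_one_mem k)]
    simp [(hc k).2, (hc k).2.not_ge]
  constructor
  · rintro (h | ⟨l, u, hu, h, h'⟩)
    · exact absurd h.1 (Q.arc_notMem_verts k s ⟨h0, h1⟩)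
    · obtain ⟨rfl, rfl⟩ := (Q.arc_eq_arc_iff hu ⟨h0, h1⟩).1 h
      exact h'
  · intro h
    exact Or.inr ⟨k, s, ⟨h0, h1⟩, rfl, h⟩

theorem indicator_extendSet (hc : ∀ k, c k ∈ Ico (0 : ℝ) 1) {k : Fin Q.numEdges} {s : ℝ}
    (hs : s ∈ Icc (0 : ℝ) 1) : (Q.extendSet A c).indicator (1 : E3 → ℝ) (Q.arc k s)
      = if s ≤ c k then A.indicator 1 (Q.arc k 0) else A.indicator 1 (Q.arc k 1) := by
  classical
  simp only [indicator, arc_mem_extendSet_iff hc hs]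
  rcases le_or_gt s (c k) with h | h
  · simp [h, h.not_gt]
  · simp [h, h.not_ge]

/-- The extended indicator changes on edge `k` immediately after the start of the chosen piece `j
k`, and nowhere else. So the cut of `U` collapses to one term per edge of `Q`. -/
theorem cut_le_cut_extendSet (f : Refinement U Q) (e : S2) (A : Set E3)
    (j : Fin Q.numEdges → Fin U.numEdges) (hj : ∀ k, f.ι (j k) = k)
    (h : ∀ k, (A.indicator 1 (Q.arc k 0) - A.indicator 1 (Q.arc k 1)) *
        Real.sign (height e (Q.arc k 0) - height e (Q.arc k 1))
      ≤ (A.indicator 1 (Q.arc k 0) - A.indicator 1 (Q.arc k 1)) *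
        Real.sign (height e (U.arc (j k) 0) - height e (U.arc (j k) 1))) :
    Q.inscribed.cut e (A.indicator 1)
      ≤ U.inscribed.cut e ((Q.extendSet A fun k => f.α (j k)).indicator 1) := by
  classical
  set a : Fin Q.numEdges → ℝ := fun k => A.indicator 1 (Q.arc k 0) - A.indicator 1 (Q.arc k 1)
    with ha
  have hc : ∀ k, (fun k => f.α (j k)) k ∈ Ico (0 : ℝ) 1 := fun k => f.α_mem _
  have key : ∀ l, (Q.extendSet A fun k => f.α (j k)).indicator 1 (U.arc l 0)
      - (Q.extendSet A fun k => f.α (j k)).indicator 1 (U.arc l 1)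
      = ∑ k, if j k = l then a k else 0 := by
    intro l
    have hα := f.α_mem l
    have hβ := f.β_mem l
    have hαβ := f.α_lt_β l
    rw [f.arc_zero, f.arc_one, indicator_extendSet hc ⟨hα.1, hα.2.le⟩,
      indicator_extendSet hc ⟨hβ.1.le, hβ.2⟩, Finset.sum_eq_single (f.ι l)]
    · by_cases hl : j (f.ι l) = l
      · simp [hl, hαβ, ha]
      · rw [if_neg hl]
        have h1 := f.α_lt_β (j (f.ι l))
        by_cases h2 : f.β l ≤ f.α (j (f.ι l))
        · rw [if_pos h2, if_pos (hαβ.le.trans h2), sub_self]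
        · rw [if_neg h2, if_neg, sub_self]
          intro h3
          obtain ⟨s, hs, hs'⟩ := exists_between (lt_min h1 (not_le.1 h2))
          refine hl (f.eq_of_mem (hj _) ⟨hs, hs'.trans_le (min_le_left _ _)⟩
            ⟨h3.trans_lt hs, hs'.trans_le (min_le_right _ _)⟩)
    · intro k _ hk
      rw [if_neg]
      rintro rfl
      exact hk (hj k).symm
    · simp
  have h2 : U.inscribed.cut e ((Q.extendSet A fun k => f.α (j k)).indicator 1)
      = (1 / 2) * ∑ k, a k * Real.sign (height e (U.arc (j k) 0) - height e (U.arc (j k) 1)) := by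
    change (1 / 2 : ℝ) * ∑ l, ((Q.extendSet A fun k => f.α (j k)).indicator 1 (U.arc l 0)
      - (Q.extendSet A fun k => f.α (j k)).indicator 1 (U.arc l 1))
      * Real.sign (height e (U.arc l 0) - height e (U.arc l 1)) = _
    simp only [key, Finset.sum_mul]
    rw [Finset.sum_comm]
    simp
  rw [h2]
  exact mul_le_mul_of_nonneg_left (Finset.sum_le_sum fun k _ => h k) (by norm_num)

/-- If `a * height` drops (weakly) along the edge, it drops (weakly) along some piece; if it rises,
the edge contributes the least possible value and any piece will do. -/
theorem exists_piece (f : Refinement U Q) (e : S2) (A : Set E3) (k : Fin Q.numEdges) :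
    ∃ l, f.ι l = k ∧ (A.indicator 1 (Q.arc k 0) - A.indicator 1 (Q.arc k 1)) *
        Real.sign (height e (Q.arc k 0) - height e (Q.arc k 1))
      ≤ (A.indicator 1 (Q.arc k 0) - A.indicator 1 (Q.arc k 1)) *
        Real.sign (height e (U.arc l 0) - height e (U.arc l 1)) := by
  have ha := indicator_sub_indicator A (Q.arc k 0) (Q.arc k 1)
  set a : ℝ := A.indicator 1 (Q.arc k 0) - A.indicator 1 (Q.arc k 1)
  simp only [mul_sign_sub ha, f.arc_zero, f.arc_one]
  rcases lt_trichotomy (a * height e (Q.arc k 0)) (a * height e (Q.arc k 1)) with h | h | h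
  · obtain ⟨l, hl, -⟩ := f.exists_α_le_lt k le_rfl one_pos
    exact ⟨l, hl, by rw [Real.sign_of_neg (sub_neg.2 h)]; exact neg_one_le_sign _⟩
  · obtain ⟨l, hl, h'⟩ := f.exists_le_of_le (i := k) (g := fun s => a * height e (Q.arc k s)) h.ge
    exact ⟨l, hl, sign_le_sign (fun h2 => by linarith) fun _ => by rw [hl]; linarith⟩
  · obtain ⟨l, hl, h'⟩ := f.exists_lt_of_lt (i := k) (g := fun s => a * height e (Q.arc k s)) h
    exact ⟨l, hl, sign_le_sign (fun h2 => by rw [hl]; linarith) fun _ => by rw [hl]; linarith⟩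

theorem indicator_nonneg_one (A : Set E3) (x : E3) : 0 ≤ A.indicator (1 : E3 → ℝ) x :=
  indicator_nonneg (fun _ _ => zero_le_one) x

theorem indicator_one_le_one (A : Set E3) (x : E3) : A.indicator (1 : E3 → ℝ) x ≤ 1 :=
  indicator_le_self' (fun _ _ => zero_le_one) x

/-- The multiplicity does not decrease when vertices are added. -/
theorem mult_mono {S T : ContinuousGraph} (hc : S.carrier = T.carrier) (hv : S.verts ⊆ T.verts)
    (e : S2) : S.inscribed.mult e ≤ T.inscribed.mult e := by
  obtain ⟨U, hU, ⟨f⟩⟩ := S.exists_refinement (V := T.verts) (hc ▸ T.verts_subset_carrier)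
  rw [Finset.union_eq_right.2 hv] at hU
  obtain ⟨A, hA⟩ := S.inscribed.exists_mult_eq_cut e
  choose j hj h using exists_piece f e A
  rw [hA]
  refine (cut_le_cut_extendSet f e A j hj h).trans ?_
  rw [cut_eq_of_verts_eq (f.carrier_eq.trans hc) hU]
  exact T.inscribed.cut_le_mult e (indicator_nonneg_one _) (indicator_one_le_one _)

theorem netCurv_mono {S T : ContinuousGraph} (hc : S.carrier = T.carrier) (hv : S.verts ⊆ T.verts) :
    S.inscribed.netCurv ≤ T.inscribed.netCurv := by
  rw [PolygonalGraph.netCurv_eq, PolygonalGraph.netCurv_eq]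
  gcongr
  exact mult_mono hc hv _

end ContinuousGraph

/-! ### Comparison with subdivisions into short arcs -/

/-- By continuity a drop between two parameters persists on open intervals near them, kept away from
`0` and `1`. Any vertices of a fine subdivision that fall in these intervals will then exhibit the
drop. -/
theorem exists_intervals_of_lt {f : ℝ → ℝ} (hf : ContinuousOn f (Icc 0 1)) {x y : ℝ} (hx : 0 ≤ x)
    (hxy : x < y) (hy : y ≤ 1) (h : f y < f x) : ∃ a b c d : ℝ, 0 < a ∧ a < b ∧ b ≤ c ∧ c < d ∧
      d < 1 ∧ ∀ u ∈ Ioo a b, ∀ v ∈ Ioo c d, f v < f u := by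
  have hpos : 0 < (f x - f y) / 2 := by linarith
  obtain ⟨η, hη, h1⟩ := Metric.continuousOn_iff.1 hf x ⟨hx, hxy.le.trans hy⟩ _ hpos
  obtain ⟨θ, hθ, h2⟩ := Metric.continuousOn_iff.1 hf y ⟨hx.trans hxy.le, hy⟩ _ hpos
  obtain ⟨r, hr, hr'⟩ := exists_between (lt_min (lt_min hη hθ) (by linarith : 0 < (y - x) / 2))
  simp only [lt_min_iff] at hr'
  refine ⟨x + r / 4, x + r / 2, y - r / 2, y - r / 4, by linarith, by linarith, by linarith,
    by linarith, by linarith, fun u hu v hv => ?_⟩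
  have h3 := h1 u ⟨by linarith [hu.1], by linarith [hu.2]⟩ (by
    rw [Real.dist_eq, abs_lt]; constructor <;> linarith [hu.1, hu.2])
  have h4 := h2 v ⟨by linarith [hv.1], by linarith [hv.2]⟩ (by
    rw [Real.dist_eq, abs_lt]; constructor <;> linarith [hv.1, hv.2])
  rw [Real.dist_eq, abs_lt] at h3 h4
  linarith [h3.1, h4.2]

/-- A nonconstant function with `f 1 ≤ f 0` drops strictly somewhere: from `0` to `x` if `f x < f
0`, and from `x` to `1` otherwise. -/
theorem exists_intervals_of_imp {f : ℝ → ℝ} (hf : ContinuousOn f (Icc 0 1)) {p : Prop}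
    (hp : p → f 1 ≤ f 0) (hp' : p → ∃ x ∈ Icc (0 : ℝ) 1, f x ≠ f 0) :
    ∃ a b c d : ℝ, 0 < a ∧ a < b ∧ b ≤ c ∧ c < d ∧
      d < 1 ∧ (p → ∀ u ∈ Ioo a b, ∀ v ∈ Ioo c d, f v < f u) := by
  by_cases h : p
  · have h1 := hp h
    obtain ⟨x, hx, hne⟩ := hp' h
    have : ∃ x y, 0 ≤ x ∧ x < y ∧ y ≤ 1 ∧ f y < f x := by
      rcases lt_or_gt_of_ne hne with h2 | h2
      · refine ⟨0, x, le_rfl, hx.1.lt_of_ne' ?_, hx.2, h2⟩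
        rintro rfl
        exact hne rfl
      · refine ⟨x, 1, hx.1, hx.2.lt_of_ne ?_, le_rfl, h1.trans_lt h2⟩
        rintro rfl
        linarith
    obtain ⟨x, y, h2, h3, h4, h5⟩ := this
    obtain ⟨a, b, c, d, h6, h7, h8, h9, h10, h11⟩ := exists_intervals_of_lt hf h2 h3 h4 h5
    exact ⟨a, b, c, d, h6, h7, h8, h9, h10, fun _ => h11⟩
  -- When no drop is demanded the intervals are arbitrary.
  · exact ⟨1 / 5, 2 / 5, 3 / 5, 4 / 5, by norm_num, by norm_num, by norm_num, by norm_num,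
      by norm_num, fun h' => absurd h' h⟩

namespace ContinuousGraph

theorem exists_vert_dist_le {S : ContinuousGraph} {δ : ℝ} (hδ : 0 ≤ δ)
    (hS : ∀ k, Metric.diam (S.edge k) ≤ δ) {x : E3} (hx : x ∈ S.carrier) :
    ∃ w ∈ S.verts, dist w x ≤ δ := by
  rcases hx with h | h
  · exact ⟨x, h, by simpa using hδ⟩
  · obtain ⟨k, hk⟩ := mem_iUnion.1 h
    refine ⟨S.arc k 0, S.arc_zero_mem k, ?_⟩
    exact (Metric.dist_le_diam_of_mem (S.isCompact_arc_image k le_rfl le_rfl).isBounded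
      ⟨0, by simp, rfl⟩ hk).trans (hS k)

theorem exists_piece_between {U Q : ContinuousGraph} (f : Refinement U Q) {k : Fin Q.numEdges}
    {u v : ℝ} (hu : 0 ≤ u) (huv : u < v) (hv : v ≤ 1) (hu' : Q.arc k u ∈ U.verts)
    (hv' : Q.arc k v ∈ U.verts) (φ : ℝ → ℝ) :
    ∃ l, f.ι l = k ∧ u ≤ f.α l ∧ f.β l ≤ v ∧ (φ v < φ u → φ (f.β l) < φ (f.α l)) := by
  by_cases h : φ v < φ u
  -- Clamping the parameter to `[u, v]` makes pieces outside it contribute no drop; none straddles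
  -- `u` or `v`, since these are vertices of `U`.
  · obtain ⟨l, rfl, hl⟩ := f.exists_lt_of_lt (i := k) (g := fun s => φ (max u (min s v))) (by
      simpa [hu, huv.le, hv, hu.trans huv.le] using h)
    have hαβ := f.α_lt_β l
    have h1 : u ≤ f.α l := by
      rcases f.le_or_le hu' with h1 | h1
      · exact h1
      · simp [min_eq_left (h1.trans huv.le), min_eq_left ((hαβ.le.trans h1).trans huv.le),
          max_eq_left h1, max_eq_left (hαβ.le.trans h1)] at hl
    have h2 : f.β l ≤ v := by
      rcases f.le_or_le hv' with h2 | h2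
      · simp [min_eq_right h2, min_eq_right (h2.trans hαβ.le)] at hl
      · exact h2
    simp only [min_eq_left h2, min_eq_left (hαβ.le.trans h2), max_eq_right h1,
      max_eq_right (h1.trans hαβ.le)] at hl
    exact ⟨l, rfl, h1, h2, fun _ => hl⟩
  · obtain ⟨l, rfl, hl⟩ := f.exists_α_eq hu (huv.trans_le hv) hu'
    refine ⟨l, rfl, hl.ge, ?_, fun h' => absurd h' h⟩
    rcases f.le_or_le hv' with h2 | h2
    · linarith
    · exact h2

/-- The points of a graph outside of an open middle part of each edge which are close to
vertices in `A`. -/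
def nearSet (Q : ContinuousGraph) (A : Set E3) (a d : Fin Q.numEdges → ℝ) : Set E3 :=
  ((Q.verts : Set E3) ∩ A) ∪ ((⋃ k : {k // Q.arc k 0 ∈ A}, Q.arc k '' Icc 0 (a k)) ∪
    ⋃ k : {k // Q.arc k 1 ∈ A}, Q.arc k '' Icc (d k) 1)

theorem isClosed_nearSet {Q : ContinuousGraph} (A : Set E3) {a d : Fin Q.numEdges → ℝ}
    (ha : ∀ k, a k ≤ 1) (hd : ∀ k, 0 ≤ d k) : IsClosed (Q.nearSet A a d) := by
  refine ((Q.verts.finite_toSet.inter_of_left A).isClosed).union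
    ((isClosed_iUnion_of_finite fun k => ?_).union (isClosed_iUnion_of_finite fun k => ?_))
  · exact (Q.isCompact_arc_image k.1 le_rfl (ha k)).isClosed
  · exact (Q.isCompact_arc_image k.1 (hd k) le_rfl).isClosed

theorem mem_extendSet_of_mem_nearSet {Q : ContinuousGraph} {A : Set E3}
    {a d c : Fin Q.numEdges → ℝ} (ha : ∀ k, 0 < a k) (hac : ∀ k, a k ≤ c k) (hcd : ∀ k, c k < d k)
    (hd : ∀ k, d k < 1) {x : E3} (hx : x ∈ Q.nearSet A a d) : x ∈ Q.extendSet A c := by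
  have hc : ∀ k, c k ∈ Ico (0 : ℝ) 1 := fun k =>
    ⟨(ha k).le.trans (hac k), (hcd k).trans (hd k)⟩
  rcases hx with h | h | h
  · exact (mem_extendSet_iff_of_mem h.1).2 h.2
  · obtain ⟨⟨k, hk⟩, s, hs, rfl⟩ := mem_iUnion.1 h
    have h1 : s ≤ c k := hs.2.trans (hac k)
    exact (arc_mem_extendSet_iff hc ⟨hs.1, h1.trans (hc k).2.le⟩).2 (Or.inl ⟨h1, hk⟩)
  · obtain ⟨⟨k, hk⟩, s, hs, rfl⟩ := mem_iUnion.1 h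
    have h1 : c k < s := (hcd k).trans_le hs.1
    exact (arc_mem_extendSet_iff hc ⟨(hc k).1.trans h1.le, hs.2⟩).2 (Or.inr ⟨h1, hk⟩)

/-- Cutting at the same parameters, the extensions of `A` and of its complement are disjoint. -/
theorem extendSet_compl {Q : ContinuousGraph} {A : Set E3} {c : Fin Q.numEdges → ℝ}
    (hc : ∀ k, c k ∈ Ico (0 : ℝ) 1) {x : E3} (hx : x ∈ Q.extendSet Aᶜ c) :
    x ∉ Q.extendSet A c := by
  rcases hx with h | ⟨k, s, hs, rfl, h⟩
  · rw [mem_extendSet_iff_of_mem h.1]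
    exact h.2
  · rw [arc_mem_extendSet_iff hc (Ioo_subset_Icc_self hs)]
    rintro (h' | h') <;> rcases h with h | h
    · exact h.2 h'.2
    · exact h.1.not_ge h'.1
    · exact h'.1.not_ge h.1
    · exact h.2 h'.2

/-- Away from the middle parts of the edges, the near sets of `A` and of its complement cover the
graph. They are closed and disjoint, so a connected arc avoiding the middle parts lies in one of
them. -/
theorem carrier_subset_nearSet {Q : ContinuousGraph} (A : Set E3) (a d : Fin Q.numEdges → ℝ)
    {x : E3} (hx : x ∈ Q.carrier) (hx' : ∀ k, x ∉ Q.arc k '' Icc (a k) (d k)) :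
    x ∈ Q.nearSet A a d ∪ Q.nearSet Aᶜ a d := by
  rcases hx with h | h
  · by_cases hA : x ∈ A
    · exact Or.inl (Or.inl ⟨h, hA⟩)
    · exact Or.inr (Or.inl ⟨h, hA⟩)
  · obtain ⟨k, s, hs, rfl⟩ := mem_iUnion.1 h
    by_cases h1 : s ≤ a k
    · by_cases hA : Q.arc k 0 ∈ A
      · exact Or.inl (Or.inr (Or.inl (mem_iUnion.2 ⟨⟨k, hA⟩, s, ⟨hs.1, h1⟩, rfl⟩)))
      · exact Or.inr (Or.inr (Or.inl (mem_iUnion.2 ⟨⟨k, hA⟩, s, ⟨hs.1, h1⟩, rfl⟩)))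
    by_cases h2 : d k ≤ s
    · by_cases hA : Q.arc k 1 ∈ A
      · exact Or.inl (Or.inr (Or.inr (mem_iUnion.2 ⟨⟨k, hA⟩, s, ⟨h2, hs.2⟩, rfl⟩)))
      · exact Or.inr (Or.inr (Or.inr (mem_iUnion.2 ⟨⟨k, hA⟩, s, ⟨h2, hs.2⟩, rfl⟩)))
    · exact absurd ⟨s, ⟨(not_le.1 h1).le, (not_le.1 h2).le⟩, rfl⟩ (hx' k)

/-- If `χ` is constant on those edges of `S` which contain additional vertices of `W`, then these
vertices do not change the cut. -/
theorem cut_eq_of_refinement {W S : ContinuousGraph} (g : Refinement W S) (e : S2) (χ : E3 → ℝ)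
    (h : ∀ m, (∃ w ∈ W.verts, w ∉ S.verts ∧ w ∈ S.edge m) →
      ∀ x ∈ S.edge m, ∀ y ∈ S.edge m, χ x = χ y) :
    W.inscribed.cut e χ = S.inscribed.cut e χ := by
  set F : E3 → E3 → ℝ := fun x y => (χ x - χ y) * Real.sign (height e x - height e y) with hF
  have hmem : ∀ m, ∀ s ∈ Icc (0 : ℝ) 1, S.arc m s ∈ S.edge m := fun m s hs => ⟨s, hs, rfl⟩
  -- Each term is written as the increment of a function linear in the parameter, so that the sum
  -- telescopes. On an edge with additional vertices everything vanishes; any other edge is a single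
  -- piece, with `α = 0` and `β = 1`.
  have h2 : ∀ l, F (W.arc l 0) (W.arc l 1)
      = F (S.arc (g.ι l) 0) (S.arc (g.ι l) 1) * g.β l - F (S.arc (g.ι l) 0) (S.arc (g.ι l) 1) * g.α l := by
    intro l
    have hα := g.α_mem l
    have hβ := g.β_mem l
    by_cases hl : ∃ w ∈ W.verts, w ∉ S.verts ∧ w ∈ S.edge (g.ι l)
    · have h3 := h _ hl
      rw [g.arc_zero, g.arc_one]
      simp only [hF]
      rw [h3 _ (hmem _ 0 (by simp)) _ (hmem _ 1 (by simp)),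
        h3 _ (hmem _ _ ⟨hα.1, hα.2.le⟩) _ (hmem _ _ ⟨hβ.1.le, hβ.2⟩)]
      simp
    · have h3 : ∀ s ∈ Icc (0 : ℝ) 1, S.arc (g.ι l) s ∈ W.verts → s = 0 ∨ s = 1 := by
        intro s hs hW
        rw [← S.arc_mem_verts_iff hs]
        by_contra h4
        exact hl ⟨_, hW, h4, hmem _ s hs⟩
      have h4 : g.α l = 0 := (h3 _ ⟨hα.1, hα.2.le⟩ (g.arc_zero l ▸ W.arc_zero_mem l)).resolve_right
        hα.2.ne
      have h5 : g.β l = 1 := (h3 _ ⟨hβ.1.le, hβ.2⟩ (g.arc_one l ▸ W.arc_one_mem l)).resolve_left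
        hβ.1.ne'
      rw [g.arc_zero, g.arc_one, h4, h5]
      ring
  change (1 / 2) * ∑ l, F (W.arc l 0) (W.arc l 1) = (1 / 2) * ∑ m, F (S.arc m 0) (S.arc m 1)
  rw [Finset.sum_congr rfl fun l _ => h2 l,
    g.telescope fun m s => F (S.arc m 0) (S.arc m 1) * s]
  simp

/-- If the height is not constant along any edge of `Q`, then the multiplicity of `Q` is at most
that of any other subdivision with sufficiently small edges. -/
theorem eventually_mult_le (Q : ContinuousGraph) (e : S2)
    (hQ : ∀ k, ∃ x ∈ Icc (0 : ℝ) 1, height e (Q.arc k x) ≠ height e (Q.arc k 0)) :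
    ∀ᶠ δ in 𝓝[>] (0 : ℝ), ∀ S : ContinuousGraph, S.carrier = Q.carrier →
      (∀ k, Metric.diam (S.edge k) ≤ δ) → Q.inscribed.mult e ≤ S.inscribed.mult e := by
  obtain ⟨A, hA⟩ := Q.inscribed.exists_mult_eq_cut e
  set σ : Fin Q.numEdges → ℝ := fun k => A.indicator 1 (Q.arc k 0) - A.indicator 1 (Q.arc k 1)
    with hσ
  set f : Fin Q.numEdges → ℝ → ℝ := fun k s => σ k * height e (Q.arc k s) with hf
  have hcont : ∀ k, ContinuousOn (f k) (Icc 0 1) := fun k =>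
    continuousOn_const.mul ((continuous_height e).comp_continuousOn (Q.arc_continuousOn k))
  -- A strict drop is needed exactly on the edges where the indicator jumps and the contribution is
  -- not already `-1`; this includes horizontal chords, where nonconstancy of the height enters.
  have h1 := fun k => exists_intervals_of_imp (hcont k) (p := σ k ≠ 0 ∧ f k 1 ≤ f k 0)
    (fun h => h.2) (fun h => by
      obtain ⟨x, hx, hne⟩ := hQ k
      exact ⟨x, hx, fun h' => hne (mul_left_cancel₀ h.1 h')⟩)
  choose a b c d ha hab hbc hcd hd hlt using h1
  have e1 : ∀ k, ∀ᶠ δ in 𝓝[>] (0 : ℝ), ∀ w ∈ Q.carrier,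
      dist w (Q.arc k ((a k + b k) / 2)) ≤ δ → ∃ u ∈ Ioo (a k) (b k), Q.arc k u = w := by
    intro k
    obtain ⟨δ, hδ, h⟩ := Q.exists_dist_lt (k := k) (a := a k) (b := b k) (s := (a k + b k) / 2)
      (ha k).le (by linarith [hbc k, hcd k, hd k])
      ⟨by linarith [hab k], by linarith [hab k]⟩
    filter_upwards [Ioo_mem_nhdsGT hδ] with δ' hδ' w hw hd
    exact h w hw (hd.trans_lt hδ'.2)
  have e2 : ∀ k, ∀ᶠ δ in 𝓝[>] (0 : ℝ), ∀ w ∈ Q.carrier,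
      dist w (Q.arc k ((c k + d k) / 2)) ≤ δ → ∃ u ∈ Ioo (c k) (d k), Q.arc k u = w := by
    intro k
    obtain ⟨δ, hδ, h⟩ := Q.exists_dist_lt (k := k) (a := c k) (b := d k) (s := (c k + d k) / 2)
      (by linarith [ha k, hab k, hbc k]) (hd k).le
      ⟨by linarith [hcd k], by linarith [hcd k]⟩
    filter_upwards [Ioo_mem_nhdsGT hδ] with δ' hδ' w hw hd
    exact h w hw (hd.trans_lt hδ'.2)
  -- Short arcs through a vertex of `Q` do not reach the middle parts of the edges.
  have e3 : ∀ k, ∀ᶠ δ in 𝓝[>] (0 : ℝ), ∀ v ∈ Q.verts, ∀ s ∈ Icc (a k) (d k),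
      ¬ dist (Q.arc k s) v ≤ δ := by
    intro k
    rw [Filter.eventually_all_finset]
    intro v hv
    have hop := (Q.isCompact_arc_image k (ha k).le (hd k).le).isClosed.isOpen_compl
    have hmem : v ∈ (Q.arc k '' Icc (a k) (d k))ᶜ := by
      rintro ⟨s, hs, rfl⟩
      exact Q.arc_notMem_verts k s ⟨(ha k).trans_le hs.1, hs.2.trans_lt (hd k)⟩ hv
    obtain ⟨δ, hδ, h⟩ := Metric.isOpen_iff.1 hop v hmem
    filter_upwards [Ioo_mem_nhdsGT hδ] with δ' hδ' s hs hdist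
    exact h (Metric.mem_ball.2 (hdist.trans_lt hδ'.2)) ⟨s, hs, rfl⟩
  filter_upwards [Filter.eventually_all.2 e1, Filter.eventually_all.2 e2,
    Filter.eventually_all.2 e3, self_mem_nhdsWithin] with δ hδ1 hδ2 hδ3 hδ0 S hS hdiam
  rw [mem_Ioi] at hδ0
  obtain ⟨U, W, ⟨g⟩, ⟨g'⟩, hc, hv, hv'⟩ := exists_common_refinement hS.symm
  have hSU : S.verts ⊆ U.verts := by rw [hv']; exact Finset.subset_union_right
  -- Since its arcs are short, `S` has one vertex in each of the two intervals on edge `k`. The jump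
  -- goes to a piece between them, hence inside the middle part.
  have hpiece : ∀ k, ∃ l, g.ι l = k ∧ a k ≤ g.α l ∧ g.β l ≤ d k ∧
      (σ k ≠ 0 ∧ f k 1 ≤ f k 0 → f k (g.β l) < f k (g.α l)) := by
    intro k
    obtain ⟨w, hw, hdw⟩ := exists_vert_dist_le hδ0.le hdiam (x := Q.arc k ((a k + b k) / 2))
      (hS ▸ Q.arc_mem_carrier k
        ⟨by linarith [ha k, hab k], by linarith [hab k, hbc k, hcd k, hd k]⟩)
    obtain ⟨w', hw', hdw'⟩ := exists_vert_dist_le hδ0.le hdiam (x := Q.arc k ((c k + d k) / 2))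
      (hS ▸ Q.arc_mem_carrier k
        ⟨by linarith [ha k, hab k, hbc k, hcd k], by linarith [hcd k, hd k]⟩)
    obtain ⟨u, hu, rfl⟩ := hδ1 k w (hS ▸ S.verts_subset_carrier hw) hdw
    obtain ⟨v, hv, rfl⟩ := hδ2 k w' (hS ▸ S.verts_subset_carrier hw') hdw'
    obtain ⟨l, hl, hl1, hl2, hl3⟩ := exists_piece_between g (k := k) (u := u) (v := v)
      (by linarith [ha k, hu.1]) (by linarith [hu.2, hv.1, hbc k]) (by linarith [hv.2, hd k])
      (hSU hw) (hSU hw') (f k)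
    exact ⟨l, hl, by linarith [hu.1], by linarith [hv.2], fun h => hl3 (hlt k h u hu v hv)⟩
  choose j hj hja hjd hjlt using hpiece
  have hsign : ∀ k, σ k * Real.sign (height e (Q.arc k 0) - height e (Q.arc k 1))
      ≤ σ k * Real.sign (height e (U.arc (j k) 0) - height e (U.arc (j k) 1)) := by
    intro k
    by_cases h0 : σ k = 0
    · simp [h0]
    rw [mul_sign_sub (indicator_sub_indicator A _ _), mul_sign_sub (indicator_sub_indicator A _ _),
      g.arc_zero, g.arc_one, hj]
    by_cases h1 : f k 1 ≤ f k 0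
    · rw [Real.sign_of_pos (sub_pos.2 (hjlt k ⟨h0, h1⟩))]
      exact sign_le_one _
    · rw [Real.sign_of_neg (sub_neg.2 (not_le.1 h1))]
      exact neg_one_le_sign _
  rw [hA]
  refine (cut_le_cut_extendSet g e A j hj hsign).trans ?_
  set C : Set E3 := Q.extendSet A fun k => g.α (j k) with hC
  -- It remains to delete the vertices of `Q` that `S` lacks; the arcs of `S` through them avoid the
  -- middle parts, so the indicator is constant there.
  rw [cut_eq_of_verts_eq hc hv, cut_eq_of_refinement g']
  · exact S.inscribed.cut_le_mult e (indicator_nonneg_one _) (indicator_one_le_one _)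
  rintro m ⟨w, hw, hwS, hwm⟩
  have hwQ : w ∈ Q.verts := by
    rw [← hv, hv', Finset.mem_union] at hw
    exact hw.resolve_right hwS
  have hgc : ∀ k, g.α (j k) < d k := fun k => (g.α_lt_β _).trans_le (hjd k)
  have hdisj : ∀ x ∈ S.edge m, ∀ k, x ∉ Q.arc k '' Icc (a k) (d k) := by
    rintro x hx k ⟨s, hs, rfl⟩
    refine hδ3 k w hwQ s hs ?_
    exact (Metric.dist_le_diam_of_mem (S.isCompact_arc_image m le_rfl le_rfl).isBounded
      hx hwm).trans (hdiam m)
  have hconn : IsPreconnected (S.edge m) := isPreconnected_Icc.image _ (S.arc_continuousOn m)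
  have ha1 : ∀ k, a k ≤ 1 := fun k => by linarith [hab k, hbc k, hcd k, hd k]
  have hd1 : ∀ k, 0 ≤ d k := fun k => by linarith [ha k, hab k, hbc k, hcd k]
  have hin : ∀ x ∈ Q.nearSet A a d, x ∈ C := fun x hx =>
    mem_extendSet_of_mem_nearSet ha hja hgc hd hx
  have hout : ∀ x ∈ Q.nearSet Aᶜ a d, x ∉ C := fun x hx =>
    extendSet_compl (fun k => g.α_mem _) (mem_extendSet_of_mem_nearSet ha hja hgc hd hx)
  have hsub : ∀ x ∈ S.edge m, x ∈ Q.nearSet A a d ∪ Q.nearSet Aᶜ a d := fun x hx =>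
    carrier_subset_nearSet A a d (hS ▸ Or.inr (mem_iUnion.2 ⟨m, hx⟩)) (hdisj x hx)
  rcases isPreconnected_iff_subset_of_disjoint_closed.1 hconn _ _ (isClosed_nearSet A ha1 hd1)
    (isClosed_nearSet Aᶜ ha1 hd1) hsub (eq_empty_iff_forall_notMem.2
      fun x hx => hout x hx.2.2 (hin x hx.2.1)) with h | h
  · intro x hx y hy
    rw [indicator_of_mem (hin x (h hx)), indicator_of_mem (hin y (h hy))]
    rfl
  · intro x hx y hy
    rw [indicator_of_notMem (hout x (h hx)), indicator_of_notMem (hout y (h hy))]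

end ContinuousGraph

/-! ### Generic directions and positivity -/

namespace ContinuousGraph

variable (G : ContinuousGraph)

/-- The height is injective on the points with rational parameters of each edge. -/
def IsGeneric (e : S2) : Prop :=
  ∀ i : Fin G.numEdges, ∀ p q : ℚ, (p : ℝ) ∈ Icc (0 : ℝ) 1 → (q : ℝ) ∈ Icc (0 : ℝ) 1 → p ≠ q →
    height e (G.arc i p) ≠ height e (G.arc i q)

theorem ae_isGeneric : ∀ᵐ e ∂area, G.IsGeneric e := by
  simp only [IsGeneric, ae_all_iff]
  intro i p q hp hq hpq
  have h : G.arc i p ≠ G.arc i q := fun h => hpq (Rat.cast_injective (G.arc_injOn i hp hq h))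
  filter_upwards [ae_height_ne h] with e he using he

variable {G}

theorem IsGeneric.exists_ne {e : S2} (he : G.IsGeneric e) (i : Fin G.numEdges) {a b : ℝ}
    (ha : 0 ≤ a) (hab : a < b) (hb : b ≤ 1) :
    ∃ x ∈ Ioo a b, ∃ y ∈ Ioo a b, height e (G.arc i x) ≠ height e (G.arc i y) := by
  obtain ⟨p, hp, hp'⟩ := exists_rat_btwn hab
  obtain ⟨q, hq, hq'⟩ := exists_rat_btwn hp'
  refine ⟨p, ⟨hp, hp'⟩, q, ⟨hp.trans hq, hq'⟩, he i p q ?_ ?_ ?_⟩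
  · exact ⟨by linarith, by linarith⟩
  · exact ⟨by linarith, by linarith⟩
  · rintro rfl
    exact lt_irrefl _ hq

theorem IsGeneric.exists_ne_of_refinement {e : S2} (he : G.IsGeneric e) {U : ContinuousGraph}
    (f : Refinement U G) (k : Fin U.numEdges) :
    ∃ x ∈ Icc (0 : ℝ) 1, height e (U.arc k x) ≠ height e (U.arc k 0) := by
  obtain ⟨x, hx, y, hy, hxy⟩ := he.exists_ne (f.ι k) (f.α_nonneg k) (f.α_lt_β k) (f.β_le_one k)
  obtain ⟨u, hu, hu'⟩ := f.exists_arc_eq hx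
  obtain ⟨v, hv, hv'⟩ := f.exists_arc_eq hy
  rw [← hu', ← hv'] at hxy
  by_cases h : height e (U.arc k u) = height e (U.arc k 0)
  · exact ⟨v, Ioo_subset_Icc_self hv, fun h' => hxy (h.trans h'.symm)⟩
  · exact ⟨u, Ioo_subset_Icc_self hu, h⟩

/-- At the highest endpoint of an edge all edges go weakly down, and one of them strictly since its
chord is not horizontal. -/
theorem IsGeneric.mult_pos {e : S2} (he : G.IsGeneric e) : 0 < G.inscribed.mult e := by
  have : Nonempty (Fin G.inscribed.numEdges × Bool) := ⟨(⟨0, G.numEdges_pos⟩, true)⟩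
  obtain ⟨d, -, hd⟩ := Finset.exists_max_image Finset.univ
    (fun d => height e (G.inscribed.src d)) Finset.univ_nonempty
  have htgt : ∀ d', height e (G.inscribed.tgt d') ≤ height e (G.inscribed.src d) := by
    rintro ⟨i, b⟩
    have := hd (i, !b) (Finset.mem_univ _)
    cases b <;> simpa [PolygonalGraph.src, PolygonalGraph.tgt] using this
  have hne : height e (G.inscribed.tgt d) ≠ height e (G.inscribed.src d) := by
    have := he d.1 0 1 (by simp) (by simp) (by simp)
    obtain ⟨i, b⟩ := d
    simp only [Rat.cast_zero, Rat.cast_one] at this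
    cases b
    · simpa [PolygonalGraph.src, PolygonalGraph.tgt, inscribed] using this
    · simpa [PolygonalGraph.src, PolygonalGraph.tgt, inscribed] using this.symm
  have hmem : G.inscribed.src d ∈ G.inscribed.verts := by
    unfold PolygonalGraph.src
    split_ifs
    · exact G.inscribed.fst_mem _
    · exact G.inscribed.snd_mem _
  refine Finset.sum_pos' (fun _ _ => posPart_nonneg _) ⟨_, hmem, ?_⟩
  refine posPart_pos ?_
  classical
  rw [PolygonalGraph.nlm_eq_sum]
  refine mul_pos (by norm_num) (Finset.sum_pos' (fun d' _ => ?_) ⟨⟨d, rfl⟩, Finset.mem_univ _, ?_⟩)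
  · rcases (htgt d'.1).eq_or_lt with h | h
    · rw [h, sub_self, Real.sign_zero]
    · rw [Real.sign_of_pos (by linarith)]; exact zero_le_one
  · rw [Real.sign_of_pos (sub_pos.2 ((htgt d).lt_of_ne hne))]; exact one_pos

theorem netCurv_inscribed_le {S : ContinuousGraph} (hS : S.carrier = G.carrier) :
    S.inscribed.netCurv ≤ G.netCurv :=
  le_iSup₂_of_le S.inscribed ⟨S, isSubdivision_iff.2 hS, rfl⟩ le_rfl

variable (G) in
theorem netCurv_pos : 0 < G.netCurv := by
  refine lt_of_lt_of_le ?_ (netCurv_inscribed_le (S := G) rfl)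
  rw [PolygonalGraph.netCurv_eq, pos_iff_ne_zero]
  refine mul_ne_zero (by simp) fun h => ?_
  rw [lintegral_eq_zero_iff G.inscribed.measurable_ofReal_mult] at h
  have : NeBot (ae area) := ae_neBot.2 area_ne_zero
  obtain ⟨e, he, he'⟩ := (h.and G.ae_isGeneric).exists
  simp only [Pi.zero_apply, ENNReal.ofReal_eq_zero] at he
  exact absurd he'.mult_pos he.not_gt

/-! ### Refined sequences -/

/-- `R` cuts `T` into short arcs, using also the vertices of `Q`; `S` adds a highest and a lowest
point of each arc. Including `Q` lets the net curvature be pushed towards its supremum. -/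
theorem exists_extremal_subdivision (e : S2) (T Q : ContinuousGraph) (hQ : Q.carrier = T.carrier)
    {δ : ℝ} (hδ : 0 < δ) : ∃ S R : ContinuousGraph, S.carrier = T.carrier ∧ R.carrier = T.carrier ∧
      T.verts ⊆ S.verts ∧ Q.verts ⊆ S.verts ∧ R.verts ⊆ S.verts ∧ ∀ i : Fin R.numEdges,
    Metric.diam (R.edge i) ≤ δ ∧
    ((S.verts : Set E3) ∩ R.arc i '' Ioo 0 1).ncard ≤ 2 ∧
    (∀ x ∈ R.edge i, ∃ v ∈ S.verts, v ∈ R.edge i ∧ height e x ≤ height e v) ∧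
    (∀ x ∈ R.edge i, ∃ v ∈ S.verts, v ∈ R.edge i ∧ height e v ≤ height e x) := by
  classical
  obtain ⟨V, hV, hdiam⟩ := T.exists_diam_le hδ
  obtain ⟨R, hR, ⟨f⟩⟩ := T.exists_refinement (V := V ∪ Q.verts) (by
    rw [Finset.coe_union]
    exact union_subset hV (hQ ▸ Q.verts_subset_carrier))
  have hmax : ∀ i, ∃ x ∈ R.edge i, ∀ y ∈ R.edge i, height e y ≤ height e x := fun i =>
    (R.isCompact_arc_image i le_rfl le_rfl).exists_isMaxOn ⟨R.arc i 0, 0, by simp, rfl⟩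
      (continuous_height e).continuousOn
  have hmin : ∀ i, ∃ x ∈ R.edge i, ∀ y ∈ R.edge i, height e x ≤ height e y := fun i =>
    (R.isCompact_arc_image i le_rfl le_rfl).exists_isMinOn ⟨R.arc i 0, 0, by simp, rfl⟩
      (continuous_height e).continuousOn
  choose M hM hM' using hmax
  choose m hm hm' using hmin
  have hedge : ∀ {x i}, x ∈ R.edge i → x ∈ R.carrier := fun {x i} h =>
    Or.inr (mem_iUnion.2 ⟨i, h⟩)
  obtain ⟨S, hS, ⟨g⟩⟩ := R.exists_refinement (V := Finset.univ.image M ∪ Finset.univ.image m) (by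
    intro x hx
    simp only [Finset.coe_union, Finset.coe_image, Finset.coe_univ, image_univ] at hx
    rcases hx with ⟨i, rfl⟩ | ⟨i, rfl⟩
    · exact hedge (hM i)
    · exact hedge (hm i))
  have hMS : ∀ i, M i ∈ S.verts := fun i => by simp [hS]
  have hmS : ∀ i, m i ∈ S.verts := fun i => by simp [hS]
  have hRS : R.verts ⊆ S.verts := g.verts_subset
  refine ⟨S, R, g.carrier_eq.trans f.carrier_eq, f.carrier_eq, f.verts_subset.trans hRS,
    fun x hx => hRS (by simp [hR, hx]), hRS, fun i => ⟨hdiam R f (fun x hx => by simp [hR, hx]) i,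
    ?_, fun x hx => ⟨M i, hMS i, hM i, hM' i x hx⟩, fun x hx => ⟨m i, hmS i, hm i, hm' i x hx⟩⟩⟩
  -- An interior point of arc `i` lies on no other arc, so extremal points of other arcs add no
  -- vertices to its interior.
  have hother : ∀ {j x}, x ∈ R.edge j → x ∈ R.arc i '' Ioo 0 1 → j = i := by
    rintro j _ ⟨s, hs, rfl⟩ ⟨u, hu, h⟩
    have hv : R.arc j s ∉ R.verts := h ▸ R.arc_notMem_verts i u hu
    rw [R.arc_mem_verts_iff hs, not_or] at hv
    exact R.arc_disjoint j i s ⟨hs.1.lt_of_ne' hv.1, hs.2.lt_of_ne hv.2⟩ u hu h.symm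
  refine (Set.ncard_le_ncard (t := {M i, m i}) ?_ (by simp)).trans ((Set.ncard_insert_le _ _).trans
    (by simp))
  rintro x ⟨hx, hxi⟩
  rw [Finset.mem_coe, hS] at hx
  simp only [Finset.mem_union, Finset.mem_image, Finset.mem_univ, true_and] at hx
  rcases hx with hx | ⟨j, rfl⟩ | ⟨j, rfl⟩
  · obtain ⟨s, hs, rfl⟩ := hxi
    exact absurd hx (R.arc_notMem_verts i s hs)
  · rw [hother (hM j) hxi]; simp
  · rw [hother (hm j) hxi]; simp

theorem exists_seq_tendsto_netCurv (G : ContinuousGraph) : ∃ Q : ℕ → ContinuousGraph,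
    (∀ k, (Q k).carrier = G.carrier) ∧
      Tendsto (fun k => (Q k).inscribed.netCurv) atTop (𝓝 G.netCurv) := by
  obtain ⟨u, -, hu, hmem⟩ := exists_seq_tendsto_sSup
    (S := (fun S : ContinuousGraph => S.inscribed.netCurv) '' {S | S.carrier = G.carrier})
    ⟨_, G, rfl, rfl⟩ (OrderTop.bddAbove _)
  choose Q hQ hQ' using hmem
  have h : G.netCurv
      = sSup ((fun S : ContinuousGraph => S.inscribed.netCurv) '' {S | S.carrier = G.carrier}) := by
    apply le_antisymm
    · refine iSup₂_le ?_
      rintro _ ⟨S, hS, rfl⟩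
      exact le_sSup ⟨S, hS.1, rfl⟩
    · refine sSup_le ?_
      rintro _ ⟨S, hS, rfl⟩
      exact netCurv_inscribed_le hS
  refine ⟨Q, hQ, ?_⟩
  rw [h]
  simpa only [hQ'] using hu

/-- The graphs are built recursively, the `k`-th one containing the vertices of the `k`-th member of
a maximizing sequence; by `netCurv_mono` the net curvatures are squeezed to the supremum. -/
theorem exists_isRefinedSeq (G : ContinuousGraph) (e : S2) : ∃ S, G.IsRefinedSeq e S := by
  obtain ⟨Q, hQ, hlim⟩ := G.exists_seq_tendsto_netCurv
  have step : ∀ (T : {T : ContinuousGraph // T.carrier = G.carrier}) (k : ℕ),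
      ∃ S : {T : ContinuousGraph // T.carrier = G.carrier}, ∃ R : ContinuousGraph,
      R.carrier = G.carrier ∧
      T.1.verts ⊆ S.1.verts ∧ (Q k).verts ⊆ S.1.verts ∧ R.verts ⊆ S.1.verts ∧
      ∀ i : Fin R.numEdges,
    Metric.diam (R.edge i) ≤ 1 / ((k : ℝ) + 1) ∧
    ((S.1.verts : Set E3) ∩ R.arc i '' Ioo 0 1).ncard ≤ 2 ∧
    (∀ x ∈ R.edge i, ∃ v ∈ S.1.verts, v ∈ R.edge i ∧ height e x ≤ height e v) ∧
    (∀ x ∈ R.edge i, ∃ v ∈ S.1.verts, v ∈ R.edge i ∧ height e v ≤ height e x) := by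
    intro T k
    obtain ⟨S, R, hS, hR, h⟩ := exists_extremal_subdivision e T.1 (Q k) ((hQ k).trans T.2.symm)
      (Nat.one_div_pos_of_nat (n := k) (α := ℝ))
    exact ⟨⟨S, hS.trans T.2⟩, R, hR.trans T.2, h⟩
  choose F R hR hT hQF hRF hext using step
  set S : ℕ → {T : ContinuousGraph // T.carrier = G.carrier} :=
    fun k => Nat.rec (F ⟨G, rfl⟩ 0) (fun n T => F T (n + 1)) k with hS
  have hprev : ∀ k, ∃ T, S k = F T k := by
    rintro (_ | k)
    · exact ⟨_, rfl⟩
    · exact ⟨_, rfl⟩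
  refine ⟨fun k => (S k).1, fun k => isSubdivision_iff.2 (S k).2, fun k => hT (S k) (k + 1), ?_, ?_⟩
  · refine tendsto_of_tendsto_of_tendsto_of_le_of_le hlim tendsto_const_nhds (fun k => ?_)
      fun k => netCurv_inscribed_le (S k).2
    obtain ⟨T, hT⟩ := hprev k
    exact netCurv_mono ((hQ k).trans (S k).2.symm) (by rw [hT]; exact hQF T k)
  · intro k
    obtain ⟨T, hT⟩ := hprev k
    rw [hT]
    exact ⟨R T k, isSubdivision_iff.2 (hR T k), hRF T k, hext T k⟩

theorem IsRefinedSeq.carrier_eq {e : S2} {S : ℕ → ContinuousGraph} (h : G.IsRefinedSeq e S) (k) :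
    (S k).carrier = G.carrier := (h.isSubdivision k).1

theorem IsRefinedSeq.monotone_mult {e : S2} {S : ℕ → ContinuousGraph} (h : G.IsRefinedSeq e S)
    (e' : S2) : Monotone fun k => ENNReal.ofReal ((S k).inscribed.mult e') :=
  monotone_nat_of_le_succ fun k => ENNReal.ofReal_le_ofReal
    (mult_mono ((h.carrier_eq k).trans (h.carrier_eq _).symm) (h.nested k) e')

theorem exists_isMultiplicity (G : ContinuousGraph) (e : S2) : ∃ m, G.IsMultiplicity e m := by
  obtain ⟨S, hS⟩ := G.exists_isRefinedSeq e
  exact ⟨_, S, hS, tendsto_atTop_iSup (hS.monotone_mult e)⟩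

/-- The supremum of the multiplicities of all approximating polygonal graphs. -/
def supMult (G : ContinuousGraph) (e : S2) : ℝ≥0∞ :=
  ⨆ (S : ContinuousGraph) (_ : S.carrier = G.carrier), ENNReal.ofReal (S.inscribed.mult e)

theorem le_supMult {S : ContinuousGraph} (h : S.carrier = G.carrier) (e : S2) :
    ENNReal.ofReal (S.inscribed.mult e) ≤ G.supMult e := le_iSup₂_of_le S h le_rfl

/-- The direction `e'` in which multiplicities are compared need not be the direction `e` of the
sequence. This lets one sequence compute `supMult` in almost every direction. -/
theorem IsRefinedSeq.exists_mult_le {e e' : S2} {S : ℕ → ContinuousGraph}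
    (h : G.IsRefinedSeq e S) (he' : G.IsGeneric e') {T : ContinuousGraph}
    (hT : T.carrier = G.carrier) : ∃ k, T.inscribed.mult e' ≤ (S k).inscribed.mult e' := by
  -- `T` is replaced with a refinement of `G`, because genericity refers to the arcs of `G` and
  -- passes to their pieces.
  obtain ⟨U, hU, ⟨f⟩⟩ := G.exists_refinement (V := T.verts) (hT ▸ T.verts_subset_carrier)
  have hTU := mult_mono (hT.trans f.carrier_eq.symm)
    (hU ▸ Finset.subset_union_right : T.verts ⊆ U.verts) e'
  have hlim : Tendsto (fun k : ℕ => 1 / ((k : ℝ) + 1)) atTop (𝓝[>] 0) :=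
    tendsto_nhdsWithin_iff.2 ⟨tendsto_one_div_add_atTop_nhds_zero_nat,
      Eventually.of_forall fun k => mem_Ioi.2 Nat.one_div_pos_of_nat⟩
  obtain ⟨k, hk⟩ := (hlim.eventually
    (U.eventually_mult_le e' fun k => he'.exists_ne_of_refinement f k)).exists
  obtain ⟨R, hR, hRS, hext⟩ := h.extremal k
  exact ⟨k, hTU.trans ((hk R (hR.1.trans f.carrier_eq.symm) fun i => (hext i).1).trans
    (mult_mono (hR.1.trans (h.carrier_eq k).symm) hRS e'))⟩

theorem IsRefinedSeq.iSup_mult {e e' : S2} {S : ℕ → ContinuousGraph}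
    (h : G.IsRefinedSeq e S) (he' : G.IsGeneric e') :
    ⨆ k, ENNReal.ofReal ((S k).inscribed.mult e') = G.supMult e' := by
  apply le_antisymm
  · exact iSup_le fun k => le_supMult (h.carrier_eq k) e'
  · refine iSup₂_le fun T hT => ?_
    obtain ⟨k, hk⟩ := h.exists_mult_le he' hT
    exact le_iSup_of_le k (ENNReal.ofReal_le_ofReal hk)

theorem IsGeneric.eq_supMult {e : S2} (he : G.IsGeneric e) {m : ℝ≥0∞} (hm : G.IsMultiplicity e m) :
    m = G.supMult e := by
  obtain ⟨S, hS, hlim⟩ := hm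
  rw [← hS.iSup_mult he]
  exact tendsto_nhds_unique hlim (tendsto_atTop_iSup (hS.monotone_mult e))

/-- `supMult` is a supremum over an uncountable family; almost everywhere it agrees with the
supremum along one refined sequence, to which monotone convergence applies. -/
theorem exists_measurable_eq_supMult (G : ContinuousGraph) : ∃ φ : S2 → ℝ≥0∞, Measurable φ ∧
    φ =ᵐ[area] G.supMult ∧ G.netCurv = (1 / 2) * ∫⁻ e, φ e ∂area := by
  have : Nonempty S2 := by
    obtain ⟨x, hx⟩ := NormedSpace.sphere_nonempty (E := E3).2 zero_le_one
    exact ⟨⟨x, hx⟩⟩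
  obtain ⟨S, hS⟩ := G.exists_isRefinedSeq (Classical.arbitrary S2)
  have hmeas : ∀ k, Measurable fun e => ENNReal.ofReal ((S k).inscribed.mult e) :=
    fun k => (S k).inscribed.measurable_ofReal_mult
  refine ⟨fun e => ⨆ k, ENNReal.ofReal ((S k).inscribed.mult e), Measurable.iSup hmeas, ?_, ?_⟩
  · filter_upwards [G.ae_isGeneric] with e he using hS.iSup_mult he
  · rw [lintegral_iSup hmeas fun k l hkl e => hS.monotone_mult e hkl, ENNReal.mul_iSup]
    simp only [← PolygonalGraph.netCurv_eq]
    refine tendsto_nhds_unique hS.tendsto_netCurv (tendsto_atTop_iSup ?_)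
    exact monotone_nat_of_le_succ fun k =>
      netCurv_mono ((hS.carrier_eq k).trans (hS.carrier_eq _).symm) (hS.nested k)

/-- A bounded nonempty set of half-integers has a largest element. -/
theorem exists_mult_eq_supMult {e : S2} (h : G.supMult e ≠ ⊤) : ∃ T : ContinuousGraph,
    T.carrier = G.carrier ∧ G.supMult e = ENNReal.ofReal (T.inscribed.mult e) := by
  set N : Set ℕ := {n | ∃ T : ContinuousGraph, T.carrier = G.carrier ∧
    T.inscribed.mult e = (n : ℝ) / 2} with hN
  have hne : N.Nonempty := by
    obtain ⟨n, hn⟩ := G.inscribed.exists_mult_eq e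
    exact ⟨n, G, rfl, hn⟩
  have hbdd : BddAbove N := by
    refine ⟨⌊2 * (G.supMult e).toReal⌋₊, ?_⟩
    rintro n ⟨T, hT, hn⟩
    rw [Nat.le_floor_iff (by positivity)]
    have := (ENNReal.ofReal_le_iff_le_toReal h).1 (le_supMult hT e)
    linarith
  obtain ⟨T, hT, hn⟩ := Nat.sSup_mem hne hbdd
  refine ⟨T, hT, le_antisymm (iSup₂_le fun T' hT' => ENNReal.ofReal_le_ofReal ?_) (le_supMult hT e)⟩
  obtain ⟨n', hn'⟩ := T'.inscribed.exists_mult_eq e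
  rw [hn, hn']
  have : n' ≤ sSup N := le_csSup hbdd ⟨T', hT', hn'⟩
  have : (n' : ℝ) ≤ (sSup N : ℕ) := by exact_mod_cast this
  linarith

end ContinuousGraph

/-! ### Critical points and local monotonicity -/

namespace ContinuousGraph

variable {G : ContinuousGraph}

theorem path_injOn (d : Fin G.numEdges × Bool) : InjOn (G.path d) (Icc 0 1) := by
  intro s hs t ht h
  unfold path at h
  split_ifs at h
  · exact G.arc_injOn _ hs ht h
  · have := G.arc_injOn d.1 (x₁ := 1 - s) ⟨by linarith [hs.2], by linarith [hs.1]⟩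
      (x₂ := 1 - t) ⟨by linarith [ht.2], by linarith [ht.1]⟩ h
    linarith

theorem continuousOn_path (d : Fin G.numEdges × Bool) : ContinuousOn (G.path d) (Icc 0 1) := by
  unfold path
  split_ifs
  · exact G.arc_continuousOn _
  · exact (G.arc_continuousOn _).comp (by fun_prop)
      fun s hs => ⟨by linarith [hs.2], by linarith [hs.1]⟩

theorem along_iff {q : E3} {d : Fin G.numEdges × Bool} {t : ℝ} (ht : t ∈ Ico (0 : ℝ) 1)
    (hq : G.path d t = q) (r : ℝ → ℝ → Prop) :
    G.Along q d r ↔ ∀ᶠ ε in 𝓝[>] (0 : ℝ), r t ε := by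
  constructor
  · rintro ⟨s, hs, h, hr⟩
    have := G.path_injOn d ⟨hs.1, hs.2.le⟩ ⟨ht.1, ht.2.le⟩ (h.trans hq.symm)
    rwa [← this]
  · intro h
    exact ⟨t, ht, hq, h⟩

/-- An interior point of an edge near which the height is monotone is not critical. -/
theorem not_isCritical_of_monotoneOn {e : S2} {i : Fin G.numEdges} {t δ : ℝ} (hδ : 0 < δ)
    (ht : t ∈ Ioo (0 : ℝ) 1)
    (h : MonotoneOn (fun s => height e (G.arc i s)) (Icc (t - δ) (t + δ)) ∨
      AntitoneOn (fun s => height e (G.arc i s)) (Icc (t - δ) (t + δ))) :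
    ¬ G.IsCritical e (G.arc i t) := by
  rintro ⟨-, hcrit⟩
  rcases hcrit with hcrit | hcrit
  · exact hcrit.2 (valence_arc ht)
  apply hcrit
  have ht' : 1 - t ∈ Ico (0 : ℝ) 1 := ⟨by linarith [ht.2], by linarith [ht.1]⟩
  have h1 : G.path (i, true) t = G.arc i t := by simp [path]
  have h2 : G.path (i, false) (1 - t) = G.arc i t := by simp [path]
  have hsmall := Ioo_mem_nhdsGT hδ
  set b : G.Branch (G.arc i t) := ⟨(i, true), t, ⟨ht.1.le, ht.2⟩, h1⟩
  set b' : G.Branch (G.arc i t) := ⟨(i, false), 1 - t, ht', h2⟩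
  have hne : b ≠ b' := fun h => by simpa [b, b'] using congrArg (fun x => x.1.2) h
  rcases h with h | h
  · refine ⟨b, b', hne, (along_iff ⟨ht.1.le, ht.2⟩ h1 _).2 ?_, (along_iff ht' h2 _).2 ?_⟩
    · filter_upwards [hsmall] with ε hε x hx y hy hxy
      simp only [b, path, if_true]
      exact h ⟨by linarith [hx.1], by linarith [hx.2, hε.2]⟩
        ⟨by linarith [hy.1], by linarith [hy.2, hε.2]⟩ hxy
    · filter_upwards [hsmall] with ε hε x hx y hy hxy
      simp only [b', path, Bool.false_eq_true, if_false]
      exact h ⟨by linarith [hy.2, hε.2], by linarith [hy.1]⟩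
        ⟨by linarith [hx.2, hε.2], by linarith [hx.1]⟩ (by linarith)
  · refine ⟨b', b, hne.symm, (along_iff ht' h2 _).2 ?_, (along_iff ⟨ht.1.le, ht.2⟩ h1 _).2 ?_⟩
    · filter_upwards [hsmall] with ε hε x hx y hy hxy
      simp only [b', path, Bool.false_eq_true, if_false]
      exact h ⟨by linarith [hy.2, hε.2], by linarith [hy.1]⟩
        ⟨by linarith [hx.2, hε.2], by linarith [hx.1]⟩ (by linarith)
    · filter_upwards [hsmall] with ε hε x hx y hy hxy
      simp only [b, path, if_true]
      exact h ⟨by linarith [hx.1], by linarith [hx.2, hε.2]⟩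
        ⟨by linarith [hy.1], by linarith [hy.2, hε.2]⟩ hxy

/-- Near a point of an edge that is not critical, the height is monotone. -/
theorem exists_monotoneOn_of_not_isCritical {e : S2} {i : Fin G.numEdges} {t : ℝ}
    (ht : t ∈ Ioo (0 : ℝ) 1) (h : ¬ G.IsCritical e (G.arc i t)) : ∃ δ > 0,
      (MonotoneOn (fun s => height e (G.arc i s)) (Icc t (t + δ)) ∧
        MonotoneOn (fun s => height e (G.arc i s)) (Icc (t - δ) t)) ∨
      (AntitoneOn (fun s => height e (G.arc i s)) (Icc t (t + δ)) ∧
        AntitoneOn (fun s => height e (G.arc i s)) (Icc (t - δ) t)) := by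
  have ht' : 1 - t ∈ Ico (0 : ℝ) 1 := ⟨by linarith [ht.2], by linarith [ht.1]⟩
  have h1 : G.path (i, true) t = G.arc i t := by simp [path]
  have h2 : G.path (i, false) (1 - t) = G.arc i t := by simp [path]
  have hex : ∃ b b' : G.Branch (G.arc i t), b ≠ b' ∧
      G.Along (G.arc i t) b.1
        (fun t ε => MonotoneOn (fun s => height e (G.path b.1 s)) (Icc t (t + ε))) ∧
      G.Along (G.arc i t) b'.1
        (fun t ε => AntitoneOn (fun s => height e (G.path b'.1 s)) (Icc t (t + ε))) := by
    by_contra hcrit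
    exact h ⟨G.arc_mem_carrier i (Ioo_subset_Icc_self ht), Or.inr hcrit⟩
  obtain ⟨⟨⟨j, c⟩, hb⟩, ⟨⟨j', c'⟩, hb'⟩, hne, hm, ha⟩ := hex
  obtain rfl := (exists_path_eq_arc_iff ht _).1 hb
  obtain rfl : j' = j := (exists_path_eq_arc_iff ht _).1 hb'
  have hcc : c ≠ c' := by
    rintro rfl
    exact hne rfl
  cases c <;> cases c'
  · exact absurd rfl hcc
  · rw [along_iff ht' h2] at hm
    rw [along_iff ⟨ht.1.le, ht.2⟩ h1] at ha
    obtain ⟨δ, ⟨hm, ha⟩, hδ⟩ := ((hm.and ha).and self_mem_nhdsWithin).exists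
    refine ⟨δ, hδ, Or.inr ⟨?_, ?_⟩⟩
    · simpa [path] using ha
    · intro x hx y hy hxy
      have := hm (a := 1 - y) ⟨by linarith [hy.2], by linarith [hy.1]⟩ (b := 1 - x)
        ⟨by linarith [hx.2], by linarith [hx.1]⟩ (by linarith)
      simpa [path] using this
  · rw [along_iff ht' h2] at ha
    rw [along_iff ⟨ht.1.le, ht.2⟩ h1] at hm
    obtain ⟨δ, ⟨hm, ha⟩, hδ⟩ := ((hm.and ha).and self_mem_nhdsWithin).exists
    refine ⟨δ, hδ, Or.inl ⟨?_, ?_⟩⟩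
    · simpa [path] using hm
    · intro x hx y hy hxy
      have := ha (a := 1 - y) ⟨by linarith [hy.2], by linarith [hy.1]⟩ (b := 1 - x)
        ⟨by linarith [hx.2], by linarith [hx.1]⟩ (by linarith)
      simpa [path] using this
  · exact absurd rfl hcc

/-- As in Rolle's theorem, two equal heights force a local extremum in between. At a noncritical
point the height is also monotone, so it is constant on one side, which genericity forbids. -/
theorem IsGeneric.injOn_of_not_isCritical {e : S2} (he : G.IsGeneric e) {i : Fin G.numEdges}
    {a b : ℝ} (ha : 0 ≤ a) (hb : b ≤ 1) (h : ∀ s ∈ Ioo a b, ¬ G.IsCritical e (G.arc i s)) :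
    InjOn (fun s => height e (G.arc i s)) (Icc a b) := by
  have hcont : ContinuousOn (fun s => height e (G.arc i s)) (Icc 0 1) :=
    (continuous_height e).comp_continuousOn (G.arc_continuousOn i)
  suffices H : ∀ x ∈ Icc a b, ∀ y ∈ Icc a b, x < y →
      height e (G.arc i x) ≠ height e (G.arc i y) by
    intro x hx y hy hxy
    by_contra hne
    rcases lt_or_gt_of_ne hne with h' | h'
    · exact H x hx y hy h' hxy
    · exact H y hy x hx h' hxy.symm
  intro x hx y hy hxy heq
  obtain ⟨c, hc, hext⟩ := exists_isLocalExtr_Ioo hxy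
    (hcont.mono (Icc_subset_Icc (ha.trans hx.1) (hy.2.trans hb))) heq
  have hc01 : c ∈ Ioo (0 : ℝ) 1 := ⟨by linarith [hx.1, hc.1], by linarith [hy.2, hc.2]⟩
  obtain ⟨δ, hδ, hmono⟩ := exists_monotoneOn_of_not_isCritical hc01
    (h c ⟨hx.1.trans_lt hc.1, hc.2.trans_le hy.2⟩)
  have hright : ∀ η > 0, (∀ s ∈ Ioo c (c + η), height e (G.arc i s) = height e (G.arc i c)) →
      False := by
    intro η hη hs
    obtain ⟨u, hu, v, hv, huv⟩ := he.exists_ne i hc01.1.le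
      (lt_min (by linarith) hc01.2 : c < min (c + η) 1) (min_le_right _ _)
    exact huv ((hs u ⟨hu.1, hu.2.trans_le (min_le_left _ _)⟩).trans
      (hs v ⟨hv.1, hv.2.trans_le (min_le_left _ _)⟩).symm)
  have hleft : ∀ η > 0, (∀ s ∈ Ioo (c - η) c, height e (G.arc i s) = height e (G.arc i c)) →
      False := by
    intro η hη hs
    obtain ⟨u, hu, v, hv, huv⟩ := he.exists_ne i (le_max_right (c - η) 0)
      (max_lt (by linarith) hc01.1 : max (c - η) 0 < c) hc01.2.le
    exact huv ((hs u ⟨(le_max_left _ _).trans_lt hu.1, hu.2⟩).trans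
      (hs v ⟨(le_max_left _ _).trans_lt hv.1, hv.2⟩).symm)
  rcases hext with hext | hext <;> obtain ⟨θ, hθ, hball⟩ := Metric.eventually_nhds_iff.1 hext <;>
    rcases hmono with ⟨hr, hl⟩ | ⟨hr, hl⟩
  · refine hleft (min δ θ) (lt_min hδ hθ) fun s hs => ?_
    have h1 := min_le_left δ θ
    have h2 := min_le_right δ θ
    refine le_antisymm (hl ⟨by linarith [hs.1], hs.2.le⟩ ⟨by linarith, le_rfl⟩ hs.2.le) (hball ?_)
    rw [Real.dist_eq, abs_lt]
    constructor <;> linarith [hs.1, hs.2]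
  · refine hright (min δ θ) (lt_min hδ hθ) fun s hs => ?_
    have h1 := min_le_left δ θ
    have h2 := min_le_right δ θ
    refine le_antisymm (hr ⟨le_rfl, by linarith⟩ ⟨hs.1.le, by linarith [hs.2]⟩ hs.1.le) (hball ?_)
    rw [Real.dist_eq, abs_lt]
    constructor <;> linarith [hs.1, hs.2]
  · refine hright (min δ θ) (lt_min hδ hθ) fun s hs => ?_
    have h1 := min_le_left δ θ
    have h2 := min_le_right δ θ
    refine le_antisymm (hball ?_) (hr ⟨le_rfl, by linarith⟩ ⟨hs.1.le, by linarith [hs.2]⟩ hs.1.le)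
    rw [Real.dist_eq, abs_lt]
    constructor <;> linarith [hs.1, hs.2]
  · refine hleft (min δ θ) (lt_min hδ hθ) fun s hs => ?_
    have h1 := min_le_left δ θ
    have h2 := min_le_right δ θ
    refine le_antisymm (hball ?_) (hl ⟨by linarith [hs.1], hs.2.le⟩ ⟨by linarith, le_rfl⟩ hs.2.le)
    rw [Real.dist_eq, abs_lt]
    constructor <;> linarith [hs.1, hs.2]

theorem IsGeneric.strictMonoOn_path {e : S2} (he : G.IsGeneric e) {d : Fin G.numEdges × Bool}
    {a b : ℝ} (ha : 0 ≤ a) (hab : a ≤ b) (hb : b ≤ 1)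
    (h : ∀ s ∈ Ioo a b, ¬ G.IsCritical e (G.path d s)) :
    StrictMonoOn (fun s => height e (G.path d s)) (Icc a b) ∨
      StrictAntiOn (fun s => height e (G.path d s)) (Icc a b) := by
  refine ContinuousOn.strictMonoOn_of_injOn_Icc' hab (((continuous_height e).comp_continuousOn
    (G.continuousOn_path d)).mono (Icc_subset_Icc ha hb)) ?_
  obtain ⟨i, c⟩ := d
  cases c
  · intro x hx y hy hxy
    have := he.injOn_of_not_isCritical (i := i) (a := 1 - b) (b := 1 - a) (by linarith)
      (by linarith) (fun s hs => by
        have := h (1 - s) ⟨by linarith [hs.2], by linarith [hs.1]⟩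
        simpa [path] using this)
      (x₁ := 1 - x) ⟨by linarith [hx.2], by linarith [hx.1]⟩
      (x₂ := 1 - y) ⟨by linarith [hy.2], by linarith [hy.1]⟩ (by simpa [path] using hxy)
    linarith
  · simpa [path] using he.injOn_of_not_isCritical (i := i) ha hb (by simpa [path] using h)

/-! ### Finiteness of the set of critical points -/

theorem half_le_abs_nlm (P : PolygonalGraph) {e : S2} {q : E3} (hne : Nonempty (P.Star q))
    (h : (∀ d : P.Star q, height e (P.tgt d.1) < height e q) ∨
      (∀ d : P.Star q, height e q < height e (P.tgt d.1))) : 1 / 2 ≤ |P.nlm e q| := by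
  classical
  have hcard : (1 : ℝ) ≤ Fintype.card (P.Star q) := by
    exact_mod_cast Fintype.card_pos
  rw [PolygonalGraph.nlm_eq_sum, abs_mul]
  have : |∑ d : P.Star q, Real.sign (height e q - height e (P.tgt d.1))|
      = Fintype.card (P.Star q) := by
    rcases h with h | h
    · rw [Finset.sum_congr rfl fun d _ => Real.sign_of_pos (sub_pos.2 (h d))]
      simp
    · rw [Finset.sum_congr rfl fun d _ => Real.sign_of_neg (sub_neg.2 (h d))]
      simp
  rw [this, abs_of_pos (by norm_num)]
  linarith

/-- Near each critical point of the edge there are `x < y < z` with the height at `y` strictly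
above, or strictly below, both others. Inserting all these points gives `|nlm| ≥ 1/2` at each `y`,
and `mult` is half the sum of `|nlm|`. -/
theorem card_le_mult {e : S2} {i : Fin G.numEdges} (T : Finset ℝ)
    (hT : ∀ t ∈ T, t ∈ Ioo (0 : ℝ) 1 ∧ G.IsCritical e (G.arc i t)) :
    ∃ U : ContinuousGraph, U.carrier = G.carrier ∧ (T.card : ℝ) / 4 ≤ U.inscribed.mult e := by
  classical
  -- The windows `[t - δ, t + δ]` must lie in `(0, 1)` and be pairwise disjoint, so that triples of
  -- different points do not interfere.
  have hδ : ∀ᶠ δ in 𝓝[>] (0 : ℝ), ∀ t ∈ T, (δ < t ∧ δ < 1 - t) ∧ ∀ t' ∈ T, t ≠ t' →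
      δ < |t - t'| / 2 := by
    rw [Filter.eventually_all_finset]
    intro t ht
    have h01 := (hT t ht).1
    refine Filter.Eventually.and ?_ ?_
    · filter_upwards [Ioo_mem_nhdsGT h01.1, Ioo_mem_nhdsGT (sub_pos.2 h01.2)] with δ h1 h2
      exact ⟨h1.2, h2.2⟩
    · rw [Filter.eventually_all_finset]
      intro t' _
      by_cases h : t = t'
      · exact Eventually.of_forall fun _ h' => absurd h h'
      · have : 0 < |t - t'| / 2 := half_pos (abs_pos.2 (sub_ne_zero.2 h))
        filter_upwards [Ioo_mem_nhdsGT this] with δ h1 _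
        exact h1.2
  obtain ⟨δ, hδ, hδ0⟩ := (hδ.and self_mem_nhdsWithin).exists
  have htriple : ∀ t : T, ∃ x ∈ Icc (t.1 - δ) (t.1 + δ), ∃ y ∈ Icc (t.1 - δ) (t.1 + δ),
      ∃ z ∈ Icc (t.1 - δ) (t.1 + δ), x < y ∧ y < z ∧
      (height e (G.arc i x) < height e (G.arc i y) ∧ height e (G.arc i z) < height e (G.arc i y) ∨
        height e (G.arc i y) < height e (G.arc i x) ∧
          height e (G.arc i y) < height e (G.arc i z)) := by
    intro t
    have h1 := (hT t t.2).1
    have h2 : ¬ MonotoneOn (fun s => height e (G.arc i s)) (Icc (t.1 - δ) (t.1 + δ)) ∧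
        ¬ AntitoneOn (fun s => height e (G.arc i s)) (Icc (t.1 - δ) (t.1 + δ)) := by
      constructor
      · exact fun h => not_isCritical_of_monotoneOn hδ0 h1 (Or.inl h) (hT t t.2).2
      · exact fun h => not_isCritical_of_monotoneOn hδ0 h1 (Or.inr h) (hT t t.2).2
    exact not_monotoneOn_not_antitoneOn_iff_exists_lt_lt.1 h2
  choose x hx y hy z hz hxy hyz hext using htriple
  have h01 : ∀ t : T, ∀ s ∈ Icc (t.1 - δ) (t.1 + δ), s ∈ Ioo (0 : ℝ) 1 := by
    intro t s hs
    have := (hδ t t.2).1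
    exact ⟨by linarith [hs.1], by linarith [hs.2]⟩
  have hsep : ∀ t t' : T, ∀ s ∈ Icc (t.1 - δ) (t.1 + δ), s ∈ Icc (t'.1 - δ) (t'.1 + δ) →
      t = t' := by
    intro t t' s hs hs'
    by_contra hne
    have h1 := (hδ t t.2).2 t' t'.2 fun h => hne (Subtype.ext h)
    have h2 : |t.1 - t'.1| ≤ 2 * δ := by
      rw [abs_le]
      constructor <;> linarith [hs.1, hs.2, hs'.1, hs'.2]
    linarith
  obtain ⟨U, hU, ⟨f⟩⟩ := G.exists_refinement (V := Finset.univ.biUnion fun t : T =>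
    {G.arc i (x t), G.arc i (y t), G.arc i (z t)}) (by
      intro p hp
      simp only [Finset.coe_biUnion, mem_iUnion, Finset.coe_insert, Finset.coe_singleton] at hp
      obtain ⟨t, -, hp⟩ := hp
      rcases hp with rfl | rfl | rfl
      · exact G.arc_mem_carrier i (Ioo_subset_Icc_self (h01 t _ (hx t)))
      · exact G.arc_mem_carrier i (Ioo_subset_Icc_self (h01 t _ (hy t)))
      · exact G.arc_mem_carrier i (Ioo_subset_Icc_self (h01 t _ (hz t))))
  have hmemU : ∀ t : T, G.arc i (x t) ∈ U.verts ∧ G.arc i (y t) ∈ U.verts ∧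
      G.arc i (z t) ∈ U.verts := by
    intro t
    have : ∀ p, p ∈ ({G.arc i (x t), G.arc i (y t), G.arc i (z t)} : Finset E3) → p ∈ U.verts := by
      intro p hp
      rw [hU]
      exact Finset.mem_union_right _ (Finset.mem_biUnion.2 ⟨t, Finset.mem_univ _, hp⟩)
    exact ⟨this _ (by simp), this _ (by simp), this _ (by simp)⟩
  have honly : ∀ t : T, ∀ s ∈ Icc (t.1 - δ) (t.1 + δ), G.arc i s ∈ U.verts →
      s = x t ∨ s = y t ∨ s = z t := by
    intro t s hs hsU
    have hs01 := h01 t s hs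
    rw [hU, Finset.mem_union, Finset.mem_biUnion] at hsU
    rcases hsU with h | ⟨t', -, h⟩
    · exact absurd h (G.arc_notMem_verts i s hs01)
    simp only [Finset.mem_insert, Finset.mem_singleton] at h
    rcases h with h | h | h
    · obtain ⟨-, rfl⟩ := (G.arc_eq_arc_iff hs01 (h01 t' _ (hx t'))).1 h
      rw [hsep t t' _ hs (hx t')]; simp
    · obtain ⟨-, rfl⟩ := (G.arc_eq_arc_iff hs01 (h01 t' _ (hy t'))).1 h
      rw [hsep t t' _ hs (hy t')]; simp
    · obtain ⟨-, rfl⟩ := (G.arc_eq_arc_iff hs01 (h01 t' _ (hz t'))).1 h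
      rw [hsep t t' _ hs (hz t')]; simp
  refine ⟨U, f.carrier_eq, ?_⟩
  have hnlm : ∀ t : T, 1 / 2 ≤ |U.inscribed.nlm e (G.arc i (y t))| := by
    intro t
    have hy01 := h01 t _ (hy t)
    have hstart : ∀ k, ∀ s ∈ Icc (0 : ℝ) 1, G.arc (f.ι k) s = G.arc i (y t) →
        f.ι k = i ∧ s = y t := by
      intro k s hs h
      have hv : G.arc (f.ι k) s ∉ G.verts := h ▸ G.arc_notMem_verts i _ hy01
      rw [G.arc_mem_verts_iff hs, not_or] at hv
      exact (G.arc_eq_arc_iff ⟨hs.1.lt_of_ne' hv.1, hs.2.lt_of_ne hv.2⟩ hy01).1 h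
    -- The neighbours of the middle vertex are the outer points of its own triple, as its window
    -- contains no other vertices.
    have htgt : ∀ d : U.inscribed.Star (G.arc i (y t)),
        U.inscribed.tgt d.1 = G.arc i (x t) ∨ U.inscribed.tgt d.1 = G.arc i (z t) := by
      suffices H : ∀ (k : Fin U.numEdges) (c : Bool), U.path (k, c) 0 = G.arc i (y t) →
          U.path (k, c) 1 = G.arc i (x t) ∨ U.path (k, c) 1 = G.arc i (z t) by
        rintro ⟨⟨k, c⟩, hd⟩
        have := H k c
        rw [path_zero, path_one] at this
        exact this hd
      intro k c hd
      rw [path_zero] at hd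
      rw [path_one]
      have hα := f.α_mem k
      have hβ := f.β_mem k
      have hαβ := f.α_lt_β k
      cases c
      · change U.arc k 1 = _ at hd
        rw [f.arc_one] at hd
        obtain ⟨h1, h2⟩ := hstart k _ ⟨hβ.1.le, hβ.2⟩ hd
        left
        change U.arc k 0 = _
        have h3 : x t ≤ f.α k := by
          rcases f.le_or_le (k := k) (s := x t) (by rw [h1]; exact (hmemU t).1) with h | h
          · exact h
          · linarith [hxy t]
        rw [f.arc_zero, h1]
        rcases honly t (f.α k) ⟨by linarith [(hx t).1], by linarith [(hy t).2]⟩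
          (by rw [← h1, ← f.arc_zero]; exact U.arc_zero_mem k) with h | h | h
        · rw [h]
        · linarith
        · linarith [hyz t]
      · change U.arc k 0 = _ at hd
        rw [f.arc_zero] at hd
        obtain ⟨h1, h2⟩ := hstart k _ ⟨hα.1, hα.2.le⟩ hd
        right
        change U.arc k 1 = _
        have h3 : f.β k ≤ z t := by
          rcases f.le_or_le (k := k) (s := z t) (by rw [h1]; exact (hmemU t).2.2) with h | h
          · linarith [hyz t]
          · exact h
        rw [f.arc_one, h1]
        rcases honly t (f.β k) ⟨by linarith [(hy t).1], by linarith [(hz t).2]⟩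
          (by rw [← h1, ← f.arc_one]; exact U.arc_one_mem k) with h | h | h
        · linarith [hxy t]
        · linarith
        · rw [h]
    have hne : Nonempty (U.inscribed.Star (G.arc i (y t))) := by
      obtain ⟨k, rfl, hk⟩ := f.exists_α_eq (i := i) hy01.1.le hy01.2 (hmemU t).2.1
      refine ⟨⟨(k, true), ?_⟩⟩
      change U.arc k 0 = _
      rw [f.arc_zero, hk]
    refine half_le_abs_nlm _ hne ?_
    rcases hext t with h | h
    · left
      intro d
      rcases htgt d with h' | h' <;> rw [h']
      exacts [h.1, h.2]
    · right
      intro d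
      rcases htgt d with h' | h' <;> rw [h']
      exacts [h.1, h.2]
  have hinj : Function.Injective fun t : T => G.arc i (y t) := by
    intro t t' h
    have := ((G.arc_eq_arc_iff (h01 t _ (hy t)) (h01 t' _ (hy t'))).1 h).2
    exact hsep t t' (y t) (hy t) (this ▸ hy t')
  rw [PolygonalGraph.mult_eq_sum_abs]
  have hsub : Finset.univ.image (fun t : T => G.arc i (y t)) ⊆ U.inscribed.verts := by
    intro p hp
    simp only [Finset.mem_image, Finset.mem_univ, true_and] at hp
    obtain ⟨t, rfl⟩ := hp
    exact (hmemU t).2.1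
  have h1 := Finset.sum_le_sum_of_subset_of_nonneg hsub
    (f := fun q => |U.inscribed.nlm e q|) fun _ _ _ => abs_nonneg _
  rw [Finset.sum_image fun _ _ _ _ h => hinj h] at h1
  have h2 : (T.card : ℝ) * (1 / 2) ≤ ∑ t : T, |U.inscribed.nlm e (G.arc i (y t))| := by
    have := Finset.card_nsmul_le_sum Finset.univ
      (fun t : T => |U.inscribed.nlm e (G.arc i (y t))|) (1 / 2) fun t _ => hnlm t
    simpa using this
  linarith

theorem finite_isCritical {e : S2} (h : G.supMult e ≠ ⊤) : {q | G.IsCritical e q}.Finite := by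
  have hfin : ∀ i, {t | t ∈ Ioo (0 : ℝ) 1 ∧ G.IsCritical e (G.arc i t)}.Finite := by
    intro i
    by_contra hinf
    obtain ⟨n, hn⟩ := exists_nat_gt (4 * (G.supMult e).toReal)
    obtain ⟨T, hT, hcard⟩ := Set.Infinite.exists_subset_card_eq hinf n
    obtain ⟨U, hU, hle⟩ := card_le_mult (i := i) T fun t ht => hT ht
    have := (ENNReal.ofReal_le_iff_le_toReal h).1 (le_supMult hU e)
    rw [hcard] at hle
    linarith
  refine (G.verts.finite_toSet.union (finite_iUnion fun i => (hfin i).image (G.arc i))).subset ?_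
  intro q hq
  rcases G.mem_carrier_iff.1 hq.1 with h | ⟨i, s, hs, rfl⟩
  · exact Or.inl h
  · exact Or.inr (mem_iUnion.2 ⟨i, s, ⟨hs, hq⟩, rfl⟩)

theorem IsGeneric.exists_strictMonoOn_path {e : S2} (he : G.IsGeneric e)
    (hfin : {q | G.IsCritical e q}.Finite) (d : Fin G.numEdges × Bool) {t : ℝ}
    (ht : t ∈ Ico (0 : ℝ) 1) : ∃ u, t < u ∧ u ≤ 1 ∧
      (StrictMonoOn (fun s => height e (G.path d s)) (Icc t u) ∨
        StrictAntiOn (fun s => height e (G.path d s)) (Icc t u)) := by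
  have hfin' : {s | s ∈ Ioo t 1 ∧ G.IsCritical e (G.path d s)}.Finite := by
    refine Set.Finite.of_finite_image (f := G.path d) (hfin.subset ?_) ?_
    · rintro _ ⟨s, hs, rfl⟩
      exact hs.2
    · intro s hs s' hs' h
      exact G.path_injOn d ⟨ht.1.trans hs.1.1.le, hs.1.2.le⟩ ⟨ht.1.trans hs'.1.1.le, hs'.1.2.le⟩ h
  have hnhds : {s | s ∈ Ioo t 1 ∧ G.IsCritical e (G.path d s)}ᶜ ∈ 𝓝 t :=
    hfin'.isClosed.isOpen_compl.mem_nhds fun h => lt_irrefl _ h.1.1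
  obtain ⟨η, hη, hball⟩ := Metric.mem_nhds_iff.1 hnhds
  have h1 : t < min (t + η) 1 := lt_min (by linarith) ht.2
  refine ⟨min (t + η) 1, h1, min_le_right _ _, he.strictMonoOn_path ht.1 h1.le (min_le_right _ _)
    fun s hs hcrit => ?_⟩
  have h2 := hs.2.trans_le (min_le_left _ _)
  refine hball (a := s) ?_ ⟨⟨hs.1, hs.2.trans_le (min_le_right _ _)⟩, hcrit⟩
  rw [Metric.mem_ball, Real.dist_eq, abs_lt]
  constructor <;> linarith [hs.1]

end ContinuousGraph

namespace ContinuousGraph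

variable {G U : ContinuousGraph}

/-! ### The multiplicity as a sum over the critical points -/

theorem Refinement.exists_path_eq (f : Refinement U G) (k : Fin U.numEdges) (c : Bool) :
    ∃ t u : ℝ, 0 ≤ t ∧ t < u ∧ u ≤ 1 ∧ G.path (f.ι k, c) t = U.path (k, c) 0 ∧
      G.path (f.ι k, c) u = U.path (k, c) 1 ∧ ∀ s ∈ Ioo t u, G.path (f.ι k, c) s ∉ U.verts := by
  have hα := f.α_mem k
  have hβ := f.β_mem k
  have hαβ := f.α_lt_β k
  cases c
  · refine ⟨1 - f.β k, 1 - f.α k, by linarith [hβ.2], by linarith, by linarith [hα.1], ?_, ?_, ?_⟩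
    · simp [path, f.arc_one]
    · simp [path, f.arc_zero]
    · intro s hs
      simpa [path] using f.notMem_verts (k := k) (s := 1 - s)
        ⟨by linarith [hs.2], by linarith [hs.1]⟩
  · refine ⟨f.α k, f.β k, hα.1, hαβ, hβ.2, ?_, ?_, ?_⟩
    · simp [path, f.arc_zero]
    · simp [path, f.arc_one]
    · intro s hs
      simpa [path] using f.notMem_verts hs

/-- For a strictly monotone height the germ at `q` and the chord to the far end point the same way.
-/
theorem along_iff_of_strictMonoOn {e : S2} {q : E3} {d : Fin G.numEdges × Bool} {t u : ℝ}
    (ht : 0 ≤ t) (htu : t < u) (hu : u ≤ 1) (hq : G.path d t = q)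
    (h : StrictMonoOn (fun s => height e (G.path d s)) (Icc t u) ∨
      StrictAntiOn (fun s => height e (G.path d s)) (Icc t u)) :
    (G.Along q d (fun t ε => height e (G.path d (t + ε)) ≤ height e q)
        ↔ height e (G.path d u) ≤ height e q) ∧
      (G.Along q d (fun t ε => height e q ≤ height e (G.path d (t + ε)))
        ↔ height e q ≤ height e (G.path d u)) ∧ height e (G.path d u) ≠ height e q := by
  have ht' : t ∈ Ico (0 : ℝ) 1 := ⟨ht, htu.trans_le hu⟩
  rw [along_iff ht' hq, along_iff ht' hq]
  have hsmall := Ioo_mem_nhdsGT (sub_pos.2 htu)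
  subst hq
  rcases h with h | h
  · have h1 : ∀ᶠ ε in 𝓝[>] (0 : ℝ), height e (G.path d t) < height e (G.path d (t + ε)) := by
      filter_upwards [hsmall] with ε hε
      exact h ⟨le_rfl, htu.le⟩ ⟨by linarith [hε.1], by linarith [hε.2]⟩ (by linarith [hε.1])
    have h2 : height e (G.path d t) < height e (G.path d u) :=
      h ⟨le_rfl, htu.le⟩ ⟨htu.le, le_rfl⟩ htu
    refine ⟨⟨fun h3 => ?_, fun h3 => absurd h3 h2.not_ge⟩,
      ⟨fun _ => h2.le, fun _ => h1.mono fun _ h => h.le⟩, h2.ne'⟩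
    obtain ⟨ε, h4, h5⟩ := (h1.and h3).exists
    exact absurd h5 h4.not_ge
  · have h1 : ∀ᶠ ε in 𝓝[>] (0 : ℝ), height e (G.path d (t + ε)) < height e (G.path d t) := by
      filter_upwards [hsmall] with ε hε
      exact h ⟨le_rfl, htu.le⟩ ⟨by linarith [hε.1], by linarith [hε.2]⟩ (by linarith [hε.1])
    have h2 : height e (G.path d u) < height e (G.path d t) :=
      h ⟨le_rfl, htu.le⟩ ⟨htu.le, le_rfl⟩ htu
    refine ⟨⟨fun _ => h2.le, fun _ => h1.mono fun _ h => h.le⟩,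
      ⟨fun h3 => ?_, fun h3 => absurd h3 h2.not_ge⟩, h2.ne⟩
    obtain ⟨ε, h4, h5⟩ := (h1.and h3).exists
    exact absurd h5 h4.not_ge

theorem ncard_star (q : E3) (p : Fin U.numEdges × Bool → Prop) :
    {d : U.inscribed.Star q | p d.1}.ncard = {d | U.path d 0 = q ∧ p d}.ncard := by
  rw [← Set.ncard_image_of_injective _ Subtype.val_injective]
  congr 1
  ext d
  have hsrc : U.inscribed.src d = U.path d 0 := (path_zero d).symm
  constructor
  · rintro ⟨⟨d, hd⟩, h, rfl⟩
    exact ⟨hsrc.symm.trans hd, h⟩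
  · rintro ⟨hd, h⟩
    exact ⟨⟨d, hsrc.trans hd⟩, h, rfl⟩

theorem IsGeneric.along_iff_of_refinement {e : S2} (he : G.IsGeneric e) (f : Refinement U G)
    (hcrit : ∀ q, G.IsCritical e q → q ∈ U.verts) {q : E3} (b : G.Branch q) {k : Fin U.numEdges}
    (hk : f.ι k = b.1.1) (hq : U.path (k, b.1.2) 0 = q) :
    (G.Along q b.1 (fun t ε => height e (G.path b.1 (t + ε)) ≤ height e q)
        ↔ height e (U.path (k, b.1.2) 1) ≤ height e q) ∧
      (G.Along q b.1 (fun t ε => height e q ≤ height e (G.path b.1 (t + ε)))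
        ↔ height e q ≤ height e (U.path (k, b.1.2) 1)) ∧
      height e (U.path (k, b.1.2) 1) ≠ height e q := by
  obtain ⟨⟨i, c⟩, hb⟩ := b
  dsimp only at hk hq ⊢
  subst hk
  obtain ⟨t, u, h1, h2, h3, h4, h5, h6⟩ := f.exists_path_eq k c
  rw [← h5]
  exact along_iff_of_strictMonoOn h1 h2 h3 (h4.trans hq)
    (he.strictMonoOn_path h1 h2.le h3 fun s hs hc => h6 s hs (hcrit _ hc))

theorem IsGeneric.below_iff_not_above {e : S2} (he : G.IsGeneric e) (f : Refinement U G)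
    (hcrit : ∀ q, G.IsCritical e q → q ∈ U.verts) {q : E3} (hq : q ∈ U.verts) (b : G.Branch q) :
    G.Along q b.1 (fun t ε => height e (G.path b.1 (t + ε)) ≤ height e q) ↔
      ¬ G.Along q b.1 (fun t ε => height e q ≤ height e (G.path b.1 (t + ε))) := by
  obtain ⟨k, hk, hkq⟩ := (f.exists_path_eq_iff hq b.1).1 b.2
  obtain ⟨h1, h2, h3⟩ := he.along_iff_of_refinement f hcrit b hk hkq
  rw [h1, h2, not_le]
  exact ⟨fun h => h.lt_of_ne h3, le_of_lt⟩

/-- When all critical points are vertices, every arc is strictly monotone in height, so chords rise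
exactly where arcs do. Each end being strictly up or down, the parameterization is irrelevant by
`DoublePairing.nlm_eq`. -/
theorem IsGeneric.nlm_eq_inscribed_nlm {e : S2} (he : G.IsGeneric e) (f : Refinement U G)
    (hcrit : ∀ q, G.IsCritical e q → q ∈ U.verts) {q : E3} (hq : q ∈ U.verts)
    (τ : DoublePairing (G.Branch q)) : G.nlm e q τ = U.inscribed.nlm e q := by
  rw [nlm, DoublePairing.nlm_eq _ _ _ (he.below_iff_not_above f hcrit hq), PolygonalGraph.nlm,
    DoublePairing.nlm, DoublePairing.count_standard, DoublePairing.count_standard]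
  have htgt : ∀ d, U.inscribed.tgt d = U.path d 1 := fun d => (path_one d).symm
  simp only [htgt]
  rw [ncard_star q fun d => height e (U.path d 1) ≤ height e q,
    ncard_star q fun d => height e q ≤ height e (U.path d 1),
    f.ncard_branch hq _ (fun d => height e (U.path d 1) ≤ height e q)
      fun b k hk hkq => (he.along_iff_of_refinement f hcrit b hk hkq).1,
    f.ncard_branch hq _ (fun d => height e q ≤ height e (U.path d 1))
      fun b k hk hkq => (he.along_iff_of_refinement f hcrit b hk hkq).2.1]

/-- There are two branches, one going up and one going down, and their contributions cancel. -/
theorem IsGeneric.nlm_eq_zero {e : S2} (he : G.IsGeneric e) (f : Refinement U G)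
    (hcrit : ∀ q, G.IsCritical e q → q ∈ U.verts) {q : E3} (hq : q ∈ U.verts)
    (hncrit : ¬ G.IsCritical e q) : U.inscribed.nlm e q = 0 := by
  have hqG : q ∈ G.carrier := f.carrier_eq ▸ U.verts_subset_carrier hq
  have hval : Nat.card (G.Branch q) = 2 := by
    by_contra h
    exact hncrit ⟨hqG, Or.inl ⟨hqG, h⟩⟩
  have hex : ∃ b b' : G.Branch q, b ≠ b' ∧
      G.Along q b.1
        (fun t ε => MonotoneOn (fun s => height e (G.path b.1 s)) (Icc t (t + ε))) ∧
      G.Along q b'.1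
        (fun t ε => AntitoneOn (fun s => height e (G.path b'.1 s)) (Icc t (t + ε))) := by
    by_contra h
    exact hncrit ⟨hqG, Or.inr h⟩
  obtain ⟨b, b', hne, ⟨t, ht, htq, hm⟩, ⟨t', ht', htq', ha⟩⟩ := hex
  have habove : G.Along q b.1 (fun t ε => height e q ≤ height e (G.path b.1 (t + ε))) := by
    refine ⟨t, ht, htq, ?_⟩
    filter_upwards [hm, self_mem_nhdsWithin] with ε hε hpos
    have h0 : t ≤ t + ε := by linarith [mem_Ioi.1 hpos]
    have h1 := hε ⟨le_rfl, h0⟩ ⟨h0, le_rfl⟩ h0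
    simp only [htq] at h1
    exact h1
  have hbelow : G.Along q b'.1 (fun t ε => height e (G.path b'.1 (t + ε)) ≤ height e q) := by
    refine ⟨t', ht', htq', ?_⟩
    filter_upwards [ha, self_mem_nhdsWithin] with ε hε hpos
    have h0 : t' ≤ t' + ε := by linarith [mem_Ioi.1 hpos]
    have h1 := hε ⟨le_rfl, h0⟩ ⟨h0, le_rfl⟩ h0
    simp only [htq'] at h1
    exact h1
  have hiff := he.below_iff_not_above f hcrit hq
  have hall : ∀ x, x = b ∨ x = b' := by
    intro x
    by_contra! h
    exact h.2 (((Nat.card_eq_two_iff' b).1 hval).unique h.1 hne.symm)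
  have h1 : {x : G.Branch q | G.Along q x.1
      (fun t ε => height e (G.path x.1 (t + ε)) ≤ height e q)} = {b'} := by
    ext x
    constructor
    · intro hx
      rcases hall x with rfl | rfl
      · exact absurd habove ((hiff _).1 hx)
      · rfl
    · rintro rfl
      exact hbelow
  have h2 : {x : G.Branch q | G.Along q x.1
      (fun t ε => height e q ≤ height e (G.path x.1 (t + ε)))} = {b} := by
    ext x
    constructor
    · intro hx
      rcases hall x with rfl | rfl
      · rfl
      · exact absurd hx ((hiff _).1 hbelow)
    · rintro rfl
      exact habove
  rw [← he.nlm_eq_inscribed_nlm f hcrit hq (DoublePairing.standard _), nlm,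
    DoublePairing.nlm_eq _ _ _ hiff, h1, h2]
  simp

/-- Adding the critical points to a maximizing subdivision keeps it maximizing, and its noncritical
vertices contribute nothing. -/
theorem IsGeneric.supMult_eq_sum {e : S2} (he : G.IsGeneric e) (h : G.supMult e ≠ ⊤)
    (hfin : {q | G.IsCritical e q}.Finite) (τ : (q : E3) → DoublePairing (G.Branch q)) :
    G.supMult e = ∑ q ∈ hfin.toFinset, ENNReal.ofReal ((G.nlm e q (τ q))⁺) := by
  obtain ⟨T, hT, hmax⟩ := exists_mult_eq_supMult h
  obtain ⟨U, hU, ⟨f⟩⟩ := G.exists_refinement (V := T.verts ∪ hfin.toFinset) (by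
    rw [Finset.coe_union, hfin.coe_toFinset]
    exact union_subset (hT ▸ T.verts_subset_carrier) fun q hq => hq.1)
  have hcrit : ∀ q, G.IsCritical e q → q ∈ U.verts := fun q hq => by
    rw [hU]
    exact Finset.mem_union_right _ (Finset.mem_union_right _ (hfin.mem_toFinset.2 hq))
  have hTU : T.verts ⊆ U.verts := fun q hq => by
    rw [hU]
    exact Finset.mem_union_right _ (Finset.mem_union_left _ hq)
  have h1 : G.supMult e = ENNReal.ofReal (U.inscribed.mult e) := by
    refine le_antisymm ?_ (le_supMult f.carrier_eq e)
    rw [hmax]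
    exact ENNReal.ofReal_le_ofReal (mult_mono (hT.trans f.carrier_eq.symm) hTU e)
  rw [h1, PolygonalGraph.mult, ENNReal.ofReal_sum_of_nonneg fun _ _ => posPart_nonneg _]
  symm
  have hsub : hfin.toFinset ⊆ U.verts := fun q hq => hcrit q (hfin.mem_toFinset.1 hq)
  rw [Finset.sum_congr rfl fun q hq => by rw [he.nlm_eq_inscribed_nlm f hcrit (hsub hq)]]
  refine Finset.sum_subset hsub fun q hq hq' => ?_
  rw [he.nlm_eq_zero f hcrit hq fun h => hq' (hfin.mem_toFinset.2 h)]
  simp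

end ContinuousGraph

/-! ### One-sided tangents -/

theorem exists_separating {p : S2 → Prop} (hp : ∀ᵐ e ∂area, p e) {T T' : E3} (hT : ‖T‖ = 1)
    (hT' : ‖T'‖ = 1) (hne : T ≠ T') : ∃ e, p e ∧ height e T < 0 ∧ 0 < height e T' := by
  have hopen : IsOpen {e : S2 | height e T < 0 ∧ 0 < height e T'} :=
    (isOpen_lt (continuous_height_left T) continuous_const).inter
      (isOpen_lt continuous_const (continuous_height_left T'))
  have hpos : 0 < ‖T' - T‖ := norm_pos_iff.2 (sub_ne_zero.2 hne.symm)
  have hlt : inner ℝ T T' < 1 := (inner_lt_one_iff_real_of_norm_eq_one hT hT').2 hne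
  -- The normalized difference `T' - T` separates two distinct unit vectors because their inner
  -- product is below `1`; a set of full measure is dense, so it meets the open set of separating
  -- directions.
  obtain ⟨e, he, hpe⟩ := (Measure.dense_of_ae hp).exists_mem_open hopen
    ⟨⟨‖T' - T‖⁻¹ • (T' - T), by
      rw [mem_sphere_zero_iff_norm, norm_smul, norm_inv, norm_norm, inv_mul_cancel₀ hpos.ne']⟩, by
      simp only [mem_ofPred_eq, height, inner_smul_left, inner_sub_left, conj_trivial,
        real_inner_self_eq_norm_sq, hT, hT', real_inner_comm T T']
      constructor
      · exact mul_neg_of_pos_of_neg (inv_pos.2 hpos) (by linarith)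
      · exact mul_pos (inv_pos.2 hpos) (by linarith)⟩
  exact ⟨e, he, hpe⟩

theorem height_nonneg_of_mapClusterPt {l : Filter ℝ} {f : ℝ → E3} {T : E3} {e : S2}
    (hT : MapClusterPt T l f) (h : ∀ᶠ s in l, 0 ≤ height e (f s)) : 0 ≤ height e T := by
  by_contra! hneg
  have := mapClusterPt_iff_frequently.1 hT _
    ((isOpen_lt (continuous_height e) continuous_const).mem_nhds hneg)
  obtain ⟨s, h1, h2⟩ := (this.and_eventually h).exists
  exact absurd h2 (not_le.2 h1)

theorem height_nonpos_of_mapClusterPt {l : Filter ℝ} {f : ℝ → E3} {T : E3} {e : S2}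
    (hT : MapClusterPt T l f) (h : ∀ᶠ s in l, height e (f s) ≤ 0) : height e T ≤ 0 := by
  by_contra! hneg
  have := mapClusterPt_iff_frequently.1 hT _
    ((isOpen_lt continuous_const (continuous_height e)).mem_nhds hneg)
  obtain ⟨s, h1, h2⟩ := (this.and_eventually h).exists
  exact absurd h2 (not_le.2 h1)

theorem height_unitDir (e : S2) (x y : E3) :
    height e (unitDir x y) = ‖y - x‖⁻¹ * (height e y - height e x) := by
  rw [← height_sub]; simp [unitDir, height, inner_smul_right]

/-- If almost every height is strictly monotone along a curve on the right side of each point,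
then the curve has one-sided unit tangent vectors, and they depend right continuously on the
point. -/
theorem exists_tangents {γ : ℝ → E3} (hγ : InjOn γ (Icc 0 1))
    (h : ∀ᵐ e ∂area, ∀ t ∈ Ico (0 : ℝ) 1, ∃ u, t < u ∧ u ≤ 1 ∧
      (StrictMonoOn (fun s => height e (γ s)) (Icc t u) ∨
        StrictAntiOn (fun s => height e (γ s)) (Icc t u))) :
    ∃ T : ℝ → E3, ∀ t ∈ Ico (0 : ℝ) 1, ‖T t‖ = 1 ∧
      Tendsto (fun s => unitDir (γ t) (γ s)) (𝓝[>] t) (𝓝 (T t)) ∧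
      ContinuousWithinAt T (Ici t) t := by
  have hK : IsCompact (Metric.sphere (0 : E3) 1) := isCompact_sphere _ _
  have hup : ∀ {e : S2} {t u : ℝ} {T : E3}, t < u →
      StrictMonoOn (fun s => height e (γ s)) (Icc t u) →
      MapClusterPt T (𝓝[>] t) (fun s => unitDir (γ t) (γ s)) → 0 ≤ height e T := by
    intro e t u T htu hmono hT
    refine height_nonneg_of_mapClusterPt hT ?_
    filter_upwards [Ioo_mem_nhdsGT htu] with s hs
    rw [height_unitDir]
    have := hmono ⟨le_rfl, htu.le⟩ ⟨hs.1.le, hs.2.le⟩ hs.1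
    exact mul_nonneg (inv_nonneg.2 (norm_nonneg _)) (sub_nonneg.2 this.le)
  have hdown : ∀ {e : S2} {t u : ℝ} {T : E3}, t < u →
      StrictAntiOn (fun s => height e (γ s)) (Icc t u) →
      MapClusterPt T (𝓝[>] t) (fun s => unitDir (γ t) (γ s)) → height e T ≤ 0 := by
    intro e t u T htu hmono hT
    refine height_nonpos_of_mapClusterPt hT ?_
    filter_upwards [Ioo_mem_nhdsGT htu] with s hs
    rw [height_unitDir]
    have := hmono ⟨le_rfl, htu.le⟩ ⟨hs.1.le, hs.2.le⟩ hs.1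
    exact mul_nonpos_of_nonneg_of_nonpos (inv_nonneg.2 (norm_nonneg _)) (sub_nonpos.2 this.le)
  have hlim : ∀ t, ∃ T : E3, t ∈ Ico (0 : ℝ) 1 → ‖T‖ = 1 ∧
      Tendsto (fun s => unitDir (γ t) (γ s)) (𝓝[>] t) (𝓝 T) := by
    intro t
    by_cases ht : t ∈ Ico (0 : ℝ) 1
    · have hev : ∀ᶠ s in 𝓝[>] t, unitDir (γ t) (γ s) ∈ Metric.sphere (0 : E3) 1 := by
        filter_upwards [Ioo_mem_nhdsGT ht.2] with s hs
        have hne : ‖γ s - γ t‖ ≠ 0 := by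
          rw [norm_ne_zero_iff, sub_ne_zero]
          intro h'
          exact hs.1.ne' (hγ ⟨ht.1.trans hs.1.le, hs.2.le⟩ ⟨ht.1, ht.2.le⟩ h')
        rw [mem_sphere_zero_iff_norm, unitDir, norm_smul, norm_inv, norm_norm, inv_mul_cancel₀ hne]
      obtain ⟨T, hT, hcl⟩ := hK.exists_mapClusterPt_of_frequently hev.frequently
      refine ⟨T, fun _ => ⟨mem_sphere_zero_iff_norm.1 hT,
        hK.tendsto_nhds_of_unique_mapClusterPt hev fun T' hT' hcl' => ?_⟩⟩
      by_contra hne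
      -- A height monotone just after `t` gives all cluster points of the secant directions the same
      -- weak sign, so they cannot be strictly separated.
      obtain ⟨e, he, h1, h2⟩ := exists_separating h (mem_sphere_zero_iff_norm.1 hT')
        (mem_sphere_zero_iff_norm.1 hT) hne
      obtain ⟨u, htu, -, hmono | hmono⟩ := he t ht
      · exact absurd (hup htu hmono hcl') h1.not_ge
      · exact absurd (hdown htu hmono hcl) h2.not_ge
    · exact ⟨0, fun h' => absurd h' ht⟩
  choose T hT using hlim
  refine ⟨T, fun t ht => ⟨(hT t ht).1, (hT t ht).2, ?_⟩⟩
  have hev : ∀ᶠ s in 𝓝[≥] t, s ∈ Ico (0 : ℝ) 1 := by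
    filter_upwards [Ico_mem_nhdsGE ht.2] with s hs
    exact ⟨ht.1.trans hs.1, hs.2⟩
  have hcluster : ∀ s ∈ Ico (0 : ℝ) 1,
      MapClusterPt (T s) (𝓝[>] s) (fun s' => unitDir (γ s) (γ s')) :=
    fun s hs => (hT s hs).2.mapClusterPt
  refine hK.tendsto_nhds_of_unique_mapClusterPt
    (hev.mono fun s hs => mem_sphere_zero_iff_norm.2 (hT s hs).1) fun T' hT' hcl' => ?_
  by_contra hne
  -- Monotonicity on `[t, u]` controls the sign of the height of `T s` for all `s` in `[t, u)`,
  -- hence also that of its limits as `s` decreases to `t`.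
  obtain ⟨e, he, h1, h2⟩ := exists_separating h (mem_sphere_zero_iff_norm.1 hT') (hT t ht).1 hne
  obtain ⟨u, htu, -, hmono | hmono⟩ := he t ht
  · refine absurd (height_nonneg_of_mapClusterPt hcl' ?_) h1.not_ge
    filter_upwards [Ico_mem_nhdsGE htu, hev] with s hs hs'
    exact hup hs.2 (hmono.mono (Icc_subset_Icc_left hs.1)) (hcluster s hs')
  · exact absurd (hdown htu hmono (hcluster t ht)) h2.not_ge

/-! ### Consequences of finiteness and the main theorem -/

namespace ContinuousGraph

variable {G : ContinuousGraph}

theorem hasOneSidedTangents (h : ∀ᵐ e ∂area, {q | G.IsCritical e q}.Finite) :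
    G.HasOneSidedTangents := by
  intro d
  refine exists_tangents (G.path_injOn d) ?_
  filter_upwards [h, G.ae_isGeneric] with e hfin he t ht
  exact he.exists_strictMonoOn_path hfin d ht

theorem ae_finite_isCritical (h : G.netCurv < ⊤) :
    ∀ᵐ e ∂area, {q | G.IsCritical e q}.Finite := by
  obtain ⟨φ, hφ, hae, hint⟩ := G.exists_measurable_eq_supMult
  have hne : ∫⁻ e, φ e ∂area ≠ ⊤ := by
    intro h'
    rw [hint, h', ENNReal.mul_top (by simp)] at h
    exact lt_irrefl _ h
  filter_upwards [ae_lt_top hφ hne, hae] with e he he'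
  exact finite_isCritical (he' ▸ he.ne)

theorem IsGeneric.exists_supMult_eq {e : S2} (he : G.IsGeneric e) (h : G.supMult e ≠ ⊤) :
    ∃ n : ℕ, 0 < n ∧ G.supMult e = (n : ℝ≥0∞) / 2 := by
  obtain ⟨T, hT, hmax⟩ := exists_mult_eq_supMult h
  obtain ⟨n, hn⟩ := T.inscribed.exists_mult_eq e
  have heq : G.supMult e = (n : ℝ≥0∞) / 2 := by
    rw [hmax, hn, ENNReal.ofReal_div_of_pos two_pos]
    simp
  refine ⟨n, Nat.pos_of_ne_zero ?_, heq⟩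
  rintro rfl
  have h1 := le_supMult (G := G) (S := G) rfl e
  rw [heq] at h1
  simp only [Nat.cast_zero, ENNReal.zero_div, nonpos_iff_eq_zero, ENNReal.ofReal_eq_zero] at h1
  exact absurd he.mult_pos h1.not_gt

end ContinuousGraph

end NetCurvature

end

theorem theorem4 (G : NetCurvature.ContinuousGraph) :
    0 < G.netCurv ∧
    -- the multiplicity exists, and it is well defined for almost all `e`
    (∀ e, ∃ m, G.IsMultiplicity e m) ∧
    (∀ᵐ e ∂NetCurvature.area, ∃! m, G.IsMultiplicity e m) ∧
    -- the representation of the net total curvature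
    (∀ μ : NetCurvature.S2 → ENNReal, (∀ e, G.IsMultiplicity e (μ e)) →
      AEMeasurable μ NetCurvature.area ∧
      G.netCurv = (1 / 2) * ∫⁻ e, μ e ∂NetCurvature.area ∧
      ∀ᵐ e ∂NetCurvature.area,
        μ e = ⊤ ∨
        ((∃ n : ℕ, 0 < n ∧ μ e = (n : ENNReal) / 2) ∧
          ∃ hfin : {q | G.IsCritical e q}.Finite,
            ∀ τ : (q : NetCurvature.E3) → NetCurvature.DoublePairing (G.Branch q),
              μ e = ∑ q ∈ hfin.toFinset, ENNReal.ofReal ((G.nlm e q (τ q))⁺))) ∧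
    -- consequences of finiteness
    (G.netCurv < ⊤ →
      G.HasOneSidedTangents ∧
      ∀ᵐ e ∂NetCurvature.area, {q | G.IsCritical e q}.Finite) := by
  refine ⟨G.netCurv_pos, G.exists_isMultiplicity, ?_, ?_, ?_⟩
  · filter_upwards [G.ae_isGeneric] with e he
    obtain ⟨m, hm⟩ := G.exists_isMultiplicity e
    exact ⟨m, hm, fun m' hm' => (he.eq_supMult hm').trans (he.eq_supMult hm).symm⟩
  · intro μ hμ
    obtain ⟨φ, hφ, hae, hint⟩ := G.exists_measurable_eq_supMult
    have hμφ : μ =ᵐ[NetCurvature.area] φ := by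
      filter_upwards [G.ae_isGeneric, hae] with e he he'
      rw [he', he.eq_supMult (hμ e)]
    refine ⟨⟨φ, hφ, hμφ⟩, by rw [hint, lintegral_congr_ae hμφ], ?_⟩
    filter_upwards [G.ae_isGeneric] with e he
    rw [he.eq_supMult (hμ e)]
    by_cases htop : G.supMult e = ⊤
    · exact Or.inl htop
    · have hfin := NetCurvature.ContinuousGraph.finite_isCritical htop
      exact Or.inr ⟨he.exists_supMult_eq htop, hfin, he.supMult_eq_sum htop hfin⟩
  · intro h
    have hfin := NetCurvature.ContinuousGraph.ae_finite_isCritical h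
    exact ⟨NetCurvature.ContinuousGraph.hasOneSidedTangents hfin, hfin⟩
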